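/- A \emph{constraint language} is a finite set $\Gamma$ of relations $R\subseteq\{0,1\}^r$ (of various arities $r$). An \emph{instance} of CSP over $\Gamma$ consists of a finite set $V$ of variables and a set $C$ of constraints $R(v_1,\dots,v_r)$ with $R\in\Gamma$ of arity $r$ and $v_1,\dots,v_r\in V$ (not necessarily distinct). An assignment $\sigma\colon V\to\{0,1\}$ \emph{satisfies} the instance if $(\sigma(v_1),\dots,\sigma(v_r))\in R$ for every constraint $R(v_1,\dots,v_r)\in C$; $Z(I)$ denotes the number of satisfying assignments of $I$. The degree of a variable is the number of times it appears among the constraints, counted with multiplicity inside each scope, and the degree of an instance is the maximum degree of its variables. $\#\mathrm{CSP}(\Gamma)$ is the problem of computing $Z(I)$ for an instance $I$ over $\Gamma$, and $\#\mathrm{CSP}_d(\Gamma)$ is its restriction to instances of degree at most $d$. Instances are given as words that list the variables and then the constraints. Let $\Gamma_{\mathrm{pin}}=\{R_{\mathrm{zero}},R_{\mathrm{one}}\}$ with $R_{\mathrm{zero}}=\{0\}$ and $R_{\mathrm{one}}=\{1\}$. The language $\Gamma$ \emph{$d$-simulates equality} if for every $k\ge 2$ there are $\ell\ge k$, $m\ge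 1$ and an instance $I$ over $\Gamma\cup\Gamma_{\mathrm{pin}}$ with variables $x_1,\dots,x_\ell$, of degree at most $d$ and with each of $x_1,\dots,x_k$ of degree at most $d-1$, that has exactly $m$ satisfying assignments with $\sigma(x_1)=\dots=\sigma(x_k)=0$, exactly $m$ with $\sigma(x_1)=\dots=\sigma(x_k)=1$, and no other satisfying assignments. A \emph{randomized approximation scheme} (RAS) for a counting problem $f$ produces, on input of an instance $x$ of $f$ and an error bound $\varepsilon\in(0,1)$, a random natural number $Y$ with $\Pr\bigl(e^{-\varepsilon}f(x)\le Y\le e^{\varepsilon}f(x)\bigr)\ge\frac34$. An \emph{approximation-preserving reduction} from $f$ to $g$, whose existence is written $f\le_{\mathrm{AP}}g$, is a probabilistic oracle Turing machine $M$ that takes inputs $(x,\varepsilon)$ as above and satisfies: (i) every oracle call of $M$ is of the form $(w,\delta)$, where $w$ is an instance of $g$ and $0<\delta<1$ with $\delta^{-1}\le\mathrm{poly}(|x|,\varepsilon^{-1})$; (ii) $M$ is a RAS for $f$ whenever the oracle is a RAS for $g$; (iii) the run-time of $M$ is polynomial in $|x|$ and $\varepsilon^{-1}$. (Error bounds given to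 machines and oracles are reciprocals $1/N$ of integers $N\ge2$, with $N$ written in unary; numerical answers are written in binary; an oracle call takes one step and its answers are independent samples.) \textbf{Proposition.} Let $\Gamma$ be a constraint language and $d$ a natural number. If $\Gamma$ $d$-simulates equality, then $$\#\mathrm{CSP}(\Gamma)\le_{\mathrm{AP}}\#\mathrm{CSP}_d(\Gamma\cup\Gamma_{\mathrm{pin}}).$$ -/

import Mathlib

open scoped ENNReal

noncomputable section

namespace BoolCSP

/-! ### Probabilistic oracle Turing machines -/

/-- The stacks through which a probabilistic oracle machine communicates. -/
inductive Port
  | input | inputErr | query | queryErr | answer | output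
deriving DecidableEq

/-- Alphabets of the communication stacks. Instances of the problem to be solved are words over `A`,
instances of the oracle problem are words over `B`. Error bounds are reciprocals `1 / N` of natural
numbers, with `N` written in unary; the oracle's answer and the output are numbers in binary. -/
abbrev Port.Alphabet (A B : Type) : Port → Type
  | .input => A
  | .inputErr => Unit
  | .query => B
  | .queryErr => Unit
  | .answer => Bool
  | .output => Bool

/-- One instruction: a deterministic statement of Mathlib's multi-stack Turing machine model, a fair
coin toss that selects the next label, or an oracle call after which the machine continues at the
given label. -/
inductive Instr {K : Type} (S : K → Type) (Λ σ : Type)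
  | run : Turing.TM2.Stmt S Λ σ → Instr S Λ σ
  | toss : Λ → Λ → Instr S Λ σ
  | ask : Λ → Instr S Λ σ

/-- A probabilistic oracle Turing machine (with finitely many work stacks, in addition to the
communication stacks, finite alphabets, finitely many labels and finitely many internal states). -/
structure OracleMachine (A B : Type) where
  /-- index type of the work stacks -/
  W : Type
  [decW : DecidableEq W]
  [finW : Finite W]
  /-- alphabets of the work stacks -/
  Work : W → Type
  [finWork : ∀ w, Finite (Work w)]
  /-- labels of the program -/
  Λ : Type
  [finΛ : Finite Λ]
  /-- internal states -/
  σ : Type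
  [finσ : Finite σ]
  start : Λ
  init : σ
  prog : Λ → Instr (Sum.elim (Port.Alphabet A B) Work) Λ σ

namespace OracleMachine

variable {A B : Type} (M : OracleMachine A B)

instance : DecidableEq M.W := M.decW

/-- Index type of all stacks. -/
abbrev K : Type := Port ⊕ M.W

/-- Alphabets of all stacks. -/
abbrev Alphabet : M.K → Type := Sum.elim (Port.Alphabet A B) M.Work

/-- Configurations: the current label (`none` once halted), the internal state and the stacks. -/
abbrev Cfg : Type := Turing.TM2.Cfg M.Alphabet M.Λ M.σ

/-- Initial configuration on input `(x, 1 / N)`. -/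
def initCfg (x : List A) (N : ℕ) : M.Cfg where
  l := some M.start
  var := M.init
  stk k := match k with
    | .inl .input => x
    | .inl .inputErr => List.replicate N ()
    | .inl .query => []
    | .inl .queryErr => []
    | .inl .answer => []
    | .inl .output => []
    | .inr _ => []

/-- The word on the query stack. -/
def queryWord (c : M.Cfg) : List B := c.stk (.inl .query)

/-- The number `N` such that `1 / N` is the error bound on the query stack. -/
def queryErr (c : M.Cfg) : ℕ := (c.stk (.inl .queryErr)).length

/-- The number on the output stack, written in binary with the least significant bit on top. -/
def outputValue (c : M.Cfg) : ℕ :=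
  List.foldr Nat.bit 0 (c.stk (.inl .output) : List Bool)

/-- The next instruction of the machine is an oracle call. -/
def IsAsking (c : M.Cfg) : Prop := ∃ q q' : M.Λ, c.l = some q ∧ M.prog q = .ask q'

/-- The configuration in which the oracle call is answered by `Y`: the query is removed and the
binary digits of `Y` (least significant bit on top) replace the content of the answer stack. -/
def answerCfg (q : M.Λ) (c : M.Cfg) (Y : ℕ) : M.Cfg where
  l := some q
  var := c.var
  stk k := match k with
    | .inl .query => []
    | .inl .queryErr => []
    | .inl .answer => Nat.bits Y
    | k => c.stk k

/-- The distribution of the next configuration. The oracle call `(w, 1 / N)` is answered by a fresh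
sample from `O w N`. -/
def step (O : List B → ℕ → PMF ℕ) (c : M.Cfg) : PMF M.Cfg :=
  match c.l with
  | none => PMF.pure c
  | some q =>
    match M.prog q with
    | .run s => PMF.pure (Turing.TM2.stepAux s c.var c.stk)
    | .toss q₀ q₁ => (PMF.uniformOfFintype Bool).map fun b =>
        { c with l := some (cond b q₁ q₀) }
    | .ask q' => (O (M.queryWord c) (M.queryErr c)).map (M.answerCfg q' c)

/-- The distribution of the configuration after `t` steps on input `(x, 1 / N)`. -/
def run (O : List B → ℕ → PMF ℕ) (x : List A) (N : ℕ) : ℕ → PMF M.Cfg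
  | 0 => PMF.pure (M.initCfg x N)
  | t + 1 => (run O x N t).bind (M.step O)

end OracleMachine

/-! ### Counting problems and approximation-preserving reductions -/

/-- A counting problem: a natural number is attached to every instance, and instances are encoded
as words over the alphabet `A`. -/
structure CountingProblem (A : Type) where
  Inst : Type
  encode : Inst → List A
  encode_injective : Function.Injective encode
  value : Inst → ℕ

/-- The natural numbers `Y` with `e^{-ε} ≤ Y / v ≤ e^ε`, where `ε = 1 / N` (and `Y = 0` if
`v = 0`). -/
def goodApprox (v N : ℕ) : Set ℕ :=
  {Y | Real.exp (-(1 / (N : ℝ))) * v ≤ Y ∧ (Y : ℝ) ≤ Real.exp (1 / (N : ℝ)) * v}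

/-- The random numbers `O w N` form a randomized approximation scheme for `g`. As `1 / N` ranges over
error bounds in `(0, 1)`, only `N ≥ 2` matters. -/
def IsRAS {B : Type} (g : CountingProblem B) (O : List B → ℕ → PMF ℕ) : Prop :=
  ∀ (I : g.Inst) (N : ℕ), 2 ≤ N →
    3 / 4 ≤ (O (g.encode I) N).toOuterMeasure (goodApprox (g.value I) N)

/-- `M` is an approximation-preserving reduction from `f` to `g`; the polynomial `p`, evaluated at
`|x| + ε⁻¹`, bounds both the reciprocals of the error bounds in oracle calls and the run-time. -/
structure IsAPReduction {A B : Type} (M : OracleMachine A B) (f : CountingProblem A)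
    (g : CountingProblem B) (p : Polynomial ℕ) : Prop where
  /-- Every oracle call that may occur consists of an instance of `g` and an error bound `δ` with
  `0 < δ < 1` and `δ⁻¹ ≤ poly(|x|, ε⁻¹)`. -/
  calls : ∀ (O : List B → ℕ → PMF ℕ) (I : f.Inst) (N : ℕ), 2 ≤ N →
    ∀ t, ∀ c ∈ (M.run O (f.encode I) N t).support, M.IsAsking c →
      (∃ J : g.Inst, M.queryWord c = g.encode J) ∧ 2 ≤ M.queryErr c ∧
        M.queryErr c ≤ p.eval ((f.encode I).length + N)
  /-- Every computation halts after polynomially many steps. -/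
  time : ∀ (O : List B → ℕ → PMF ℕ) (I : f.Inst) (N : ℕ), 2 ≤ N →
    ∀ c ∈ (M.run O (f.encode I) N (p.eval ((f.encode I).length + N))).support, c.l = none
  /-- If the oracle is a randomized approximation scheme for `g`, then `M` is one for `f`. -/
  approx : ∀ (O : List B → ℕ → PMF ℕ), IsRAS g O → ∀ (I : f.Inst) (N : ℕ), 2 ≤ N →
    3 / 4 ≤ ((M.run O (f.encode I) N (p.eval ((f.encode I).length + N))).map
      M.outputValue).toOuterMeasure (goodApprox (f.value I) N)

/-- `f ≤_AP g`, for counting problems over finite alphabets. -/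
def APReducible {A B : Type} [Finite A] [Finite B] (f : CountingProblem A)
    (g : CountingProblem B) : Prop :=
  ∃ (M : OracleMachine A B) (p : Polynomial ℕ), IsAPReduction M f g p

/-! ### Boolean constraint satisfaction problems -/

/-- A Boolean relation, given by its arity and its set of tuples. -/
abbrev BoolRel : Type := Σ r : ℕ, Finset (Fin r → Bool)

/-- A constraint language is a finite set of Boolean relations. -/
abbrev ConstraintLanguage : Type := Finset BoolRel

def Rzero : BoolRel := ⟨1, {fun _ => false}⟩

def Rone : BoolRel := ⟨1, {fun _ => true}⟩

def pinLanguage : ConstraintLanguage := {Rzero, Rone}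

/-- A constraint `R(v₁, …, v_r)` over the variables `Fin n`: a relation in `Γ` and a scope. -/
abbrev Constraint (Γ : ConstraintLanguage) (n : ℕ) : Type :=
  Σ R : {R : BoolRel // R ∈ Γ}, (Fin R.1.1 → Fin n)

/-- An instance: a finite set of variables and a set of constraints, listed without repetition. -/
structure CSPInstance (Γ : ConstraintLanguage) where
  numVars : ℕ
  constraints : List (Constraint Γ numVars)
  nodup : constraints.Nodup

namespace CSPInstance

variable {Γ : ConstraintLanguage} (I : CSPInstance Γ)

def Satisfies (s : Fin I.numVars → Bool) : Prop :=
  ∀ c ∈ I.constraints, (fun i => s (c.2 i)) ∈ c.1.1.2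

/-- The number `Z(I)` of satisfying assignments. -/
def Z : ℕ := Set.ncard {s : Fin I.numVars → Bool | I.Satisfies s}

/-- The number of times the variable `v` appears among the constraints. -/
def varDegree (v : Fin I.numVars) : ℕ :=
  (I.constraints.map fun c => (Finset.univ.filter fun i => c.2 i = v).card).sum

def degree : ℕ := Finset.univ.sup I.varDegree

end CSPInstance

/-- Input symbols: the tick `inl true`, the end mark `inl false`, and one symbol for the name of each
relation in `Γ`. -/
abbrev Sym (Γ : ConstraintLanguage) : Type := Bool ⊕ {R : BoolRel // R ∈ Γ}

/-- Unary code of a natural number. -/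
def encodeNum (Γ : ConstraintLanguage) (n : ℕ) : List (Sym Γ) :=
  List.replicate n (.inl true) ++ [.inl false]

/-- Code of a constraint: the name of its relation followed by the variables of its scope. -/
def encodeConstraint {Γ : ConstraintLanguage} {n : ℕ} (c : Constraint Γ n) : List (Sym Γ) :=
  .inr c.1 :: (List.ofFn c.2).flatMap fun v => encodeNum Γ v

/-- Code of an instance: the number of variables, followed by the list of constraints. -/
def CSPInstance.encode {Γ : ConstraintLanguage} (I : CSPInstance Γ) : List (Sym Γ) :=
  encodeNum Γ I.numVars ++ I.constraints.flatMap encodeConstraint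

theorem encodeNum_append_inj {Γ : ConstraintLanguage} :
    ∀ {a b : ℕ} {l l' : List (Sym Γ)}, encodeNum Γ a ++ l = encodeNum Γ b ++ l' →
      a = b ∧ l = l' := by
  intro a
  induction a with
  | zero =>
    intro b l l' h
    cases b with
    | zero => simpa [encodeNum] using h
    | succ b => simp [encodeNum, List.replicate_succ] at h
  | succ a ih =>
    intro b l l' h
    cases b with
    | zero => simp [encodeNum, List.replicate_succ] at h
    | succ b =>
      have h' : encodeNum Γ a ++ l = encodeNum Γ b ++ l' := by
        simpa [encodeNum, List.replicate_succ] using h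
      obtain ⟨h1, h2⟩ := ih h'
      exact ⟨by rw [h1], h2⟩

theorem encodeScope_append_inj {Γ : ConstraintLanguage} {n : ℕ} :
    ∀ {u v : List (Fin n)} {l l' : List (Sym Γ)}, u.length = v.length →
      (u.flatMap fun x => encodeNum Γ x) ++ l = (v.flatMap fun x => encodeNum Γ x) ++ l' →
      u = v ∧ l = l' := by
  intro u
  induction u with
  | nil =>
    intro v l l' hl h
    cases v with
    | nil => simpa using h
    | cons => simp at hl
  | cons x u ih =>
    intro v l l' hl h
    cases v with
    | nil => simp at hl
    | cons y v =>
      change (encodeNum Γ x ++ u.flatMap fun x => encodeNum Γ x) ++ l =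
        (encodeNum Γ y ++ v.flatMap fun x => encodeNum Γ x) ++ l' at h
      rw [List.append_assoc, List.append_assoc] at h
      obtain ⟨h1, h2⟩ := encodeNum_append_inj h
      obtain ⟨h3, h4⟩ := ih (by simpa using hl) h2
      exact ⟨by rw [Fin.ext h1, h3], h4⟩

theorem encodeConstraint_append_inj {Γ : ConstraintLanguage} {n : ℕ} {c c' : Constraint Γ n}
    {l l' : List (Sym Γ)} (h : encodeConstraint c ++ l = encodeConstraint c' ++ l') :
    c = c' ∧ l = l' := by
  obtain ⟨R, u⟩ := c
  obtain ⟨R', u'⟩ := c'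
  simp only [encodeConstraint, List.cons_append, List.cons.injEq, Sum.inr.injEq] at h
  obtain ⟨rfl, h⟩ := h
  obtain ⟨h1, h2⟩ := encodeScope_append_inj (by simp) h
  exact ⟨by rw [List.ofFn_injective h1], h2⟩

theorem encodeConstraints_inj {Γ : ConstraintLanguage} {n : ℕ} :
    ∀ {C C' : List (Constraint Γ n)},
      C.flatMap encodeConstraint = C'.flatMap encodeConstraint → C = C' := by
  intro C
  induction C with
  | nil =>
    intro C' h
    cases C' with
    | nil => rfl
    | cons c C' => simp [encodeConstraint] at h
  | cons c C ih =>
    intro C' h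
    cases C' with
    | nil => simp [encodeConstraint] at h
    | cons c' C' =>
      change encodeConstraint c ++ C.flatMap encodeConstraint =
        encodeConstraint c' ++ C'.flatMap encodeConstraint at h
      obtain ⟨h1, h2⟩ := encodeConstraint_append_inj h
      rw [h1, ih h2]

theorem CSPInstance.encode_injective (Γ : ConstraintLanguage) :
    Function.Injective (CSPInstance.encode (Γ := Γ)) := by
  rintro ⟨n, C, hC⟩ ⟨n', C', hC'⟩ h
  obtain ⟨h1, h2⟩ := encodeNum_append_inj h
  change n = n' at h1
  subst h1
  obtain rfl : C = C' := encodeConstraints_inj h2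
  rfl

/-- The problem `#CSP(Γ)`. -/
def numCSP (Γ : ConstraintLanguage) : CountingProblem (Sym Γ) where
  Inst := CSPInstance Γ
  encode := CSPInstance.encode
  encode_injective := CSPInstance.encode_injective Γ
  value := CSPInstance.Z

/-- The problem `#CSP_d(Γ)`: the restriction of `#CSP(Γ)` to instances of degree at most `d`. -/
def numCSPDeg (d : ℕ) (Γ : ConstraintLanguage) : CountingProblem (Sym Γ) where
  Inst := {I : CSPInstance Γ // I.degree ≤ d}
  encode I := I.1.encode
  encode_injective := (CSPInstance.encode_injective Γ).comp Subtype.val_injective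
  value I := I.1.Z

/-! ### Simulating equality -/

/-- `Γ` `d`-simulates the `k`-ary equality relation: some instance over `Γ ∪ {R_zero, R_one}` of
degree at most `d` has exactly `m ≥ 1` satisfying assignments that are constantly 0 on the first `k`
variables, exactly `m` that are constantly 1 there, and no others; each of the first `k` variables
has degree at most `d - 1`. -/
def DSimulatesEqK (d k : ℕ) (Γ : ConstraintLanguage) : Prop :=
  ∃ (I : CSPInstance (Γ ∪ pinLanguage)) (hk : k ≤ I.numVars) (m : ℕ), 1 ≤ m ∧
    Set.ncard {s | I.Satisfies s ∧ ∀ i : Fin k, s (Fin.castLE hk i) = false} = m ∧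
    Set.ncard {s | I.Satisfies s ∧ ∀ i : Fin k, s (Fin.castLE hk i) = true} = m ∧
    (∀ s, I.Satisfies s → (∀ i : Fin k, s (Fin.castLE hk i) = false) ∨
      (∀ i : Fin k, s (Fin.castLE hk i) = true)) ∧
    I.degree ≤ d ∧ ∀ i : Fin k, I.varDegree (Fin.castLE hk i) + 1 ≤ d

def DSimulatesEquality (d : ℕ) (Γ : ConstraintLanguage) : Prop :=
  ∀ k, 2 ≤ k → DSimulatesEqK d k Γ

end BoolCSP

end

/-! The obvious reduction replaces a variable with `k` occurrences by a gadget for `k`-ary equality.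
This needs gadgets of unbounded arity, while the hypothesis asserts only that they exist: it bounds
neither their size nor the effort of finding them. The reduction therefore uses two fixed gadgets,
which are hard-wired into the machine: `H` for binary equality, and `G` for equality of `2 *
H.entries + 2` variables, where `H.entries` counts the occurrences of variables in `H`.

Let the given instance `I` have `n` variables and `T` occurrences of variables. There is a cell for
each variable in each of `T + 2` layers, and a copy of `H` links every cell to the cell of the same
variable in the cyclically preceding layer. Copies of `H` must not share their ports, since the
degrees would add up. Instead, each cell has for each variable of `H` a block, which is a copy of
`G`, and every occurrence of a variable, in a link or in `I`, receives a port of a block for itself.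
A port has degree at most `d - 1` inside `G` and is used at most once outside, so all degrees are at
most `d` (`count_boundedCs`). The links make all cells of a variable agree (`eq_of_links`), and
different occurrences in `I` are placed in different layers. Counting solutions gives `Z(J) = Z(I) *
w ^ P` for the new instance `J`, with `w = 2 * H.m * G.m ^ H.numVars` and `P = (T + 2) * n`
(`card_satL_boundedCs`). As constraints form a set, no two of the constructed ones may coincide
(`nodup_boundedCs`); for this purpose gadgets are freed of trivial constraints.

The machine writes `J`, calls the oracle once with error bound `1 / (8 * N)`, divides the answer by
`w ^ P` and rounds to the nearest integer. If `Z(I)` is small compared with `N`, the result is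
exact; otherwise the rounding error is absorbed by the relative error (`round_mem_goodApprox`). With
a single call, the success probability `3/4` carries over unchanged.

The machine is given by two structured programs, one before and one after the call. Their
compilation is correct with the same number of steps (`Prog.Exec.detSteps`), and
`apReducible_of_progs` turns specifications of the programs into a reduction. All cells look alike
up to a shift of indices, so a few unary counters suffice to write the code of `J`
(`boundedInstance_encode`). -/

noncomputable section

namespace BoolCSP

/-! ### Structured stack programs -/

/-- Structured programs over stacks with alphabets `S` and a finite store `σ`. The command
`loop k body` pops symbols `a` from the stack `k` and runs `body a`, until the stack is empty. -/
inductive Prog {K : Type} (S : K → Type) (σ : Type) : Type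
  | push (k : K) (f : σ → S k) : Prog S σ
  | pop (k : K) (f : σ → Option (S k) → σ) : Prog S σ
  | load (f : σ → σ) : Prog S σ
  | seq (p q : Prog S σ) : Prog S σ
  | ite (c : σ → Bool) (p q : Prog S σ) : Prog S σ
  | loop (k : K) (body : S k → Prog S σ) : Prog S σ

namespace Prog

variable {K : Type} {S : K → Type} {σ : Type}

/-- The control points of a program. -/
def Lab : Prog S σ → Type
  | push _ _ => Unit
  | pop _ _ => Unit
  | load _ => Unit
  | seq p q => p.Lab ⊕ q.Lab
  | ite _ p q => Option (p.Lab ⊕ q.Lab)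
  | loop _ body => Option (Σ a, (body a).Lab)

def entry : (p : Prog S σ) → p.Lab
  | push _ _ => ()
  | pop _ _ => ()
  | load _ => ()
  | seq p _ => .inl p.entry
  | ite _ _ _ => none
  | loop _ _ => none

theorem finite_lab [∀ k, Finite (S k)] (p : Prog S σ) : Finite p.Lab := by
  induction p with
  | push => exact inferInstanceAs (Finite Unit)
  | pop => exact inferInstanceAs (Finite Unit)
  | load => exact inferInstanceAs (Finite Unit)
  | seq p q hp hq => exact inferInstanceAs (Finite (p.Lab ⊕ q.Lab))
  | ite c p q hp hq => exact inferInstanceAs (Finite (Option (p.Lab ⊕ q.Lab)))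
  | loop k body h => exact inferInstanceAs (Finite (Option (Σ a, (body a).Lab)))

/-- Compilation to statements of a multi-stack machine. The second component of the internal state
holds the target of the conditional jumps of `loop`. -/
def code {Λ : Type} : (p : Prog S σ) → (p.Lab → Λ) → Λ → p.Lab → Turing.TM2.Stmt S Λ (σ × Λ)
  | push k f, _, exit, _ => .push k (fun s => f s.1) (.goto fun _ => exit)
  | pop k f, _, exit, _ => .pop k (fun s o => (f s.1 o, s.2)) (.goto fun _ => exit)
  | load f, _, exit, _ => .load (fun s => (f s.1, s.2)) (.goto fun _ => exit)
  | seq p q, emb, _, .inl l => p.code (fun l => emb (.inl l)) (emb (.inr q.entry)) l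
  | seq _ q, emb, exit, .inr l => q.code (fun l => emb (.inr l)) exit l
  | ite c p q, emb, _, none =>
      .branch (fun s => c s.1) (.goto fun _ => emb (some (.inl p.entry)))
        (.goto fun _ => emb (some (.inr q.entry)))
  | ite _ p _, emb, exit, some (.inl l) => p.code (fun l => emb (some (.inl l))) exit l
  | ite _ _ q, emb, exit, some (.inr l) => q.code (fun l => emb (some (.inr l))) exit l
  | loop k body, emb, exit, none =>
      .pop k (fun s o => (s.1, o.elim exit fun a => emb (some ⟨a, (body a).entry⟩)))
        (.goto fun s => s.2)
  | loop _ body, emb, _, some ⟨a, l⟩ =>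
      (body a).code (fun l => emb (some ⟨a, l⟩)) (emb none) l

/-- The store together with the contents of the stacks. -/
abbrev State (S : K → Type) (σ : Type) : Type := σ × ∀ k, List (S k)

variable [DecidableEq K]

/-- Big-step semantics: `Exec p s t s'` if `p` leads from `s` to `s'` in `t` steps. -/
inductive Exec : Prog S σ → State S σ → ℕ → State S σ → Prop
  | push {k f} {s : State S σ} :
      Exec (.push k f) s 1 (s.1, Function.update s.2 k (f s.1 :: s.2 k))
  | pop {k f} {s : State S σ} :
      Exec (.pop k f) s 1 (f s.1 (s.2 k).head?, Function.update s.2 k (s.2 k).tail)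
  | load {f} {s : State S σ} : Exec (.load f) s 1 (f s.1, s.2)
  | seq {p q s s' s'' t t'} :
      Exec p s t s' → Exec q s' t' s'' → Exec (.seq p q) s (t + t') s''
  | ite_true {c p q} {s : State S σ} {t s'} :
      c s.1 = true → Exec p s t s' → Exec (.ite c p q) s (t + 1) s'
  | ite_false {c p q} {s : State S σ} {t s'} :
      c s.1 = false → Exec q s t s' → Exec (.ite c p q) s (t + 1) s'
  | loop_nil {k body} {s : State S σ} : s.2 k = [] → Exec (.loop k body) s 1 s
  | loop_cons {k body a l} {s : State S σ} {t s' t' last} :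
      s.2 k = a :: l → Exec (body a) (s.1, Function.update s.2 k l) t s' →
      Exec (.loop k body) s' t' last → Exec (.loop k body) s (t + t' + 1) last

/-- `p` leads from `s` to `s'` in at most `B` steps. -/
def Runs (p : Prog S σ) (s : State S σ) (B : ℕ) (s' : State S σ) : Prop :=
  ∃ t ≤ B, Exec p s t s'

end Prog

/-- `t` deterministic steps of a machine with the (partial) program `P`. -/
inductive DetSteps {K : Type} [DecidableEq K] {S : K → Type} {Λ σ : Type}
    (P : Λ → Option (Turing.TM2.Stmt S Λ σ)) :
    Turing.TM2.Cfg S Λ σ → ℕ → Turing.TM2.Cfg S Λ σ → Prop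
  | refl {c} : DetSteps P c 0 c
  | head {q stmt v stk t c} : P q = some stmt →
      DetSteps P (Turing.TM2.stepAux stmt v stk) t c → DetSteps P ⟨some q, v, stk⟩ (t + 1) c

section DetSteps

variable {K : Type} [DecidableEq K] {S : K → Type} {Λ σ : Type}

theorem DetSteps.trans {P : Λ → Option (Turing.TM2.Stmt S Λ σ)} {a b c} {t u : ℕ}
    (h : DetSteps P a t b) (hbc : DetSteps P b u c) : DetSteps P a (t + u) c := by
  induction h with
  | refl => simpa using hbc
  | head hq _ ih => rw [Nat.add_right_comm]; exact .head hq (ih hbc)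

/-- The compiled code simulates the big-step semantics. -/
theorem Prog.Exec.detSteps {P : Λ → Option (Turing.TM2.Stmt S Λ (σ × Λ))} {p : Prog S σ}
    {s s' : Prog.State S σ} {t : ℕ} (h : p.Exec s t s') :
    ∀ (emb : p.Lab → Λ) (exit : Λ), (∀ l, P (emb l) = some (p.code emb exit l)) → ∀ b : Λ,
      ∃ b' : Λ, DetSteps P ⟨some (emb p.entry), (s.1, b), s.2⟩ t
        ⟨some exit, (s'.1, b'), s'.2⟩ := by
  induction h with
  | push => exact fun emb exit hP b => ⟨b, .head (hP _) .refl⟩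
  | pop => exact fun emb exit hP b => ⟨b, .head (hP _) .refl⟩
  | load => exact fun emb exit hP b => ⟨b, .head (hP _) .refl⟩
  | @seq p q s s' s'' t t' _ _ ih ih' =>
    intro emb exit hP b
    obtain ⟨b₁, h₁⟩ := ih (fun l => emb (.inl l)) (emb (.inr q.entry)) (fun l => hP (.inl l)) b
    obtain ⟨b₂, h₂⟩ := ih' (fun l => emb (.inr l)) exit (fun l => hP (.inr l)) b₁
    exact ⟨b₂, h₁.trans h₂⟩
  | @ite_true c p q s t s' hc _ ih =>
    intro emb exit hP b
    obtain ⟨b₁, h₁⟩ := ih (fun l => emb (some (.inl l))) exit (fun l => hP (some (.inl l))) b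
    refine ⟨b₁, .head (hP none) ?_⟩
    simpa [Prog.code, Turing.TM2.stepAux, hc] using h₁
  | @ite_false c p q s t s' hc _ ih =>
    intro emb exit hP b
    obtain ⟨b₁, h₁⟩ := ih (fun l => emb (some (.inr l))) exit (fun l => hP (some (.inr l))) b
    refine ⟨b₁, .head (hP none) ?_⟩
    simpa [Prog.code, Turing.TM2.stepAux, hc] using h₁
  | @loop_nil k body s hk =>
    intro emb exit hP b
    refine ⟨exit, .head (hP none) ?_⟩
    have : Function.update s.2 k [] = s.2 := by rw [← hk, Function.update_eq_self]
    simpa [Prog.code, Turing.TM2.stepAux, hk, this] using DetSteps.refl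
  | @loop_cons k body a l s t s' t' s'' hk _ _ ih ih' =>
    intro emb exit hP b
    -- The pop has stored the entry of `body a` as the jump target, so the body starts with this
    -- value in the second component of the state.
    obtain ⟨b₁, h₁⟩ := ih (fun l => emb (some ⟨a, l⟩)) (emb none) (fun l => hP (some ⟨a, l⟩))
      (emb (some ⟨a, (body a).entry⟩))
    obtain ⟨b₂, h₂⟩ := ih' emb exit hP b₁
    refine ⟨b₂, .head (hP none) ?_⟩
    simpa [Prog.code, Turing.TM2.stepAux, hk] using h₁.trans h₂

end DetSteps

/-! ### Machines with one oracle call -/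

namespace OracleMachine

variable {A B : Type}

/-- The deterministic part of a program. -/
def det (M : OracleMachine A B) (q : M.Λ) : Option (Turing.TM2.Stmt M.Alphabet M.Λ M.σ) :=
  match M.prog q with
  | .run s => some s
  | _ => none

theorem det_eq_some {M : OracleMachine A B} {q : M.Λ} {s} (h : M.det q = some s) :
    M.prog q = .run s := by
  unfold det at h
  split at h
  · simp_all
  · simp at h

/-- The distribution of the configuration `t` steps after the configuration `c`. -/
def runFrom (M : OracleMachine A B) (O : List B → ℕ → PMF ℕ) (c : M.Cfg) : ℕ → PMF M.Cfg
  | 0 => PMF.pure c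
  | t + 1 => (M.step O c).bind fun c' => runFrom M O c' t

/-- `run` appends steps at the end, whereas simulations consume steps at the beginning;
associativity of `bind` reconciles the two. -/
theorem runFrom_succ' (M : OracleMachine A B) (O : List B → ℕ → PMF ℕ) (c : M.Cfg) (t : ℕ) :
    M.runFrom O c (t + 1) = (M.runFrom O c t).bind (M.step O) := by
  induction t generalizing c with
  | zero => simp [runFrom]
  | succ t ih => rw [runFrom, funext ih, ← PMF.bind_bind, ← runFrom]

theorem run_eq_runFrom (M : OracleMachine A B) (O : List B → ℕ → PMF ℕ) (x : List A) (N t : ℕ) :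
    M.run O x N t = M.runFrom O (M.initCfg x N) t := by
  induction t with
  | zero => rfl
  | succ t ih => rw [runFrom_succ', ← ih]; rfl

theorem runFrom_halted (M : OracleMachine A B) (O : List B → ℕ → PMF ℕ) {c : M.Cfg}
    (h : c.l = none) (t : ℕ) : M.runFrom O c t = PMF.pure c := by
  induction t with
  | zero => rfl
  | succ t ih => simp [runFrom, step, h, ih]

theorem step_of_det (M : OracleMachine A B) (O : List B → ℕ → PMF ℕ) {q s}
    (h : M.det q = some s) (v stk) :
    M.step O ⟨some q, v, stk⟩ = PMF.pure (Turing.TM2.stepAux s v stk) := by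
  simp [step, det_eq_some h]

theorem runFrom_detSteps {M : OracleMachine A B} (O : List B → ℕ → PMF ℕ) {c c' : M.Cfg} {t : ℕ}
    (h : DetSteps M.det c t c') (u : ℕ) : M.runFrom O c (t + u) = M.runFrom O c' u := by
  induction h with
  | refl => simp
  | head hq _ ih => rw [Nat.add_right_comm, runFrom, step_of_det M O hq, PMF.pure_bind, ih]

/-- If a deterministic computation leads from `c` to `c'`, then an oracle call after `c` is an oracle
call after `c'`. -/
theorem isAsking_of_detSteps {M : OracleMachine A B} (O : List B → ℕ → PMF ℕ) {c c' : M.Cfg}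
    {t : ℕ} (h : DetSteps M.det c t c') (u : ℕ) (a : M.Cfg) (ha : a ∈ (M.runFrom O c u).support)
    (hask : M.IsAsking a) : ∃ u', a ∈ (M.runFrom O c' u').support := by
  induction h generalizing u with
  | refl => exact ⟨u, ha⟩
  | @head q s v stk t c hq _ ih =>
    cases u with
    | zero =>
      simp only [runFrom, PMF.support_pure, Set.mem_singleton_iff] at ha
      obtain ⟨q₁, q₂, h₁, h₂⟩ := hask
      subst ha
      simp only [Option.some.injEq] at h₁
      subst h₁
      rw [det_eq_some hq] at h₂
      cases h₂
    | succ u =>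
      rw [runFrom, step_of_det M O hq, PMF.pure_bind] at ha
      exact ih u ha

instance (p : Port) [Finite A] [Finite B] : Finite (Port.Alphabet A B p) := by
  cases p <;> simp only [Port.Alphabet] <;> infer_instance

theorem finite_alphabet [Finite A] [Finite B] {W : Type} {Work : W → Type}
    [∀ w, Finite (Work w)] (k : Port ⊕ W) : Finite (Sum.elim (Port.Alphabet A B) Work k) := by
  cases k <;> simp only [Sum.elim_inl, Sum.elim_inr] <;> infer_instance

variable [Finite A] [Finite B] {W : Type} [DecidableEq W] [Finite W] {Work : W → Type}
  [∀ w, Finite (Work w)] {σ : Type} [Finite σ]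

/-- The machine that runs `p`, calls the oracle and runs `q`. -/
def ofProgs (p q : Prog (Sum.elim (Port.Alphabet A B) Work) σ) (s₀ : σ) : OracleMachine A B where
  W := W
  Work := Work
  Λ := (p.Lab ⊕ q.Lab) ⊕ Bool
  finΛ := by
    have := finite_alphabet (A := A) (B := B) (Work := Work)
    have := p.finite_lab
    have := q.finite_lab
    infer_instance
  σ := σ × ((p.Lab ⊕ q.Lab) ⊕ Bool)
  finσ := by
    have := finite_alphabet (A := A) (B := B) (Work := Work)
    have := p.finite_lab
    have := q.finite_lab
    infer_instance
  start := .inl (.inl p.entry)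
  init := (s₀, .inr false)
  prog
    | .inl (.inl l) => .run (p.code (fun l => .inl (.inl l)) (.inr true) l)
    | .inl (.inr l) => .run (q.code (fun l => .inl (.inr l)) (.inr false) l)
    | .inr true => .ask (.inl (.inr q.entry))
    | .inr false => .run .halt

/-- Initial contents of the stacks. -/
def initStk (x : List A) (N : ℕ) : ∀ k, List (Sum.elim (Port.Alphabet A B) Work k)
  | .inl .input => x
  | .inl .inputErr => List.replicate N ()
  | .inl .query => []
  | .inl .queryErr => []
  | .inl .answer => []
  | .inl .output => []
  | .inr _ => []

/-- Contents of the stacks after the oracle's answer `Y`. -/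
def answerStk (stk : ∀ k, List (Sum.elim (Port.Alphabet A B) Work k)) (Y : ℕ) :
    ∀ k, List (Sum.elim (Port.Alphabet A B) Work k)
  | .inl .query => []
  | .inl .queryErr => []
  | .inl .answer => Nat.bits Y
  | k => stk k

theorem initCfg_ofProgs (p q : Prog (Sum.elim (Port.Alphabet A B) Work) σ) (s₀ : σ) (x : List A)
    (N : ℕ) : (ofProgs p q s₀).initCfg x N =
      ⟨some (.inl (.inl p.entry)), (s₀, .inr false), initStk x N⟩ := by
  unfold initCfg
  congr 1
  funext k
  rcases k with k | k
  · cases k <;> rfl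
  · rfl

theorem answerCfg_ofProgs (p q : Prog (Sum.elim (Port.Alphabet A B) Work) σ) (s₀ : σ)
    (l : (ofProgs p q s₀).Λ) (c : (ofProgs p q s₀).Cfg) (Y : ℕ) :
    (ofProgs p q s₀).answerCfg l c Y = ⟨some l, c.var, answerStk c.stk Y⟩ := by
  unfold answerCfg
  congr 1
  funext k
  rcases k with k | k
  · cases k <;> rfl
  · rfl

end OracleMachine

open OracleMachine in
/-- A reduction that makes one oracle call, given by two structured programs. -/
theorem apReducible_of_progs {A B : Type} [Finite A] [Finite B] {W : Type} [DecidableEq W]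
    [Finite W] {Work : W → Type} [∀ w, Finite (Work w)] {σ : Type} [Finite σ]
    {f : CountingProblem A} {g : CountingProblem B} (poly : Polynomial ℕ)
    (p q : Prog (Sum.elim (Port.Alphabet A B) Work) σ) (s₀ : σ)
    (h : ∀ (I : f.Inst) (N : ℕ), 2 ≤ N → ∃ (J : g.Inst) (B₁ B₂ : ℕ) (s : Prog.State _ σ),
      p.Runs (s₀, initStk (f.encode I) N) B₁ s ∧ s.2 (.inl .query) = g.encode J ∧
      2 ≤ (s.2 (.inl .queryErr)).length ∧
      (s.2 (.inl .queryErr)).length ≤ poly.eval ((f.encode I).length + N) ∧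
      B₁ + B₂ + 2 ≤ poly.eval ((f.encode I).length + N) ∧
      ∀ Y, ∃ s' : Prog.State _ σ, q.Runs (s.1, answerStk s.2 Y) B₂ s' ∧
        (Y ∈ goodApprox (g.value J) (s.2 (.inl .queryErr)).length →
          List.foldr Nat.bit 0 (s'.2 (.inl .output) : List Bool) ∈ goodApprox (f.value I) N)) :
    APReducible f g := by
  set M := ofProgs p q s₀ with hM
  -- the computation consists of two deterministic parts
  have key : ∀ (I : f.Inst) (N : ℕ), 2 ≤ N → ∃ (J : g.Inst) (t₁ B₂ : ℕ) (c : M.Cfg)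
      (F : ℕ → M.Cfg), DetSteps M.det (M.initCfg (f.encode I) N) t₁ c ∧
      M.queryWord c = g.encode J ∧ 2 ≤ M.queryErr c ∧
      M.queryErr c ≤ poly.eval ((f.encode I).length + N) ∧
      t₁ + B₂ + 1 ≤ poly.eval ((f.encode I).length + N) ∧
      c.l = some (.inr true) ∧
      ∀ Y, (F Y).l = none ∧ (∃ t ≤ B₂, DetSteps M.det
          (M.answerCfg (.inl (.inr q.entry)) c Y) t (F Y)) ∧
        (Y ∈ goodApprox (g.value J) (M.queryErr c) →
          M.outputValue (F Y) ∈ goodApprox (f.value I) N) := by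
    intro I N hN
    obtain ⟨J, B₁, B₂, s, ⟨t₁, ht₁, h₁⟩, hq, he, he', hB, h₂⟩ := h I N hN
    obtain ⟨b, hb⟩ := h₁.detSteps (P := M.det) (fun l => .inl (.inl l)) (.inr true)
      (fun l => rfl) (.inr false)
    choose s' hs' hY using h₂
    choose t ht ht' using hs'
    have hs := fun Y => (ht' Y).detSteps (P := M.det) (fun l => .inl (.inr l)) (.inr false)
      (fun l => rfl) b
    choose b' hb' using hs
    -- The additional step after the second program executes `halt`.
    refine ⟨J, t₁, B₂ + 1, ⟨some (.inr true), (s.1, b), s.2⟩,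
      fun Y => ⟨none, ((s' Y).1, b' Y), (s' Y).2⟩, ?_, hq, he, he', by omega, rfl,
      fun Y => ⟨rfl, ⟨t Y + 1, Nat.succ_le_succ (ht Y), ?_⟩, hY Y⟩⟩
    · rw [initCfg_ofProgs]
      exact hb
    · have h₃ : DetSteps M.det ⟨some (.inl (.inr q.entry)), (s.1, b), answerStk s.2 Y⟩ (t Y + 1)
          ⟨none, ((s' Y).1, b' Y), (s' Y).2⟩ :=
        (hb' Y).trans (.head (stmt := .halt) rfl .refl)
      exact (congrArg (fun c => DetSteps M.det c (t Y + 1) _)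
        (answerCfg_ofProgs p q s₀ (.inl (.inr q.entry)) ⟨_, (s.1, b), s.2⟩ Y)).mpr h₃
  have ask : ∀ (O : List B → ℕ → PMF ℕ) (c : M.Cfg), c.l = some (.inr true) →
      M.step O c = (O (M.queryWord c) (M.queryErr c)).map
        (M.answerCfg (.inl (.inr q.entry)) c) := by
    intro O c hc
    simp only [step, hc]
    rfl
  -- The answer of the oracle is the only source of randomness: the final configuration is
  -- distributed as the image under `F` of one sample.
  have final : ∀ (O : List B → ℕ → PMF ℕ) (c : M.Cfg) (F : ℕ → M.Cfg) (t₁ B₂ u : ℕ) x N,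
      DetSteps M.det (M.initCfg x N) t₁ c → c.l = some (.inr true) →
      (∀ Y, (F Y).l = none ∧ (∃ t ≤ B₂, DetSteps M.det
          (M.answerCfg (.inl (.inr q.entry)) c Y) t (F Y))) → t₁ + B₂ + 1 ≤ u →
      M.run O x N u = (O (M.queryWord c) (M.queryErr c)).map F := by
    intro O c F t₁ B₂ u x N h₁ hc h₂ hu
    obtain ⟨r, rfl⟩ := Nat.exists_eq_add_of_le hu
    rw [run_eq_runFrom, show t₁ + B₂ + 1 + r = t₁ + (B₂ + r + 1) by omega, runFrom_detSteps O h₁,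
      runFrom, ask O c hc, PMF.bind_map]
    rw [← PMF.bind_pure_comp]
    congr 1
    funext Y
    obtain ⟨hF, t, ht, h₃⟩ := h₂ Y
    simp only [Function.comp]
    rw [show B₂ + r = t + (B₂ - t + r) by omega, runFrom_detSteps O h₃, runFrom_halted M O hF]
  refine ⟨M, poly, ⟨?_, ?_, ?_⟩⟩
  · intro O I N hN t c hc hask
    obtain ⟨J, t₁, B₂, c₁, F, h₁, hq, he, he', hB, hl, h₂⟩ := key I N hN
    rw [run_eq_runFrom] at hc
    obtain ⟨u, hu⟩ := isAsking_of_detSteps O h₁ t c hc hask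
    -- After the answer the computation is deterministic and ends in a halted configuration, so no
    -- second call can occur.
    suffices c = c₁ by subst this; exact ⟨⟨J, hq⟩, he, he'⟩
    cases u with
    | zero => simpa [runFrom] using hu
    | succ u =>
      rw [runFrom, ask O c₁ hl, PMF.bind_map] at hu
      simp only [PMF.mem_support_bind_iff, Function.comp] at hu
      obtain ⟨Y, -, hY⟩ := hu
      obtain ⟨hF, ⟨t, -, h₃⟩, -⟩ := h₂ Y
      obtain ⟨u', hu'⟩ := isAsking_of_detSteps O h₃ u c hY hask
      rw [runFrom_halted M O hF] at hu'
      simp only [PMF.support_pure, Set.mem_singleton_iff] at hu'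
      obtain ⟨q₁, q₂, hq₁, -⟩ := hask
      rw [hu', hF] at hq₁
      cases hq₁
  · intro O I N hN c hc
    obtain ⟨J, t₁, B₂, c₁, F, h₁, hq, he, he', hB, hl, h₂⟩ := key I N hN
    rw [final O c₁ F t₁ B₂ _ _ N h₁ hl (fun Y => ⟨(h₂ Y).1, (h₂ Y).2.1⟩) hB] at hc
    simp only [PMF.mem_support_map_iff] at hc
    obtain ⟨Y, -, rfl⟩ := hc
    exact (h₂ Y).1
  · intro O hO I N hN
    obtain ⟨J, t₁, B₂, c₁, F, h₁, hq, he, he', hB, hl, h₂⟩ := key I N hN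
    rw [final O c₁ F t₁ B₂ _ _ N h₁ hl (fun Y => ⟨(h₂ Y).1, (h₂ Y).2.1⟩) hB, PMF.map_comp,
      PMF.toOuterMeasure_map_apply, hq]
    -- `F` sends good answers to good outputs, so the event of a good output contains that of a good
    -- answer.
    refine (hO J _ he).trans ((PMF.toOuterMeasure _).mono ?_)
    exact fun Y hY => (h₂ Y).2.2 hY

/-! ### Constraints over arbitrary variable types -/

/-- A constraint whose scope consists of elements of `V`. -/
abbrev Con (Δ : ConstraintLanguage) (V : Type) : Type :=
  Σ R : {R : BoolRel // R ∈ Δ}, (Fin R.1.1 → V)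

namespace Con

variable {Γ Δ : ConstraintLanguage} {U V V' : Type}

def map (f : V → V') (c : Con Δ V) : Con Δ V' := ⟨c.1, fun e => f (c.2 e)⟩

/-- Enlarge the constraint language. -/
def lift (h : Γ ⊆ Δ) (c : Con Γ V) : Con Δ V := ⟨⟨c.1.1, h c.1.2⟩, c.2⟩

def Holds (s : V → Bool) (c : Con Δ V) : Prop := (fun e => s (c.2 e)) ∈ c.1.1.2

theorem map_injective {f : V → V'} (hf : Function.Injective f) :
    Function.Injective (map (Δ := Δ) f) := by
  rintro ⟨R, u⟩ ⟨R', u'⟩ h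
  simp only [map, Sigma.mk.injEq] at h
  obtain ⟨rfl, h⟩ := h
  have h' := eq_of_heq h
  congr 1
  funext e
  exact hf (congrFun h' e)

theorem lift_injective (h : Γ ⊆ Δ) : Function.Injective (lift (V := V) h) := by
  rintro ⟨⟨R, hR⟩, u⟩ ⟨⟨R', hR'⟩, u'⟩ h
  simp only [lift, Sigma.mk.injEq, Subtype.mk.injEq] at h
  obtain ⟨rfl, h⟩ := h
  obtain rfl := eq_of_heq h
  rfl

@[simp] theorem map_map (f : V → V') (g : U → V) (c : Con Δ U) :
    (c.map g).map f = c.map fun x => f (g x) := rfl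

/-- A constraint in whose scope only one variable occurs is trivial, or violated by a constant
tuple. -/
theorem exists_const_notMem {c : Con Δ V} (hc : ∀ e e', c.2 e = c.2 e')
    (ht : ∃ s, ¬ c.Holds s) : ∃ b, (fun _ => b) ∉ c.1.1.2 := by
  obtain ⟨s, hs⟩ := ht
  by_cases hr : 0 < c.1.1.1
  · refine ⟨s (c.2 ⟨0, hr⟩), fun h => hs ?_⟩
    rwa [Holds, funext fun e => congrArg s (hc e ⟨0, hr⟩)]
  · refine ⟨false, fun h => hs ?_⟩
    have e₀ : (fun e => s (c.2 e)) = fun _ => false := funext fun e => absurd e.pos hr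
    rwa [Holds, e₀]

end Con

section ConList

variable {Γ Δ : ConstraintLanguage} {U V V' : Type}

/-- The list of all occurrences of variables in a list of constraints. -/
def occ (cs : List (Con Δ V)) : List V := cs.flatMap fun c => List.ofFn c.2

/-- All constraints hold. -/
def SatL (cs : List (Con Δ V)) (s : V → Bool) : Prop := ∀ c ∈ cs, c.Holds s

/-- Number the occurrences of variables consecutively, starting with `k`. -/
def number : ℕ → List (Con Δ V) → List (Con Δ (V × ℕ))
  | _, [] => []
  | k, c :: cs => ⟨c.1, fun e => (c.2 e, k + e)⟩ :: number (k + c.1.1.1) cs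

theorem map_fst_number (k : ℕ) (cs : List (Con Δ V)) :
    (number k cs).map (Con.map Prod.fst) = cs := by
  induction cs generalizing k with
  | nil => rfl
  | cons c cs ih => simp [number, ih, Con.map]

theorem occ_number (k : ℕ) (cs : List (Con Δ V)) : occ (number k cs) = (occ cs).zipIdx k := by
  induction cs generalizing k with
  | nil => rfl
  | cons c cs ih =>
    have ih' := ih (k + c.1.1.1)
    simp only [occ, number, List.flatMap_cons, List.zipIdx_append, List.length_ofFn] at ih' ⊢
    rw [ih']
    congr 1
    apply List.ext_getElem <;> simp

theorem occ_map (f : V → V') (cs : List (Con Δ V)) :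
    occ (cs.map (Con.map f)) = (occ cs).map f := by
  simp only [occ, List.flatMap_map, List.map_flatMap, List.map_ofFn]
  rfl

theorem occ_lift (h : Γ ⊆ Δ) (cs : List (Con Γ V)) : occ (cs.map (Con.lift h)) = occ cs := by
  simp only [occ, List.flatMap_map]
  rfl

theorem occ_append (cs cs' : List (Con Δ V)) : occ (cs ++ cs') = occ cs ++ occ cs' := by
  simp [occ]

theorem occ_flatMap {α : Type} (l : List α) (f : α → List (Con Δ V)) :
    occ (l.flatMap f) = l.flatMap fun a => occ (f a) := by
  simp [occ, List.flatMap_assoc]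

theorem mem_occ {cs : List (Con Δ V)} {c : Con Δ V} (hc : c ∈ cs) (e : Fin c.1.1.1) :
    c.2 e ∈ occ cs :=
  List.mem_flatMap.2 ⟨c, hc, List.mem_ofFn.2 ⟨e, rfl⟩⟩

theorem occ_perm {cs cs' : List (Con Δ V)} (h : cs.Perm cs') : (occ cs).Perm (occ cs') :=
  h.flatMap_right _

/-- If no variable occurs twice and all arities are positive, no constraint is repeated. -/
theorem nodup_of_occ {cs : List (Con Δ V)} (h : (occ cs).Nodup) (h' : ∀ c ∈ cs, 0 < c.1.1.1) :
    cs.Nodup := by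
  rw [occ, List.nodup_flatMap] at h
  refine (h.2.imp_of_mem ?_)
  intro a b ha _ hab e
  subst e
  exact hab (List.mem_ofFn.2 ⟨⟨0, h' a ha⟩, rfl⟩) (List.mem_ofFn.2 ⟨⟨0, h' a ha⟩, rfl⟩)

theorem satL_map (f : V → V') (cs : List (Con Δ V)) (s : V' → Bool) :
    SatL (cs.map (Con.map f)) s ↔ SatL cs fun x => s (f x) :=
  List.forall_mem_map

theorem satL_lift (h : Γ ⊆ Δ) (cs : List (Con Γ V)) (s : V → Bool) :
    SatL (cs.map (Con.lift h)) s ↔ SatL cs s :=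
  List.forall_mem_map

theorem satL_append (cs cs' : List (Con Δ V)) (s : V → Bool) :
    SatL (cs ++ cs') s ↔ SatL cs s ∧ SatL cs' s := by
  simp only [SatL, List.mem_append]
  exact ⟨fun h => ⟨fun c hc => h c (.inl hc), fun c hc => h c (.inr hc)⟩,
    fun h c hc => hc.elim (h.1 c) (h.2 c)⟩

theorem satL_flatMap {α : Type} (l : List α) (f : α → List (Con Δ V)) (s : V → Bool) :
    SatL (l.flatMap f) s ↔ ∀ a ∈ l, SatL (f a) s := by
  simp only [SatL, List.mem_flatMap]
  exact ⟨fun h a ha c hc => h c ⟨a, ha, hc⟩, fun h c ⟨a, ha, hc⟩ => h a ha c hc⟩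

theorem satL_number {k : ℕ} {cs : List (Con Δ V)} {s : V × ℕ → Bool} {a : V → Bool}
    (h : ∀ v j, s (v, j) = a v) : SatL (number k cs) s ↔ SatL cs a := by
  obtain rfl : s = fun x => a x.1 := funext fun ⟨v, j⟩ => h v j
  rw [← satL_map Prod.fst, map_fst_number]

theorem count_ofFn {α : Type} [DecidableEq α] {n : ℕ} (f : Fin n → α) (a : α) :
    (List.ofFn f).count a = (Finset.univ.filter fun i => f i = a).card := by
  induction n with
  | zero => simp
  | succ n ih =>
    rw [List.ofFn_succ, List.count_cons, ih, Fin.card_filter_univ_succ]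
    by_cases h : f 0 = a <;> simp [h]

theorem CSPInstance.varDegree_eq_count (I : CSPInstance Δ) (v : Fin I.numVars) :
    I.varDegree v = (occ I.constraints).count v := by
  rw [varDegree, occ, List.count_flatMap]
  congr 2
  funext c
  simp only [Function.comp, count_ofFn]

end ConList

/-! ### Gadgets -/

/-- An instance that simulates equality of its first `k` variables, without trivial constraints. -/
structure Gadget (Δ : ConstraintLanguage) (d k : ℕ) where
  numVars : ℕ
  cs : List (Con Δ (Fin numVars))
  nodup : cs.Nodup
  nontrivial : ∀ c ∈ cs, ∃ s, ¬ c.Holds s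
  le : k ≤ numVars
  m : ℕ
  m_pos : 0 < m
  sols : {s // SatL cs s} ≃ Bool × Fin m
  sols_port : ∀ (s : {s // SatL cs s}) (i : Fin k), s.1 (Fin.castLE le i) = (sols s).1
  degree_le : ∀ v, (occ cs).count v ≤ d
  degree_port : ∀ i : Fin k, (occ cs).count (Fin.castLE le i) + 1 ≤ d

/-- The common value on the first `k` variables splits the solutions into two classes of size `m`;
`0 < k` provides a variable on which this value can be read. -/
theorem exists_gadget {Γ : ConstraintLanguage} {d k : ℕ} (hk : 0 < k) (h : DSimulatesEqK d k Γ) :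
    Nonempty (Gadget (Γ ∪ pinLanguage) d k) := by
  classical
  obtain ⟨I, hkI, m, hm, h0, h1, hall, hd, hdp⟩ := h
  -- Dropping the constraints that always hold does not change the solutions and can only lower
  -- degrees. Trivial nullary constraints, for example, would otherwise be repeated in every copy of
  -- the gadget.
  set cs : List (Con (Γ ∪ pinLanguage) (Fin I.numVars)) :=
    I.constraints.filter fun c => decide (∃ s, ¬ Con.Holds s c) with hcs
  have hsat : ∀ s, SatL cs s ↔ I.Satisfies s := by
    intro s
    constructor
    · intro hs c hc
      by_contra hn
      exact hn (hs c (List.mem_filter.2 ⟨hc, by simpa using ⟨s, hn⟩⟩))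
    · exact fun hs c hc => hs c (List.mem_filter.1 hc).1
  have hsub : ∀ v, (occ cs).count v ≤ I.varDegree v := by
    intro v
    rw [I.varDegree_eq_count]
    exact List.Sublist.count_le _ (List.filter_sublist.flatMap _)
  have hdeg : ∀ v, I.varDegree v ≤ d := fun v => (Finset.le_sup (Finset.mem_univ v)).trans hd
  let val : {s // SatL cs s} → Bool := fun s => s.1 (Fin.castLE hkI ⟨0, hk⟩)
  have hval : ∀ (s : {s // SatL cs s}) (i : Fin k), s.1 (Fin.castLE hkI i) = val s := by
    intro s i
    rcases hall s.1 ((hsat _).1 s.2) with h | h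
    · rw [h i, ← h ⟨0, hk⟩]
    · rw [h i, ← h ⟨0, hk⟩]
  have hcard : ∀ b, Nat.card {s // val s = b} = m := by
    intro b
    have : Nat.card {s // val s = b} =
        Set.ncard {s | I.Satisfies s ∧ ∀ i : Fin k, s (Fin.castLE hkI i) = b} := by
      rw [← Nat.card_coe_set_eq]
      refine Nat.card_congr ⟨fun s => ⟨s.1.1, (hsat _).1 s.1.2, fun i => (hval s.1 i).trans s.2⟩,
        fun s => ⟨⟨s.1, (hsat _).2 s.2.1⟩, s.2.2 _⟩, fun _ => rfl, fun _ => rfl⟩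
    rw [this]
    cases b
    · exact h0
    · exact h1
  let e : ∀ b, {s // val s = b} ≃ Fin m := fun b =>
    (Finite.equivFin _).trans (finCongr (hcard b))
  refine ⟨⟨I.numVars, cs, I.nodup.filter _, fun c hc => by simpa using (List.mem_filter.1 hc).2,
    hkI, m, hm, (Equiv.sigmaFiberEquiv val).symm.trans ((Equiv.sigmaCongrRight e).trans
      (Equiv.sigmaEquivProd _ _)),
    fun s i => hval s i, fun v => (hsub v).trans (hdeg v),
      fun i => (Nat.add_le_add_right (hsub _) 1).trans (hdp i)⟩⟩

/-! ### The instance of bounded degree -/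

namespace Gadget

variable {Δ : ConstraintLanguage} {d k : ℕ}

/-- The `j`-th of the variables that are forced to be equal. -/
def port (G : Gadget Δ d (k + 1)) (j : ℕ) : Fin G.numVars := Fin.castLE G.le (Fin.ofNat (k + 1) j)

/-- `port` reduces its argument modulo `k + 1`, so it is faithful only for `j ≤ k`. -/
theorem val_port (G : Gadget Δ d (k + 1)) {j : ℕ} (hj : j ≤ k) : (G.port j : ℕ) = j := by
  exact Nat.mod_eq_of_lt (Nat.lt_succ_of_le hj)

theorem port_inj (G : Gadget Δ d (k + 1)) {i j : ℕ} (hi : i ≤ k) (hj : j ≤ k)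
    (h : G.port i = G.port j) : i = j := by
  rw [← G.val_port hi, h, G.val_port hj]

theorem sols_port' (G : Gadget Δ d (k + 1)) (s : {s // SatL G.cs s}) (j : ℕ) :
    s.1 (G.port j) = (G.sols s).1 := G.sols_port s _

theorem degree_port' (G : Gadget Δ d (k + 1)) (j : ℕ) : (occ G.cs).count (G.port j) + 1 ≤ d :=
  G.degree_port _

/-- A nullary constraint that fails once fails always, but the gadget has solutions. -/
theorem arity_pos (G : Gadget Δ d k) {c} (hc : c ∈ G.cs) : 0 < c.1.1.1 := by
  by_contra hr
  obtain ⟨s, hs⟩ := G.nontrivial c hc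
  have := (G.sols.symm (true, ⟨0, G.m_pos⟩)).2 c hc
  apply hs
  rw [Con.Holds] at this ⊢
  convert this using 2
  exact absurd (Fin.pos ‹_›) hr

/-- If all variables of a constraint are ports, then the constant tuples belong to its relation. -/
theorem const_mem (G : Gadget Δ d (k + 1)) {c} (hc : c ∈ G.cs) (h : ∀ e, ∃ j, c.2 e = G.port j)
    (b : Bool) : (fun _ => b) ∈ c.1.1.2 := by
  have := (G.sols.symm (b, ⟨0, G.m_pos⟩)).2 c hc
  rw [Con.Holds] at this
  convert this using 2
  rename_i e
  obtain ⟨j, hj⟩ := h e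
  rw [hj, sols_port']
  simp

/-- The total number of occurrences of variables. -/
abbrev entries (H : Gadget Δ d k) : ℕ := (occ H.cs).length

end Gadget

/-- A cell consists of a layer and a variable of the given instance. -/
abbrev Cell (n T : ℕ) : Type := Fin (T + 2) × Fin n

/-- The cell of the same variable in the (cyclically) preceding layer. -/
def Cell.pred {n T : ℕ} (p : Cell n T) : Cell n T := (p.1 - 1, p.2)

/-- There are at least two layers, even if `T = 0`. Hence the two ends of a link lie in different
blocks. -/
theorem Cell.pred_ne {n T : ℕ} (p : Cell n T) : p.pred ≠ p := by
  intro h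
  have h1 : p.1 - 1 = p.1 := congrArg Prod.fst h
  simp at h1

theorem Cell.pred_injective {n T : ℕ} : Function.Injective (Cell.pred (n := n) (T := T)) := by
  intro p q h
  simp only [Cell.pred, Prod.mk.injEq, sub_left_inj] at h
  exact Prod.ext h.1 h.2

/-- All cells, ordered by layers. -/
def cells (n T : ℕ) : List (Cell n T) := (List.finRange ((T + 2) * n)).map finProdFinEquiv.symm

theorem mem_cells {n T : ℕ} (p : Cell n T) : p ∈ cells n T := by
  simp only [cells, List.mem_map, List.mem_finRange, true_and]
  exact ⟨finProdFinEquiv p, by simp⟩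

theorem nodup_cells (n T : ℕ) : (cells n T).Nodup :=
  (List.nodup_finRange _).map finProdFinEquiv.symm.injective

section Construction

variable {Γ Δ : ConstraintLanguage} {d : ℕ} (hΓ : Γ ⊆ Δ) (H : Gadget Δ d 2)
  (G : Gadget Δ d (2 * H.entries + 2))

/-- The variables of the constructed instance: each cell has a block of variables for each variable
of `H`. -/
abbrev Var (n T : ℕ) : Type := (Cell n T × Fin H.numVars) × Fin G.numVars

variable {n T : ℕ}

/-- The variable that replaces the `j`-th occurrence of a variable of the given instance. -/
def occVar (x : Fin n × ℕ) : Var H G n T :=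
  (((Fin.ofNat (T + 2) x.2, x.1), H.port 0), G.port (2 * H.entries))

/-- The variable that replaces an occurrence of a variable of `H` in the copy of `H` that links the
cell `p` with its predecessor. -/
def linkVar (p : Cell n T) (x : Fin H.numVars × ℕ) : Var H G n T :=
  if x.1 = H.port 1 then ((p.pred, H.port 0), G.port (H.entries + x.2))
  else ((p, x.1), G.port x.2)

def occPart (T : ℕ) (cs : List (Con Γ (Fin n))) : List (Con Δ (Var H G n T)) :=
  ((number 2 cs).map (Con.lift hΓ)).map (Con.map (occVar H G))

def linkPart (p : Cell n T) : List (Con Δ (Var H G n T)) :=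
  (number 0 H.cs).map (Con.map (linkVar H G p))

def blockPart (q : Cell n T × Fin H.numVars) : List (Con Δ (Var H G n T)) :=
  G.cs.map (Con.map (Prod.mk q))

/-- Links and blocks are interleaved cell by cell, the order in which a single loop over the cells
can write them; `boundedCs_perm` separates them for the proofs. -/
def boundedCs (T : ℕ) (cs : List (Con Γ (Fin n))) : List (Con Δ (Var H G n T)) :=
  occPart hΓ H G T cs ++ (cells n T).flatMap fun p =>
    linkPart H G p ++ (List.finRange H.numVars).flatMap fun i => blockPart H G (p, i)

/-- All blocks. -/
def blocks (n T : ℕ) : List (Cell n T × Fin H.numVars) :=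
  (cells n T).product (List.finRange H.numVars)

theorem boundedCs_perm (T : ℕ) (cs : List (Con Γ (Fin n))) :
    (boundedCs hΓ H G T cs).Perm ((occPart hΓ H G T cs ++ (cells n T).flatMap (linkPart H G)) ++
      (blocks H n T).flatMap (blockPart H G)) := by
  rw [boundedCs, List.append_assoc]
  refine .append_left _ ?_
  have : (blocks H n T).flatMap (blockPart H G) = (cells n T).flatMap fun p =>
      (List.finRange H.numVars).flatMap fun i => blockPart H G (p, i) := by
    simp [blocks, List.product, List.flatMap_assoc, List.flatMap_map]
  rw [this]
  exact (List.flatMap_append_perm _ _ _).symm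

variable {H G}

/-- The ports of a block are allotted in disjoint ranges: those below `H.entries` serve the link of
its own cell, the next `H.entries` the link of the succeeding cell, and the port `2 * H.entries` the
given instance. -/
theorem linkVar_inj {p p' : Cell n T} {x x' : Fin H.numVars × ℕ} (hx : x.2 < H.entries)
    (hx' : x'.2 < H.entries) (h : linkVar H G p x = linkVar H G p' x') : p = p' ∧ x = x' := by
  unfold linkVar at h
  split_ifs at h with h1 h2 h2
  · simp only [Prod.mk.injEq] at h
    have := G.port_inj (by omega) (by omega) h.2
    exact ⟨Cell.pred_injective h.1.1, Prod.ext (h1.trans h2.symm) (by omega)⟩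
  · simp only [Prod.mk.injEq] at h
    have := G.port_inj (by omega) (by omega) h.2
    omega
  · simp only [Prod.mk.injEq] at h
    have := G.port_inj (by omega) (by omega) h.2
    omega
  · simp only [Prod.mk.injEq] at h
    have := G.port_inj (by omega) (by omega) h.2
    exact ⟨h.1.1, Prod.ext h.1.2 this⟩

theorem linkVar_ne_occVar {p : Cell n T} {x : Fin H.numVars × ℕ} (hx : x.2 < H.entries)
    (y : Fin n × ℕ) : linkVar H G p x ≠ occVar H G y := by
  intro h
  unfold linkVar occVar at h
  split_ifs at h with h1
  · simp only [Prod.mk.injEq] at h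
    have := G.port_inj (by omega) (by omega) h.2
    omega
  · simp only [Prod.mk.injEq] at h
    have := G.port_inj (by omega) (by omega) h.2
    omega

/-- The number of an occurrence is taken modulo `T + 2` to give a layer; occurrences numbered from
`2` to `T + 1` are not affected. -/
theorem occVar_inj {x x' : Fin n × ℕ} (hx : x.2 < T + 2) (hx' : x'.2 < T + 2)
    (h : occVar (T := T) H G x = occVar H G x') : x = x' := by
  simp only [occVar, Prod.mk.injEq, and_true] at h
  have h1 := congrArg Fin.val h.1
  simp only [Fin.val_ofNat, Nat.mod_eq_of_lt hx, Nat.mod_eq_of_lt hx'] at h1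
  exact Prod.ext h.2 h1

theorem nodup_zipIdx {α : Type} (l : List α) (k : ℕ) : (l.zipIdx k).Nodup := by
  apply List.Nodup.of_map Prod.snd
  rw [List.zipIdx_map_snd]
  exact List.nodup_range'

theorem snd_lt_of_mem_number {V : Type} {k : ℕ} {cs : List (Con Δ V)} {x : V × ℕ}
    (h : x ∈ occ (number k cs)) : x.2 < (occ cs).length + k := by
  rw [occ_number] at h
  have := List.snd_lt_add_of_mem_zipIdx h
  omega

theorem mem_occ_links {v : Var H G n T} :
    v ∈ occ ((cells n T).flatMap (linkPart H G)) ↔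
      ∃ p, ∃ x ∈ occ (number 0 H.cs), linkVar H G p x = v := by
  simp only [occ_flatMap, linkPart, occ_map, List.mem_flatMap, List.mem_map, mem_cells, true_and]

theorem mem_occ_occPart {cs : List (Con Γ (Fin n))} {v : Var H G n T} :
    v ∈ occ (occPart hΓ H G T cs) ↔ ∃ x ∈ occ (number 2 cs), occVar H G x = v := by
  simp only [occPart, occ_map, occ_lift, List.mem_map]

theorem nodup_occ_links :
    (occ ((cells n T).flatMap (linkPart H G))).Nodup := by
  simp only [occ_flatMap, linkPart, occ_map]
  rw [List.nodup_flatMap]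
  constructor
  · intro p _
    refine List.Nodup.map_on ?_ (by rw [occ_number]; exact nodup_zipIdx _ _)
    intro x hx y hy h
    exact (linkVar_inj (snd_lt_of_mem_number hx) (snd_lt_of_mem_number hy) h).2
  · refine (nodup_cells n T).imp ?_
    intro p p' hp v hv hv'
    simp only [List.mem_map] at hv hv'
    obtain ⟨x, hx, rfl⟩ := hv
    obtain ⟨y, hy, h⟩ := hv'
    exact hp (linkVar_inj (snd_lt_of_mem_number hx) (snd_lt_of_mem_number hy) h.symm).1

theorem nodup_occ_occPart {cs : List (Con Γ (Fin n))} (hT : (occ cs).length = T) :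
    (occ (occPart hΓ H G T cs)).Nodup := by
  simp only [occPart, occ_map, occ_lift]
  refine List.Nodup.map_on ?_ (by rw [occ_number]; exact nodup_zipIdx _ _)
  intro x hx y hy h
  have := snd_lt_of_mem_number hx
  have := snd_lt_of_mem_number hy
  exact occVar_inj (by omega) (by omega) h

theorem disjoint_occ {cs : List (Con Γ (Fin n))} :
    (occ (occPart hΓ H G T cs)).Disjoint (occ ((cells n T).flatMap (linkPart H G))) := by
  intro v hv hv'
  obtain ⟨p, x, hx, rfl⟩ := mem_occ_links.1 hv'
  obtain ⟨y, -, hy⟩ := (mem_occ_occPart hΓ).1 hv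
  exact linkVar_ne_occVar (snd_lt_of_mem_number hx) y hy.symm

theorem exists_port_of_mem_occ {cs : List (Con Γ (Fin n))} {v : Var H G n T}
    (h : v ∈ occ (occPart hΓ H G T cs ++ (cells n T).flatMap (linkPart H G))) :
    ∃ j, v.2 = G.port j := by
  rw [occ_append, List.mem_append, mem_occ_occPart, mem_occ_links] at h
  rcases h with ⟨x, -, rfl⟩ | ⟨p, x, -, rfl⟩
  · exact ⟨_, rfl⟩
  · unfold linkVar
    split_ifs
    · exact ⟨_, rfl⟩
    · exact ⟨_, rfl⟩

/-- This is the heart of the degree bound: outside the copies of `G`, every variable is used at most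
once. -/
theorem nodup_occ_append {cs : List (Con Γ (Fin n))} (hT : (occ cs).length = T) :
    (occ (occPart hΓ H G T cs ++ (cells n T).flatMap (linkPart H G))).Nodup := by
  rw [occ_append]
  exact (nodup_occ_occPart hΓ hT).append nodup_occ_links (disjoint_occ hΓ)

/-- The given constraints may be nullary, so `nodup_of_occ` does not apply; instead, projecting each
new variable to its original one recovers the given list. -/
theorem nodup_occPart {cs : List (Con Γ (Fin n))} (hcs : cs.Nodup) :
    (occPart hΓ H G T cs).Nodup := by
  apply List.Nodup.of_map (Con.map fun v : Var H G n T => v.1.1.2)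
  have : (occPart hΓ H G T cs).map (Con.map fun v : Var H G n T => v.1.1.2) =
      cs.map (Con.lift hΓ) := by
    conv_rhs => rw [← map_fst_number 2 cs]
    simp only [occPart, List.map_map]
    rfl
  rw [this]
  exact hcs.map (Con.lift_injective hΓ)

theorem arity_pos_of_mem_number {k : ℕ} {c} (hc : c ∈ number k H.cs) : 0 < c.1.1.1 := by
  have : c.map Prod.fst ∈ H.cs := by
    have := List.mem_map_of_mem (f := Con.map Prod.fst) hc
    rwa [map_fst_number] at this
  exact H.arity_pos this

theorem arity_pos_of_mem_links {c} (hc : c ∈ (cells n T).flatMap (linkPart H G)) :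
    0 < c.1.1.1 := by
  obtain ⟨p, -, hp⟩ := List.mem_flatMap.1 hc
  obtain ⟨c, hc₁, rfl⟩ := List.mem_map.1 hp
  exact arity_pos_of_mem_number hc₁

/-- Arities in `G` are positive, so a constraint of a block has a variable and thereby determines
its block. -/
theorem nodup_blocks : ((blocks H n T).flatMap (blockPart H G)).Nodup := by
  rw [List.nodup_flatMap]
  constructor
  · intro q _
    exact G.nodup.map (Con.map_injective (Prod.mk_right_injective q))
  · refine ((nodup_cells n T).product (List.nodup_finRange _)).imp ?_
    intro q q' hq c hc hc'
    obtain ⟨c, hc₁, rfl⟩ := List.mem_map.1 hc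
    obtain ⟨c', -, h⟩ := List.mem_map.1 hc'
    have hpos := G.arity_pos hc₁
    obtain ⟨R, u⟩ := c
    obtain ⟨R', u'⟩ := c'
    simp only [Con.map, Sigma.mk.injEq] at h
    obtain ⟨rfl, h⟩ := h
    have := congrFun (eq_of_heq h) ⟨0, hpos⟩
    exact hq (congrArg Prod.fst this).symm

/-- A constraint of a block all of whose variables are ports is satisfied by constant tuples, while
the nontrivial constraints of `H` and `G` that concern only one variable are not. -/
theorem disjoint_blocks {cs : List (Con Γ (Fin n))} :
    (occPart hΓ H G T cs ++ (cells n T).flatMap (linkPart H G)).Disjoint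
      ((blocks H n T).flatMap (blockPart H G)) := by
  intro c hc hc'
  obtain ⟨q, -, hq⟩ := List.mem_flatMap.1 hc'
  obtain ⟨c₀, hc₀, rfl⟩ := List.mem_map.1 hq
  have hport : ∀ e, ∃ j, c₀.2 e = G.port j := fun e =>
    exists_port_of_mem_occ hΓ (mem_occ hc e)
  suffices ∃ b, (fun _ => b) ∉ c₀.1.1.2 by
    obtain ⟨b, hb⟩ := this
    exact hb (G.const_mem hc₀ hport b)
  rcases List.mem_append.1 hc with h | h
  · apply Con.exists_const_notMem _ (G.nontrivial c₀ hc₀)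
    -- The given instance uses only this one port of a block, so a constraint of it that lies within
    -- a block concerns a single variable.
    have hblock : ∀ e, c₀.2 e = G.port (2 * H.entries) := by
      intro e
      obtain ⟨x, -, hx⟩ := (mem_occ_occPart hΓ).1 (mem_occ h e)
      exact (congrArg Prod.snd hx).symm
    exact fun e e' => (hblock e).trans (hblock e').symm
  · obtain ⟨p, -, h⟩ := List.mem_flatMap.1 h
    obtain ⟨c₁, hc₁, h⟩ := List.mem_map.1 h
    obtain ⟨R, u⟩ := c₀
    obtain ⟨R', u'⟩ := c₁
    simp only [Con.map, Sigma.mk.injEq] at h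
    obtain ⟨rfl, h⟩ := h
    replace h := fun e => congrFun (eq_of_heq h) e
    have hmem : Con.map Prod.fst ⟨R', u'⟩ ∈ H.cs := by
      have := List.mem_map_of_mem (f := Con.map Prod.fst) hc₁
      rwa [map_fst_number] at this
    refine Con.exists_const_notMem (c := Con.map Prod.fst ⟨R', u'⟩) ?_ (H.nontrivial _ hmem)
    intro e e'
    have h1 := congrArg Prod.fst ((h e).trans rfl)
    have h2 := congrArg Prod.fst ((h e').trans rfl)
    simp only [Con.map]
    -- Both variables lie in the same block `q`. By `Cell.pred_ne` they come from the same end of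
    -- the link, hence from the same variable of `H`.
    unfold linkVar at h1 h2
    split_ifs at h1 h2 with a b b
    · exact a.trans b.symm
    · exact absurd (congrArg Prod.fst (h1.trans h2.symm)) (Cell.pred_ne p)
    · exact absurd (congrArg Prod.fst (h2.trans h1.symm)) (Cell.pred_ne p)
    · exact congrArg Prod.snd (h1.trans h2.symm)

theorem nodup_boundedCs {cs : List (Con Γ (Fin n))} (hcs : cs.Nodup) :
    (boundedCs hΓ H G T cs).Nodup := by
  rw [(boundedCs_perm hΓ H G T cs).nodup_iff]
  refine List.Nodup.append (List.Nodup.append (nodup_occPart hΓ hcs) ?_ ?_) nodup_blocks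
    (disjoint_blocks hΓ)
  · exact nodup_of_occ nodup_occ_links fun c hc => arity_pos_of_mem_links hc
  · intro c hc hc'
    have hpos := arity_pos_of_mem_links hc'
    exact disjoint_occ hΓ (mem_occ hc ⟨0, hpos⟩) (mem_occ hc' ⟨0, hpos⟩)

/-- Only the block that contains `v` contributes. -/
theorem count_occ_blocks (v : Var H G n T) :
    (occ ((blocks H n T).flatMap (blockPart H G))).count v ≤ (occ G.cs).count v.2 := by
  classical
  obtain ⟨q, x⟩ := v
  simp only [occ_flatMap, blockPart, occ_map, List.count_flatMap]
  have h : ∀ q', (List.count (q, x) ∘ fun q' => (occ G.cs).map (Prod.mk q')) q' =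
      if q' = q then (occ G.cs).count x else 0 := by
    intro q'
    simp only [Function.comp]
    split_ifs with hq
    · subst hq
      exact List.count_map_of_injective _ _ (Prod.mk_right_injective q') x
    · rw [List.count_eq_zero]
      simp only [List.mem_map, not_exists, not_and]
      exact fun y _ h => hq (congrArg Prod.fst h)
  rw [funext h]
  have hnd : (blocks H n T).Nodup := (nodup_cells n T).product (List.nodup_finRange _)
  generalize blocks H n T = l at hnd
  induction l with
  | nil => simp
  | cons a l ih =>
    rw [List.nodup_cons] at hnd
    rw [List.map_cons, List.sum_cons]
    by_cases ha : a = q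
    · subst ha
      have : (l.map fun q' => if q' = a then (occ G.cs).count x else 0).sum = 0 := by
        rw [List.sum_eq_zero_iff]
        simp only [List.mem_map]
        rintro _ ⟨b, hb, rfl⟩
        rw [if_neg]
        rintro rfl
        exact hnd.1 hb
      simp [this]
    · simpa [ha] using ih hnd.2

/-- A variable used outside the blocks is a port, with degree at most `d - 1` in its copy of `G` and
one further occurrence; any other variable occurs only in its copy of `G`. -/
theorem count_boundedCs {cs : List (Con Γ (Fin n))} (hT : (occ cs).length = T)
    (v : Var H G n T) : (occ (boundedCs hΓ H G T cs)).count v ≤ d := by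
  classical
  rw [(occ_perm (boundedCs_perm hΓ H G T cs)).count_eq, occ_append, List.count_append]
  have h1 := List.nodup_iff_count_le_one.1 (nodup_occ_append (H := H) (G := G) hΓ hT) v
  have h2 := count_occ_blocks v
  by_cases hv : v ∈ occ (occPart hΓ H G T cs ++ (cells n T).flatMap (linkPart H G))
  · obtain ⟨j, hj⟩ := exists_port_of_mem_occ hΓ hv
    rw [hj] at h2
    have := G.degree_port' j
    omega
  · rw [List.count_eq_zero.2 hv]
    have := G.degree_le v.2
    omega

end Construction

/-! ### Counting the solutions of the constructed instance. -/

section Counting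

variable {Γ Δ : ConstraintLanguage} {d : ℕ} (hΓ : Γ ⊆ Δ) {H : Gadget Δ d 2}
  {G : Gadget Δ d (2 * H.entries + 2)} {n T : ℕ}

theorem satL_boundedCs (cs : List (Con Γ (Fin n))) (s : Var H G n T → Bool) :
    SatL (boundedCs hΓ H G T cs) s ↔ SatL (number 2 cs) (fun x => s (occVar H G x)) ∧
      (∀ p, SatL (number 0 H.cs) fun x => s (linkVar H G p x)) ∧
      ∀ q, SatL G.cs fun x => s (q, x) := by
  simp only [boundedCs, satL_append, satL_flatMap, occPart, linkPart, blockPart, satL_map,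
    satL_lift, mem_cells, true_imp_iff, List.mem_finRange, forall_and, Prod.forall]

theorem Gadget.port_zero_ne_port_one (H : Gadget Δ d 2) : H.port 0 ≠ H.port 1 := by
  intro h
  have := H.port_inj (by omega) (by omega) h
  omega

/-- The assignment to the copy of `H` that links the cell `p` with its predecessor. -/
def linkAssignment (H : Gadget Δ d 2) (b : Cell n T × Fin H.numVars → Bool) (p : Cell n T)
    (i : Fin H.numVars) : Bool :=
  if i = H.port 1 then b (p.pred, H.port 0) else b (p, i)

/-- Assignments of values to blocks that satisfy all links and the given instance. -/
def BlockSat (H : Gadget Δ d 2) (T : ℕ) (cs : List (Con Γ (Fin n)))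
    (b : Cell n T × Fin H.numVars → Bool) : Prop :=
  (∀ p, SatL H.cs (linkAssignment H b p)) ∧ SatL cs fun v => b ((0, v), H.port 0)

/-- The link at `p` equates the two ports of `H`, that is, the values of `p` and of its predecessor;
descend through the layers to layer `0`. -/
theorem eq_of_links {b : Cell n T × Fin H.numVars → Bool}
    (h : ∀ p, SatL H.cs (linkAssignment H b p)) (p : Cell n T) :
    b (p, H.port 0) = b ((0, p.2), H.port 0) := by
  have key : ∀ p : Cell n T, b (p, H.port 0) = b (p.pred, H.port 0) := by
    intro p
    have h0 := H.sols_port' ⟨_, h p⟩ 0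
    have h1 := H.sols_port' ⟨_, h p⟩ 1
    simp only [linkAssignment, if_neg H.port_zero_ne_port_one, if_true] at h0 h1
    rw [h0, h1]
  obtain ⟨j, v⟩ := p
  induction j using Fin.induction with
  | zero => rfl
  | succ j ih =>
    rw [key]
    have : Cell.pred (j.succ, v) = (j.castSucc, v) := by
      simp [Cell.pred, sub_eq_iff_eq_add, Fin.coeSucc_eq_succ]
    rw [this]
    exact ih

/-- Constraints outside the blocks see only ports, on which `s` depends only on the block. -/
theorem satL_boundedCs_iff (cs : List (Con Γ (Fin n))) {s : Var H G n T → Bool}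
    {b : Cell n T × Fin H.numVars → Bool} (hb : ∀ q j, s (q, G.port j) = b q) :
    SatL (boundedCs hΓ H G T cs) s ↔ BlockSat H T cs b ∧ ∀ q, SatL G.cs fun x => s (q, x) := by
  have hl : ∀ p, (SatL (number 0 H.cs) fun x => s (linkVar H G p x)) ↔
      SatL H.cs (linkAssignment H b p) := by
    intro p
    apply satL_number
    intro i j
    simp only [linkVar, linkAssignment]
    split_ifs <;> exact hb _ _
  -- The links are moved to the front: they are needed to replace the layer of each occurrence by
  -- layer `0`.
  rw [satL_boundedCs, BlockSat, and_assoc, ← and_assoc, and_comm (a := SatL _ _), and_assoc]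
  simp only [hl]
  refine and_congr_right fun h => and_congr_left fun _ => ?_
  apply satL_number
  intro v j
  rw [occVar, hb, eq_of_links h]

/-- Satisfying assignments of the constructed instance. -/
def boundedEquiv (cs : List (Con Γ (Fin n))) :
    {s : Var H G n T → Bool // SatL (boundedCs hΓ H G T cs) s} ≃
      {b : Cell n T × Fin H.numVars → Bool // BlockSat H T cs b} ×
        (Cell n T × Fin H.numVars → Fin G.m) where
  toFun s := (⟨fun q => (G.sols ⟨_, ((satL_boundedCs hΓ cs s.1).1 s.2).2.2 q⟩).1,
      ((satL_boundedCs_iff hΓ cs fun q j =>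
        G.sols_port' ⟨fun x => s.1 (q, x), ((satL_boundedCs hΓ cs s.1).1 s.2).2.2 q⟩ j).1 s.2).1⟩,
    fun q => (G.sols ⟨_, ((satL_boundedCs hΓ cs s.1).1 s.2).2.2 q⟩).2)
  invFun t := ⟨fun v => (G.sols.symm (t.1.1 v.1, t.2 v.1)).1 v.2,
    (satL_boundedCs_iff hΓ cs fun q j => by rw [G.sols_port', Equiv.apply_symm_apply]).2
      ⟨t.1.2, fun q => (G.sols.symm (t.1.1 q, t.2 q)).2⟩⟩
  left_inv s := by
    ext v
    simp
  right_inv t := by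
    ext q <;> simp

/-- The assignment to blocks determined by an assignment `a` of the given instance and the choice of
a satisfying assignment for each link. -/
def blockAssignment (H : Gadget Δ d 2) (a : Fin n → Bool) (t : Cell n T → Fin H.m × Bool)
    (q : Cell n T × Fin H.numVars) : Bool :=
  if q.2 = H.port 1 then (t q.1).2 else (H.sols.symm (a q.1.2, (t q.1).1)).1 q.2

theorem blockAssignment_port_zero (a : Fin n → Bool) (t : Cell n T → Fin H.m × Bool)
    (p : Cell n T) : blockAssignment H a t (p, H.port 0) = a p.2 := by
  rw [blockAssignment, if_neg H.port_zero_ne_port_one, H.sols_port', Equiv.apply_symm_apply]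

theorem linkAssignment_blockAssignment (a : Fin n → Bool) (t : Cell n T → Fin H.m × Bool)
    (p : Cell n T) :
    linkAssignment H (blockAssignment H a t) p = (H.sols.symm (a p.2, (t p).1)).1 := by
  funext i
  rw [linkAssignment]
  split_ifs with h
  · rw [blockAssignment_port_zero, h, H.sols_port', Equiv.apply_symm_apply]
    rfl
  · rw [blockAssignment, if_neg h]

theorem blockSat_blockAssignment {cs : List (Con Γ (Fin n))} {a : Fin n → Bool} (ha : SatL cs a)
    (t : Cell n T → Fin H.m × Bool) : BlockSat H T cs (blockAssignment H a t) := by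
  refine ⟨fun p => ?_, ?_⟩
  · rw [linkAssignment_blockAssignment]
    exact (H.sols.symm _).2
  · simpa only [blockAssignment_port_zero] using ha

/-- Assignments to the blocks that satisfy all constraints. -/
def blockEquiv (H : Gadget Δ d 2) (T : ℕ) (cs : List (Con Γ (Fin n))) :
    {b : Cell n T × Fin H.numVars → Bool // BlockSat H T cs b} ≃
      {a : Fin n → Bool // SatL cs a} × (Cell n T → Fin H.m × Bool) where
  toFun b := (⟨_, b.2.2⟩, fun p => ((H.sols ⟨_, b.2.1 p⟩).2, b.1 (p, H.port 1)))
  invFun t := ⟨_, blockSat_blockAssignment t.1.2 t.2⟩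
  left_inv b := by
    ext ⟨p, i⟩
    have h0 := H.sols_port' ⟨_, b.2.1 p⟩ 0
    simp only [linkAssignment, if_neg H.port_zero_ne_port_one] at h0
    rw [eq_of_links b.2.1] at h0
    simp only [blockAssignment]
    split_ifs with h
    · rw [h]
    · rw [h0]
      simp [linkAssignment, h]
  right_inv t := by
    obtain ⟨a, t⟩ := t
    refine Prod.ext (Subtype.ext (funext fun v => blockAssignment_port_zero _ _ _))
      (funext fun p => Prod.ext ?_ ?_)
    · have : (⟨_, (blockSat_blockAssignment a.2 t).1 p⟩ : {s // SatL H.cs s}) =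
          H.sols.symm (a.1 p.2, (t p).1) :=
        Subtype.ext (linkAssignment_blockAssignment a.1 t p)
      simp only [this, Equiv.apply_symm_apply]
    · simp [blockAssignment]

/-- Each of the `(T + 2) * n` cells contributes `H.m` solutions of its link, `G.m` solutions for
each of its `H.numVars` blocks, and a factor `2` for the block of `H.port 1`. No link uses that
block, since `linkVar` goes to the predecessor instead, so its value is free. The cyclic arrangement
gives every cell a link and makes the factor uniform. -/
theorem card_satL_boundedCs (cs : List (Con Γ (Fin n))) :
    Nat.card {s : Var H G n T → Bool // SatL (boundedCs hΓ H G T cs) s} =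
      Nat.card {a : Fin n → Bool // SatL cs a} *
        (2 * H.m * G.m ^ H.numVars) ^ ((T + 2) * n) := by
  rw [Nat.card_congr (boundedEquiv hΓ cs), Nat.card_prod, Nat.card_congr (blockEquiv H T cs),
    Nat.card_prod, mul_assoc]
  congr 1
  simp only [Nat.card_eq_fintype_card, Fintype.card_fun, Fintype.card_prod, Fintype.card_fin,
    Fintype.card_bool]
  rw [mul_pow, mul_comm 2 H.m, pow_mul' G.m, ← pow_mul]
  ring_nf

end Counting

/-! ### The constructed instance and its code as a word. -/

section Encoding

variable {Γ Δ : ConstraintLanguage} {d : ℕ} (hΓ : Γ ⊆ Δ) (H : Gadget Δ d 2)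
  (G : Gadget Δ d (2 * H.entries + 2))

/-- Numbering of the variables of the constructed instance. -/
def varEquiv (n T : ℕ) : Var H G n T ≃ Fin ((T + 2) * n * H.numVars * G.numVars) :=
  (((finProdFinEquiv.prodCongr (Equiv.refl _)).trans finProdFinEquiv).prodCongr
    (Equiv.refl _)).trans finProdFinEquiv

theorem val_varEquiv {n T : ℕ} (v : Var H G n T) : (varEquiv H G n T v : ℕ) =
    (v.1.1.1 * n + v.1.1.2) * (H.numVars * G.numVars) + (v.1.2 * G.numVars + v.2) := by
  obtain ⟨⟨⟨j, a⟩, i⟩, x⟩ := v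
  simp only [varEquiv, Equiv.trans_apply, Equiv.prodCongr_apply, Prod.map, Equiv.refl_apply,
    finProdFinEquiv_apply_val]
  ring

/-- The constructed instance of bounded degree. -/
def boundedInstance (I : CSPInstance Γ) : CSPInstance Δ where
  numVars := ((occ I.constraints).length + 2) * I.numVars * H.numVars * G.numVars
  constraints := (boundedCs hΓ H G (occ I.constraints).length I.constraints).map
    (Con.map (varEquiv H G _ _))
  nodup := (nodup_boundedCs hΓ I.nodup).map (Con.map_injective (Equiv.injective _))

theorem CSPInstance.Z_eq_card (I : CSPInstance Γ) :
    I.Z = Nat.card {a : Fin I.numVars → Bool // SatL I.constraints a} := by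
  rw [CSPInstance.Z, ← Nat.card_coe_set_eq]
  rfl

theorem boundedInstance_Z (I : CSPInstance Γ) : (boundedInstance hΓ H G I).Z =
    I.Z * (2 * H.m * G.m ^ H.numVars) ^ (((occ I.constraints).length + 2) * I.numVars) := by
  rw [CSPInstance.Z_eq_card, I.Z_eq_card, ← card_satL_boundedCs hΓ (G := G)]
  refine Nat.card_congr (((varEquiv H G _ _).arrowCongr (Equiv.refl Bool)).symm.subtypeEquiv ?_)
  intro s
  exact satL_map _ _ _

theorem boundedInstance_degree (I : CSPInstance Γ) : (boundedInstance hΓ H G I).degree ≤ d := by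
  refine Finset.sup_le fun v _ => ?_
  rw [CSPInstance.varDegree_eq_count]
  obtain ⟨v, rfl⟩ := (varEquiv H G _ _).surjective v
  have h := List.count_map_of_injective (occ (boundedCs hΓ H G _ I.constraints))
    (varEquiv H G _ _) (Equiv.injective _) v
  rw [← occ_map] at h
  exact h.trans_le (count_boundedCs hΓ rfl v)

/-- Code of a constraint whose variables are natural numbers. -/
def encodeCon (c : Con Δ ℕ) : List (Sym Δ) := .inr c.1 :: (List.ofFn c.2).flatMap (encodeNum Δ)

theorem encodeConstraint_eq {n : ℕ} (c : Constraint Δ n) :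
    encodeConstraint c = encodeCon (Con.map Fin.val c) := by
  have : List.ofFn (Con.map Fin.val c).2 = (List.ofFn c.2).map Fin.val := by
    rw [List.map_ofFn]; rfl
  -- In `encodeConstraint` the scope is cast to a list of natural numbers as a whole, by this
  -- monadic map.
  have h : (do let a ← List.ofFn c.2; pure (a : ℕ)) = (List.ofFn c.2).map Fin.val := by
    simp [List.map_eq_flatMap]
  rw [encodeCon, this, encodeConstraint, h]
  rfl

/-- The constraints of a cell and the link with its predecessor. Variables are given by the cell
(`true` for the predecessor) and the number of the variable in its cell. -/
def template : List (Con Δ (Bool × ℕ)) :=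
  (number 0 H.cs).map (Con.map fun x => if x.1 = H.port 1 then (true, H.entries + x.2)
    else (false, x.1 * G.numVars + x.2)) ++
  (List.finRange H.numVars).flatMap fun i : Fin H.numVars =>
    G.cs.map (Con.map fun x : Fin G.numVars => (false, (i : ℕ) * G.numVars + (x : ℕ)))

/-- Code of the constraints given by a template, for cells with `L` variables. -/
def cellCode (L : ℕ) (τ : List (Con Δ (Bool × ℕ))) (own pred : ℕ) : List (Sym Δ) :=
  τ.flatMap fun c => encodeCon (c.map fun y => cond y.1 pred own * L + y.2)

theorem Con.map_congr {V V' : Type} {f g : V → V'} {c : Con Δ V}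
    (h : ∀ e, f (c.2 e) = g (c.2 e)) : c.map f = c.map g := by
  unfold Con.map
  rw [funext h]

/-- A cell is described by its index and that of its predecessor alone: the remaining data form a
template that depends only on `H` and `G`. The block of `H.port 0` comes first in its cell, so its
ports carry their own numbers. -/
theorem encode_cell {n T : ℕ} (p : Cell n T) :
    (linkPart H G p ++ (List.finRange H.numVars).flatMap fun i =>
      blockPart H G (p, i)).flatMap (fun c => encodeCon (c.map fun v => (varEquiv H G n T v : ℕ))) =
    cellCode (H.numVars * G.numVars) (template H G) (p.1 * n + p.2)
      (p.pred.1 * n + p.pred.2) := by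
  rw [cellCode, template, List.flatMap_append, List.flatMap_append]
  congr 1
  · rw [linkPart, List.flatMap_map, List.flatMap_map]
    refine List.flatMap_congr fun c hc => ?_
    rw [Con.map_map, Con.map_map]
    congr 1
    apply Con.map_congr
    intro e
    have he : (c.2 e).2 < H.entries := snd_lt_of_mem_number (mem_occ hc e)
    rw [val_varEquiv, linkVar]
    split_ifs with h
    · rw [G.val_port (by omega), H.val_port (by omega)]
      simp
    · rw [G.val_port (by omega)]
      simp
  · rw [List.flatMap_assoc, List.flatMap_assoc]
    refine List.flatMap_congr fun i _ => ?_
    rw [blockPart, List.flatMap_map, List.flatMap_map]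
    refine List.flatMap_congr fun c hc => ?_
    rw [Con.map_map, Con.map_map]
    congr 1
    apply Con.map_congr
    intro e
    rw [val_varEquiv]
    simp

/-- With cells numbered layer by layer, the predecessor of cell `p` is `p - n`, except that layer
`0` wraps around to the last layer, which starts at `(T + 1) * n`. -/
theorem encode_cells {α : Type} (n T : ℕ) (F : ℕ → ℕ → List α) :
    (cells n T).flatMap (fun p => F (p.1 * n + p.2) (p.pred.1 * n + p.pred.2)) =
      (List.range n).flatMap (fun p => F p (p + (T + 1) * n)) ++
        (List.range ((T + 1) * n)).flatMap (fun p => F (n + p) p) := by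
  rw [cells, List.flatMap_map]
  have h : ∀ p : Fin ((T + 2) * n), F ((finProdFinEquiv.symm p).1 * n + (finProdFinEquiv.symm p).2)
      ((Cell.pred (finProdFinEquiv.symm p)).1 * n + (Cell.pred (finProdFinEquiv.symm p)).2) =
      F p (if (p : ℕ) < n then p + (T + 1) * n else p - n) := by
    intro p
    obtain ⟨⟨j, v⟩, rfl⟩ := finProdFinEquiv.surjective p
    rw [Equiv.symm_apply_apply, finProdFinEquiv_apply_val]
    simp only [Cell.pred]
    have hv := v.2
    rw [Fin.coe_sub_one]
    congr 1
    · ring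
    · by_cases hj : j = 0
      · subst hj
        simp [add_comm]
      · obtain ⟨i, hi⟩ : ∃ i : ℕ, (j : ℕ) = i + 1 :=
          Nat.exists_eq_succ_of_ne_zero fun h => hj (Fin.ext h)
        rw [if_neg hj, hi, if_neg (by rw [mul_add]; omega), mul_add, mul_comm n i]
        simp only [Nat.add_sub_cancel]
        omega
  simp only [h]
  have h2 : (List.finRange ((T + 2) * n)).flatMap
      (fun p : Fin ((T + 2) * n) => F p (if (p : ℕ) < n then p + (T + 1) * n else p - n)) =
      (List.range (n + (T + 1) * n)).flatMap
        (fun p => F p (if p < n then p + (T + 1) * n else p - n)) := by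
    rw [show n + (T + 1) * n = (T + 2) * n by ring, ← List.map_coe_finRange_eq_range,
      List.flatMap_map]
  rw [h2, List.range_add, List.flatMap_append, List.flatMap_map]
  congr 1
  · refine List.flatMap_congr fun p hp => ?_
    rw [if_pos (List.mem_range.1 hp)]
  · simp

/-- This is the form in which the machine produces the word: the constraints of `I` during one scan
of the input, then the cells of layer `0`, then all other cells. -/
theorem boundedInstance_encode (I : CSPInstance Γ) : (boundedInstance hΓ H G I).encode =
    encodeNum Δ (((occ I.constraints).length + 2) * I.numVars * (H.numVars * G.numVars)) ++
    ((number 2 I.constraints).flatMap (fun c => encodeCon ((c.lift hΓ).map fun x =>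
        (x.2 * I.numVars + x.1) * (H.numVars * G.numVars) + 2 * H.entries)) ++
      ((List.range I.numVars).flatMap (fun p => cellCode (H.numVars * G.numVars) (template H G) p
          (p + ((occ I.constraints).length + 1) * I.numVars)) ++
        (List.range (((occ I.constraints).length + 1) * I.numVars)).flatMap
          (fun p => cellCode (H.numVars * G.numVars) (template H G) (I.numVars + p) p))) := by
  rw [← encode_cells _ _ (cellCode (H.numVars * G.numVars) (template H G)), CSPInstance.encode,
    boundedInstance]
  simp only
  refine congrArg₂ _ (congrArg (encodeNum Δ) (mul_assoc _ H.numVars _)) ?_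
  rw [List.flatMap_map, boundedCs, List.flatMap_append, List.flatMap_assoc]
  simp only [encodeConstraint_eq, Con.map_map]
  congr 1
  · rw [occPart, List.flatMap_map, List.flatMap_map]
    refine List.flatMap_congr fun c hc => ?_
    rw [Con.map_map]
    congr 1
    apply Con.map_congr
    intro e
    have he := snd_lt_of_mem_number (mem_occ hc e)
    change (varEquiv H G _ _ (occVar H G (c.2 e)) : ℕ) = _
    rw [val_varEquiv, occVar]
    simp only
    rw [G.val_port (by omega), H.val_port (by omega), Fin.val_ofNat, Nat.mod_eq_of_lt (by omega)]
    simp [Con.lift]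
  · exact List.flatMap_congr fun p _ => encode_cell H G p

end Encoding

/-! ### Composing programs with time bounds. -/

namespace Prog

variable {K : Type} [DecidableEq K] {S : K → Type} {σ : Type}

theorem Runs.mono {p : Prog S σ} {s s' : State S σ} {B B' : ℕ} (h : p.Runs s B s')
    (hB : B ≤ B') : p.Runs s B' s' :=
  let ⟨t, ht, h⟩ := h
  ⟨t, ht.trans hB, h⟩

theorem Runs.seq {p q : Prog S σ} {s s' s'' : State S σ} {B B' : ℕ} (h : p.Runs s B s')
    (h' : q.Runs s' B' s'') : (Prog.seq p q).Runs s (B + B') s'' :=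
  let ⟨_, ht, h⟩ := h
  let ⟨_, ht', h'⟩ := h'
  ⟨_, Nat.add_le_add ht ht', .seq h h'⟩

theorem Runs.ite_true {c : σ → Bool} {p q : Prog S σ} {s s' : State S σ} {B : ℕ}
    (hc : c s.1 = true) (h : p.Runs s B s') : (Prog.ite c p q).Runs s (B + 1) s' :=
  let ⟨_, ht, h⟩ := h
  ⟨_, Nat.succ_le_succ ht, .ite_true hc h⟩

theorem Runs.ite_false {c : σ → Bool} {p q : Prog S σ} {s s' : State S σ} {B : ℕ}
    (hc : c s.1 = false) (h : q.Runs s B s') : (Prog.ite c p q).Runs s (B + 1) s' :=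
  let ⟨_, ht, h⟩ := h
  ⟨_, Nat.succ_le_succ ht, .ite_false hc h⟩

theorem runs_push {k : K} {f : σ → S k} {s : State S σ} :
    (Prog.push k f).Runs s 1 (s.1, Function.update s.2 k (f s.1 :: s.2 k)) :=
  ⟨1, le_rfl, .push⟩

theorem runs_pop {k : K} {f : σ → Option (S k) → σ} {s : State S σ} :
    (Prog.pop k f).Runs s 1 (f s.1 (s.2 k).head?, Function.update s.2 k (s.2 k).tail) :=
  ⟨1, le_rfl, .pop⟩

theorem runs_load {f : σ → σ} {s : State S σ} : (Prog.load f).Runs s 1 (f s.1, s.2) :=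
  ⟨1, le_rfl, .load⟩

theorem Runs.loop_nil {k : K} {body : S k → Prog S σ} {s : State S σ} (h : s.2 k = []) :
    (Prog.loop k body).Runs s 1 s :=
  ⟨1, le_rfl, .loop_nil h⟩

theorem Runs.loop_cons {k : K} {body : S k → Prog S σ} {s s' s'' : State S σ} {a : S k}
    {l : List (S k)} {B B' : ℕ} (hk : s.2 k = a :: l)
    (h : (body a).Runs (s.1, Function.update s.2 k l) B s')
    (h' : (Prog.loop k body).Runs s' B' s'') : (Prog.loop k body).Runs s (B + B' + 1) s'' :=
  let ⟨_, ht, h⟩ := h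
  let ⟨_, ht', h'⟩ := h'
  ⟨_, by omega, .loop_cons hk h h'⟩

def skip : Prog S σ := .load id

theorem runs_skip {s : State S σ} : (skip : Prog S σ).Runs s 1 s := runs_load

/-- Push the elements of a list, one after the other. -/
def pushes (k : K) : List (S k) → Prog S σ
  | [] => skip
  | a :: l => .seq (.push k fun _ => a) (pushes k l)

theorem runs_pushes (k : K) (l : List (S k)) (s : State S σ) :
    (pushes k l).Runs s (l.length + 1) (s.1, Function.update s.2 k (l.reverse ++ s.2 k)) := by
  induction l generalizing s with
  | nil => simpa [pushes] using runs_skip (s := s)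
  | cons a l ih =>
    have h := (runs_push (f := fun _ => a)).seq (ih (s.1, Function.update s.2 k (a :: s.2 k)))
    rw [List.length_cons, Nat.add_comm]
    simpa [pushes] using h

/-- Run a program `n` times. -/
def iter (p : Prog S σ) : ℕ → Prog S σ
  | 0 => skip
  | n + 1 => .seq p (iter p n)

theorem runs_iter {p : Prog S σ} (st : ℕ → State S σ) {n B : ℕ}
    (h : ∀ i < n, p.Runs (st i) B (st (i + 1))) : (iter p n).Runs (st 0) (n * B + 1) (st n) := by
  induction n generalizing st with
  | zero => simpa [iter] using runs_skip
  | succ n ih =>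
    refine ((h 0 (by omega)).seq (ih (fun i => st (i + 1)) fun i hi => h (i + 1) (by omega))).mono ?_
    rw [Nat.succ_mul]
    omega

end Prog

/-! ### Memory layout -/

/-- Unary counters. -/
inductive Ctr
  | n | base | pred | own | var | tmp | cells
deriving DecidableEq

instance : Finite Ctr :=
  Finite.of_surjective (fun i : Fin 7 => (![.n, .base, .pred, .own, .var, .tmp, .cells] i : Ctr))
    fun c => by
      cases c
      exacts [⟨0, rfl⟩, ⟨1, rfl⟩, ⟨2, rfl⟩, ⟨3, rfl⟩, ⟨4, rfl⟩, ⟨5, rfl⟩, ⟨6, rfl⟩]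

/-- Work stacks. -/
inductive WStack
  | ctr (c : Ctr)
  | word
  | bits (b : Bool)
deriving DecidableEq

instance : Finite WStack :=
  Finite.of_surjective
    (Sum.elim .ctr (Option.elim · .word .bits) : Ctr ⊕ Option Bool → WStack) fun w => by
      cases w with
      | ctr c => exact ⟨.inl c, rfl⟩
      | word => exact ⟨.inr none, rfl⟩
      | bits b => exact ⟨.inr (some b), rfl⟩

/-- Alphabets of the work stacks. -/
abbrev WStack.Alphabet (B : Type) : WStack → Type
  | .ctr _ => Unit
  | .word => B
  | .bits _ => Bool

/-- Alphabets of all stacks. -/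
abbrev Alph (A B : Type) : Port ⊕ WStack → Type :=
  Sum.elim (Port.Alphabet A B) (WStack.Alphabet B)

instance {B : Type} [Finite B] (w : WStack) : Finite (WStack.Alphabet B w) := by
  cases w <;> simp only [WStack.Alphabet] <;> infer_instance

/-- Contents of all stacks. -/
structure Mem (A B : Type) where
  input : List A
  inputErr : ℕ
  query : List B
  queryErr : ℕ
  answer : List Bool
  output : List Bool
  word : List B
  bits : Bool → List Bool
  ctr : Ctr → ℕ

namespace Mem

variable {A B : Type}

def stk (m : Mem A B) : ∀ k, List (Alph A B k)
  | .inl .input => m.input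
  | .inl .inputErr => List.replicate m.inputErr ()
  | .inl .query => m.query
  | .inl .queryErr => List.replicate m.queryErr ()
  | .inl .answer => m.answer
  | .inl .output => m.output
  | .inr (.ctr c) => List.replicate (m.ctr c) ()
  | .inr .word => m.word
  | .inr (.bits b) => m.bits b

def setCtr (m : Mem A B) (c : Ctr) (x : ℕ) : Mem A B := { m with ctr := Function.update m.ctr c x }

def setBits (m : Mem A B) (b : Bool) (l : List Bool) : Mem A B :=
  { m with bits := Function.update m.bits b l }

theorem update_eq {m m' : Mem A B} {k : Port ⊕ WStack} {l : List (Alph A B k)}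
    (h : m'.stk k = l) (h' : ∀ j, j ≠ k → m'.stk j = m.stk j) :
    Function.update m.stk k l = m'.stk := by
  funext j
  by_cases hj : j = k
  · subst hj
    rw [Function.update_self, h]
  · rw [Function.update_of_ne hj, h' j hj]

theorem update_input (m : Mem A B) (l : List A) :
    Function.update m.stk (.inl .input) l = stk { m with input := l } :=
  update_eq rfl fun j hj => by
    rcases j with j | j <;> cases j <;> first | rfl | exact absurd rfl hj

theorem update_inputErr (m : Mem A B) (x : ℕ) :
    Function.update m.stk (.inl .inputErr) (List.replicate x ()) = stk { m with inputErr := x } :=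
  update_eq rfl fun j hj => by
    rcases j with j | j <;> cases j <;> first | rfl | exact absurd rfl hj

theorem update_query (m : Mem A B) (l : List B) :
    Function.update m.stk (.inl .query) l = stk { m with query := l } :=
  update_eq rfl fun j hj => by
    rcases j with j | j <;> cases j <;> first | rfl | exact absurd rfl hj

theorem update_queryErr (m : Mem A B) (x : ℕ) :
    Function.update m.stk (.inl .queryErr) (List.replicate x ()) = stk { m with queryErr := x } :=
  update_eq rfl fun j hj => by
    rcases j with j | j <;> cases j <;> first | rfl | exact absurd rfl hj

theorem update_answer (m : Mem A B) (l : List Bool) :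
    Function.update m.stk (.inl .answer) l = stk { m with answer := l } :=
  update_eq rfl fun j hj => by
    rcases j with j | j <;> cases j <;> first | rfl | exact absurd rfl hj

theorem update_output (m : Mem A B) (l : List Bool) :
    Function.update m.stk (.inl .output) l = stk { m with output := l } :=
  update_eq rfl fun j hj => by
    rcases j with j | j <;> cases j <;> first | rfl | exact absurd rfl hj

theorem update_word (m : Mem A B) (l : List B) :
    Function.update m.stk (.inr .word) l = stk { m with word := l } :=
  update_eq rfl fun j hj => by
    rcases j with j | j <;> cases j <;> first | rfl | exact absurd rfl hj

theorem update_ctr (m : Mem A B) (c : Ctr) (x : ℕ) :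
    Function.update m.stk (.inr (.ctr c)) (List.replicate x ()) = stk (m.setCtr c x) :=
  update_eq (by simp [stk, setCtr]) fun j hj => by
    rcases j with j | j
    · cases j <;> rfl
    · cases j with
      | ctr c' =>
        have : c' ≠ c := fun h => hj (by rw [h])
        simp [stk, setCtr, this]
      | word => rfl
      | bits => rfl

theorem update_bits (m : Mem A B) (b : Bool) (l : List Bool) :
    Function.update m.stk (.inr (.bits b)) l = stk (m.setBits b l) :=
  update_eq (by simp [stk, setBits]) fun j hj => by
    rcases j with j | j
    · cases j <;> rfl
    · cases j with
      | bits b' =>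
        have : b' ≠ b := fun h => hj (by rw [h])
        simp [stk, setBits, this]
      | word => rfl
      | ctr => rfl

end Mem

section MemPrograms

variable {A B σ : Type}

/-- `p` leads from the store `s` and memory `m` to `s'` and `m'` in at most `t` steps. -/
def MRuns (p : Prog (Alph A B) σ) (s : σ) (m : Mem A B) (t : ℕ) (s' : σ) (m' : Mem A B) : Prop :=
  p.Runs (s, m.stk) t (s', m'.stk)

namespace MRuns

variable {p q : Prog (Alph A B) σ} {s s' s'' : σ} {m m' m'' : Mem A B} {t t' : ℕ}

theorem mono (h : MRuns p s m t s' m') (ht : t ≤ t') : MRuns p s m t' s' m' := Prog.Runs.mono h ht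

theorem seq (h : MRuns p s m t s' m') (h' : MRuns q s' m' t' s'' m'') :
    MRuns (.seq p q) s m (t + t') s'' m'' := Prog.Runs.seq h h'

theorem conv (h : MRuns p s m t s' m') (ht : t ≤ t') (hm : m' = m'') : MRuns p s m t' s' m'' :=
  hm ▸ h.mono ht

theorem ite_true {c : σ → Bool} (hc : c s = true) (h : MRuns p s m t s' m') :
    MRuns (.ite c p q) s m (t + 1) s' m' := Prog.Runs.ite_true hc h

theorem ite_false {c : σ → Bool} (hc : c s = false) (h : MRuns q s m t s' m') :
    MRuns (.ite c p q) s m (t + 1) s' m' := Prog.Runs.ite_false hc h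

theorem skip : MRuns (Prog.skip : Prog (Alph A B) σ) s m 1 s m := Prog.runs_skip

theorem load {f : σ → σ} : MRuns (.load f) s m 1 (f s) m := Prog.runs_load

theorem of_push {k : Port ⊕ WStack} {f : σ → Alph A B k}
    (h : Function.update m.stk k (f s :: m.stk k) = m'.stk) : MRuns (.push k f) s m 1 s m' := by
  rw [MRuns, ← h]
  exact Prog.runs_push (s := (s, m.stk))

theorem of_pop {k : Port ⊕ WStack} {f : σ → Option (Alph A B k) → σ}
    (h : Function.update m.stk k (m.stk k).tail = m'.stk) :
    MRuns (.pop k f) s m 1 (f s (m.stk k).head?) m' := by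
  rw [MRuns, ← h]
  exact Prog.runs_pop (s := (s, m.stk))

theorem of_pushes {k : Port ⊕ WStack} {l : List (Alph A B k)}
    (h : Function.update m.stk k (l.reverse ++ m.stk k) = m'.stk) :
    MRuns (Prog.pushes k l) s m (l.length + 1) s m' := by
  rw [MRuns, ← h]
  exact Prog.runs_pushes k l (s, m.stk)

theorem loop_nil {k : Port ⊕ WStack} {body : Alph A B k → Prog (Alph A B) σ} (h : m.stk k = []) :
    MRuns (.loop k body) s m 1 s m := Prog.Runs.loop_nil h

theorem loop_cons {k : Port ⊕ WStack} {body : Alph A B k → Prog (Alph A B) σ} {a : Alph A B k}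
    {l : List (Alph A B k)} {m₁ : Mem A B} (hk : m.stk k = a :: l)
    (hl : Function.update m.stk k l = m₁.stk) (h : MRuns (body a) s m₁ t s' m')
    (h' : MRuns (.loop k body) s' m' t' s'' m'') :
    MRuns (.loop k body) s m (t + t' + 1) s'' m'' := by
  rw [MRuns, ← hl] at h
  exact Prog.Runs.loop_cons (s := (s, m.stk)) hk h h'

theorem pushCtr {c : Ctr} : MRuns (.push (.inr (.ctr c)) fun _ => ()) s m 1 s
    (m.setCtr c (m.ctr c + 1)) := by
  exact of_push (Mem.update_ctr m c (m.ctr c + 1))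

theorem pushBits {b : Bool} {f : σ → Bool} : MRuns (.push (.inr (.bits b)) f) s m 1 s
    (m.setBits b (f s :: m.bits b)) := by
  exact of_push (Mem.update_bits _ _ _)

theorem pushQuery {f : σ → B} : MRuns (.push (.inl .query) f) s m 1 s
    { m with query := f s :: m.query } := by
  exact of_push (Mem.update_query _ _)

theorem pushOutput {f : σ → Bool} : MRuns (.push (.inl .output) f) s m 1 s
    { m with output := f s :: m.output } := by
  exact of_push (Mem.update_output _ _)

theorem popOutput {f : σ → Option Bool → σ} : MRuns (.pop (.inl .output) f) s m 1
    (f s m.output.head?) { m with output := m.output.tail } := by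
  exact of_pop (Mem.update_output _ _)

theorem popAnswer {f : σ → Option Bool → σ} : MRuns (.pop (.inl .answer) f) s m 1
    (f s m.answer.head?) { m with answer := m.answer.tail } := by
  exact of_pop (Mem.update_answer _ _)

theorem pushWord {f : σ → B} : MRuns (.push (.inr .word) f) s m 1 s
    { m with word := f s :: m.word } := by
  exact of_push (Mem.update_word _ _)

theorem pushesWord {l : List B} : MRuns (Prog.pushes (.inr .word) l) s m (l.length + 1) s
    { m with word := l.reverse ++ m.word } := by
  exact of_pushes (Mem.update_word _ _)

theorem pushesQuery {l : List B} : MRuns (Prog.pushes (.inl .query) l) s m (l.length + 1) s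
    { m with query := l.reverse ++ m.query } := by
  exact of_pushes (Mem.update_query _ _)

theorem pushesQueryErr {k : ℕ} : MRuns (Prog.pushes (.inl .queryErr) (List.replicate k ())) s m
    (k + 1) s { m with queryErr := k + m.queryErr } := by
  have e : (List.replicate k ()).reverse ++ List.replicate m.queryErr () =
      List.replicate (k + m.queryErr) () := by
    rw [List.reverse_replicate, List.replicate_add]
  exact (of_pushes ((congrArg (Function.update m.stk (.inl .queryErr)) e).trans
    (Mem.update_queryErr m _))).mono (congrArg (· + 1) (List.length_replicate (a := ()))).le

/-- A loop over a counter that the body does not change. -/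
theorem loopCtr {c : Ctr} {body : Unit → Prog (Alph A B) σ} (F : ℕ → Mem A B) {k : ℕ}
    (h : ∀ i < k, ∀ r, MRuns (body ()) s ((F i).setCtr c r) t s ((F (i + 1)).setCtr c r)) :
    MRuns (.loop (.inr (.ctr c)) body) s ((F 0).setCtr c k) (k * (t + 1) + 1) s
      ((F k).setCtr c 0) := by
  induction k generalizing F with
  | zero => exact (loop_nil (by simp [Mem.stk, Mem.setCtr])).mono (by omega)
  | succ k ih =>
    have h0 := h 0 (by omega) k
    have := ih (fun i => F (i + 1)) fun i hi => h (i + 1) (by omega)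
    refine (loop_cons (k := .inr (.ctr c)) (a := ()) (l := List.replicate k ()) ?_ ?_ h0
      this).mono ?_
    · simp [Mem.stk, Mem.setCtr, List.replicate_succ]
    · rw [Mem.update_ctr]
      simp [Mem.setCtr]
    · rw [Nat.succ_mul]
      omega

end MRuns

end MemPrograms

namespace Mem

variable {A B : Type}

/-- Push the elements of `l.reverse` on the stack `word`. -/
def addWord (m : Mem A B) (l : List B) : Mem A B := { m with word := l ++ m.word }

@[simp] theorem addWord_setCtr (m : Mem A B) (c : Ctr) (x : ℕ) (l : List B) :
    (m.setCtr c x).addWord l = (m.addWord l).setCtr c x := rfl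

@[simp] theorem addWord_addWord (m : Mem A B) (l l' : List B) :
    (m.addWord l).addWord l' = m.addWord (l' ++ l) := by simp [addWord]

@[simp] theorem addWord_nil (m : Mem A B) : m.addWord [] = m := rfl

@[simp] theorem setCtr_setCtr (m : Mem A B) (c : Ctr) (x y : ℕ) :
    (m.setCtr c x).setCtr c y = m.setCtr c y := by simp [setCtr]

theorem setCtr_comm (m : Mem A B) {c c' : Ctr} (h : c ≠ c') (x y : ℕ) :
    (m.setCtr c x).setCtr c' y = (m.setCtr c' y).setCtr c x := by
  simp [setCtr, Function.update_comm h]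

@[simp] theorem ctr_setCtr (m : Mem A B) (c : Ctr) (x : ℕ) : (m.setCtr c x).ctr c = x := by
  simp [setCtr]

theorem ctr_setCtr_of_ne (m : Mem A B) {c c' : Ctr} (h : c' ≠ c) (x : ℕ) :
    (m.setCtr c x).ctr c' = m.ctr c' := by
  simp [setCtr, h]

theorem setCtr_eq_self {m : Mem A B} {c : Ctr} {x : ℕ} (h : m.ctr c = x) : m.setCtr c x = m := by
  simp [setCtr, ← h]

end Mem

/-! ### Writing unary numbers and the constraints of a cell. -/

section Emit

variable {A σ : Type} {Δ : ConstraintLanguage} (L : ℕ)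

def incr {B : Type} (c : Ctr) : Prog (Alph A B) σ := .push (.inr (.ctr c)) fun _ => ()

theorem incr_spec {B : Type} {c : Ctr} {s : σ} {m : Mem A B} :
    MRuns (incr c) s m 1 s (m.setCtr c (m.ctr c + 1)) := MRuns.pushCtr

/-- Write `k` ticks. -/
def ticks (k : ℕ) : Prog (Alph A (Sym Δ)) σ := Prog.pushes (.inr .word) (List.replicate k (.inl true))

theorem ticks_spec {k : ℕ} {s : σ} {m : Mem A (Sym Δ)} :
    MRuns (ticks k) s m (k + 1) s (m.addWord (List.replicate k (.inl true))) := by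
  have h := MRuns.pushesWord (s := s) (m := m) (l := List.replicate k (.inl true : Sym Δ))
  rw [List.reverse_replicate, List.length_replicate] at h
  exact h

/-- Write `L` ticks for each unit of the counter `c`. -/
def dump (c : Ctr) : Prog (Alph A (Sym Δ)) σ :=
  .seq (.loop (.inr (.ctr c)) fun _ => .seq (incr .tmp) (ticks L))
    (.loop (.inr (.ctr .tmp)) fun _ => incr c)

/-- Reading a counter empties it, so the first loop saves it in `tmp` and the second restores it;
this is why `tmp` has to be empty before. -/
theorem dump_spec {c : Ctr} (hc : c ≠ .tmp) {s : σ} {m : Mem A (Sym Δ)} (hm : m.ctr .tmp = 0) :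
    MRuns (dump L c) s m (m.ctr c * (L + 5) + 2) s
      (m.addWord (List.replicate (m.ctr c * L) (.inl true))) := by
  have h1 := MRuns.loopCtr (s := s) (c := c) (t := 1 + (L + 1)) (k := m.ctr c)
    (body := fun _ => .seq (incr .tmp) (ticks L))
    (fun i => (m.addWord (List.replicate (i * L) (.inl true))).setCtr .tmp i) (by
      intro i _ r
      have h := (incr_spec (A := A) (σ := σ) (s := s) (c := .tmp)
        (m := ((m.addWord (List.replicate (i * L) (.inl true))).setCtr .tmp i).setCtr c r)).seq
        (ticks_spec (k := L))
      rw [Mem.ctr_setCtr_of_ne _ hc.symm, Mem.ctr_setCtr] at h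
      convert h using 1
      rw [Mem.addWord_setCtr, Mem.addWord_setCtr, Mem.addWord_setCtr, Mem.addWord_addWord,
        ← List.replicate_add, Mem.setCtr_comm _ hc, Mem.setCtr_setCtr]
      congr 5
      ring)
  have h2 := MRuns.loopCtr (s := s) (c := .tmp) (t := 1) (k := m.ctr c)
    (body := fun _ => (incr c : Prog (Alph A (Sym Δ)) σ))
    (fun i => (m.addWord (List.replicate (m.ctr c * L) (.inl true))).setCtr c i) (by
      intro i _ r
      have h := (incr_spec (A := A) (σ := σ) (s := s) (c := c)
        (m := ((m.addWord (List.replicate (m.ctr c * L) (.inl true))).setCtr c i).setCtr .tmp r))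
      rw [Mem.ctr_setCtr_of_ne _ hc, Mem.ctr_setCtr] at h
      convert h using 1
      rw [Mem.setCtr_comm _ hc.symm, Mem.setCtr_setCtr])
  rw [Nat.zero_mul, List.replicate_zero, Mem.addWord_nil, Mem.setCtr_eq_self hm,
    Mem.setCtr_eq_self rfl, Mem.setCtr_comm _ hc.symm] at h1
  refine (h1.seq h2).conv (by apply le_of_eq; ring) ?_
  rw [Mem.setCtr_eq_self (c := c) (x := m.ctr c) (by rfl)]
  exact Mem.setCtr_eq_self hm

/-- Write the code of `x * L + off`, where `x` is the value of the counter `c`. -/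
def emit (c : Ctr) (off : ℕ) : Prog (Alph A (Sym Δ)) σ :=
  .seq (dump L c) (Prog.pushes (.inr .word) (encodeNum Δ off))

/-- Words are built in reverse on a stack. In unary, addition is concatenation: ticks already
written merge with the code that follows. -/
theorem reverse_encodeNum_append (a b : ℕ) :
    (encodeNum Δ b).reverse ++ List.replicate a (.inl true) = (encodeNum Δ (a + b)).reverse := by
  simp only [encodeNum, List.reverse_append, List.reverse_replicate, List.append_assoc,
    ← List.replicate_add, Nat.add_comm]

theorem emit_spec {c : Ctr} (hc : c ≠ .tmp) {off : ℕ} {s : σ} {m : Mem A (Sym Δ)}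
    (hm : m.ctr .tmp = 0) :
    MRuns (emit L c off) s m (m.ctr c * (L + 5) + off + 4) s
      (m.addWord (encodeNum Δ (m.ctr c * L + off)).reverse) := by
  have h := (dump_spec (s := s) L hc hm).seq (MRuns.pushesWord (l := encodeNum Δ off))
  refine h.conv (by simp [encodeNum]; omega) ?_
  change (m.addWord _).addWord (encodeNum Δ off).reverse = _
  rw [Mem.addWord_addWord, reverse_encodeNum_append]

def emitScope : List (Bool × ℕ) → Prog (Alph A (Sym Δ)) σ
  | [] => Prog.skip
  | y :: l => .seq (emit L (cond y.1 .pred .own) y.2) (emitScope l)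

/-- `K` depends only on `l` and `L`, which are fixed with the gadgets, so the time is linear in the
bound `M` for the counters. -/
theorem emitScope_spec (l : List (Bool × ℕ)) : ∃ K : ℕ, ∀ (s : σ) (m : Mem A (Sym Δ)) (M : ℕ),
    m.ctr .tmp = 0 → m.ctr .own ≤ M → m.ctr .pred ≤ M →
    MRuns (emitScope L l) s m (K * (M + 1)) s (m.addWord (l.flatMap fun y =>
      encodeNum Δ (cond y.1 (m.ctr .pred) (m.ctr .own) * L + y.2)).reverse) := by
  induction l with
  | nil => exact ⟨1, fun s m M _ _ _ => MRuns.skip.mono (by omega)⟩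
  | cons y l ih =>
    obtain ⟨K, hK⟩ := ih
    refine ⟨L + 5 + y.2 + 4 + K, fun s m M h0 h1 h2 => ?_⟩
    have hc : (cond y.1 .pred .own : Ctr) ≠ .tmp := by cases y.1 <;> simp
    have hM : m.ctr (cond y.1 .pred .own) ≤ M := by cases y.1 <;> assumption
    have h := (emit_spec (A := A) (σ := σ) (s := s) L hc (off := y.2) h0).seq
      (hK s _ M (by exact h0) (by exact h1) (by exact h2))
    refine h.conv ?_ ?_
    · calc _ ≤ M * (L + 5) + y.2 + 4 + K * (M + 1) := by gcongr
        _ ≤ _ := by nlinarith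
    · rw [Mem.addWord_addWord, ← List.reverse_append, List.flatMap_cons]
      cases y.1 <;> rfl

def emitCon (c : Con Δ (Bool × ℕ)) : Prog (Alph A (Sym Δ)) σ :=
  .seq (.push (.inr .word) fun _ => .inr c.1) (emitScope L (List.ofFn c.2))

def emitCell : List (Con Δ (Bool × ℕ)) → Prog (Alph A (Sym Δ)) σ
  | [] => Prog.skip
  | c :: τ => .seq (emitCon L c) (emitCell τ)

theorem emitCon_spec (c : Con Δ (Bool × ℕ)) : ∃ K : ℕ, ∀ (s : σ) (m : Mem A (Sym Δ)) (M : ℕ),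
    m.ctr .tmp = 0 → m.ctr .own ≤ M → m.ctr .pred ≤ M →
    MRuns (emitCon L c) s m (K * (M + 1)) s (m.addWord (encodeCon (c.map fun y =>
      cond y.1 (m.ctr .pred) (m.ctr .own) * L + y.2)).reverse) := by
  obtain ⟨K, hK⟩ := emitScope_spec (A := A) (σ := σ) (Δ := Δ) L (List.ofFn c.2)
  refine ⟨K + 1, fun s m M h0 h1 h2 => ?_⟩
  have h := (MRuns.pushWord (s := s) (m := m) (f := fun _ => (.inr c.1 : Sym Δ))).seq
    (hK s (m.addWord [.inr c.1]) M h0 h1 h2)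
  refine h.conv (by nlinarith) ?_
  rw [Mem.addWord_addWord]
  have : List.ofFn (c.map fun y => cond y.1 (m.ctr .pred) (m.ctr .own) * L + y.2).2 =
      (List.ofFn c.2).map fun y => cond y.1 (m.ctr .pred) (m.ctr .own) * L + y.2 := by
    rw [List.map_ofFn]; rfl
  rw [encodeCon, this, List.flatMap_map, List.reverse_cons]
  rfl

theorem emitCell_spec (τ : List (Con Δ (Bool × ℕ))) : ∃ K : ℕ, ∀ (s : σ) (m : Mem A (Sym Δ))
    (M : ℕ), m.ctr .tmp = 0 → m.ctr .own ≤ M → m.ctr .pred ≤ M →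
    MRuns (emitCell L τ) s m (K * (M + 1)) s
      (m.addWord (cellCode L τ (m.ctr .own) (m.ctr .pred)).reverse) := by
  induction τ with
  | nil => exact ⟨1, fun s m M _ _ _ => MRuns.skip.mono (by omega)⟩
  | cons c τ ih =>
    obtain ⟨K, hK⟩ := ih
    obtain ⟨K', hK'⟩ := emitCon_spec (A := A) (σ := σ) L c
    refine ⟨K' + K, fun s m M h0 h1 h2 => ?_⟩
    have h := (hK' s m M h0 h1 h2).seq (hK s _ M (by exact h0) (by exact h1) (by exact h2))
    rw [← Nat.add_mul, Mem.addWord_addWord, ← List.reverse_append] at h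
    exact h

end Emit

/-- Values of the counters. -/
def ctrs (n base pred own var tmp cells : ℕ) : Ctr → ℕ
  | .n => n
  | .base => base
  | .pred => pred
  | .own => own
  | .var => var
  | .tmp => tmp
  | .cells => cells

section

variable (n base pred own var tmp cells x : ℕ)

@[simp] theorem update_ctrs_n : Function.update (ctrs n base pred own var tmp cells) .n x =
    ctrs x base pred own var tmp cells := by
  funext c; cases c <;> simp [ctrs]

@[simp] theorem update_ctrs_base : Function.update (ctrs n base pred own var tmp cells) .base x =
    ctrs n x pred own var tmp cells := by
  funext c; cases c <;> simp [ctrs]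

@[simp] theorem update_ctrs_pred : Function.update (ctrs n base pred own var tmp cells) .pred x =
    ctrs n base x own var tmp cells := by
  funext c; cases c <;> simp [ctrs]

@[simp] theorem update_ctrs_own : Function.update (ctrs n base pred own var tmp cells) .own x =
    ctrs n base pred x var tmp cells := by
  funext c; cases c <;> simp [ctrs]

@[simp] theorem update_ctrs_var : Function.update (ctrs n base pred own var tmp cells) .var x =
    ctrs n base pred own x tmp cells := by
  funext c; cases c <;> simp [ctrs]

@[simp] theorem update_ctrs_tmp : Function.update (ctrs n base pred own var tmp cells) .tmp x =
    ctrs n base pred own var x cells := by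
  funext c; cases c <;> simp [ctrs]

@[simp] theorem update_ctrs_cells : Function.update (ctrs n base pred own var tmp cells) .cells x =
    ctrs n base pred own var tmp x := by
  funext c; cases c <;> simp [ctrs]

end

/-! ### Reading the given instance and writing its constraints. -/

section Scan

variable {Γ Δ : ConstraintLanguage} (hΓ : Γ ⊆ Δ) (L o : ℕ)

/-- Contents of the stacks while the query is prepared. -/
def prepMem (inp : List (Sym Γ)) (N : ℕ) (wd : List (Sym Δ)) (c : Ctr → ℕ) :
    Mem (Sym Γ) (Sym Δ) where
  input := inp
  inputErr := N
  query := []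
  queryErr := 0
  answer := []
  output := []
  word := wd
  bits _ := []
  ctr := c

@[simp] theorem setCtr_prepMem (inp : List (Sym Γ)) (N : ℕ) (wd : List (Sym Δ)) (c : Ctr → ℕ)
    (k : Ctr) (x : ℕ) :
    (prepMem inp N wd c).setCtr k x = prepMem inp N wd (Function.update c k x) := rfl

@[simp] theorem ctr_prepMem (inp : List (Sym Γ)) (N : ℕ) (wd : List (Sym Δ)) (c : Ctr → ℕ) :
    (prepMem inp N wd c).ctr = c := rfl

@[simp] theorem addWord_prepMem (inp : List (Sym Γ)) (N : ℕ) (wd l : List (Sym Δ)) (c : Ctr → ℕ) :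
    (prepMem inp N wd c).addWord l = prepMem inp N (l ++ wd) c := rfl

/-- Treat one occurrence of a variable: advance by one layer and write the new variable. -/
def occurrence {σ : Type} : Prog (Alph (Sym Γ) (Sym Δ)) σ :=
  .seq (.loop (.inr (.ctr .n)) fun _ => .seq (incr .tmp) (.seq (incr .base) (incr .pred)))
    (.seq (.loop (.inr (.ctr .tmp)) fun _ => incr .n)
      (.seq (dump L .base)
        (.seq (.loop (.inr (.ctr .var)) fun _ => ticks L)
          (Prog.pushes (.inr .word) (encodeNum Δ o)))))

/-- `base` is the index of the first cell of the current layer, so `base + var` is the index of a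
cell, and `o` is the number of the port used there. `pred` is kept equal to `base` for later use. -/
theorem occurrence_spec {σ : Type} (s : σ) (inp : List (Sym Γ)) (N : ℕ) (wd : List (Sym Δ))
    (n b v : ℕ) :
    MRuns (occurrence L o) s (prepMem inp N wd (ctrs n b b 0 v 0 0))
      ((b + n + v) * (L + 11) + o + 7) s
      (prepMem inp N ((encodeNum Δ ((b + n + v) * L + o)).reverse ++ wd)
        (ctrs n (b + n) (b + n) 0 0 0 0)) := by
  have h1 := MRuns.loopCtr (s := s) (c := .n) (t := 3) (k := n)
    (body := fun _ => .seq (incr .tmp) (.seq (incr .base) (incr .pred)))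
    (fun i => prepMem inp N wd (ctrs n (b + i) (b + i) 0 v i 0)) (by
      intro i _ r
      refine ((incr_spec (c := .tmp)).seq ((incr_spec (c := .base)).seq
        (incr_spec (c := .pred)))).conv le_rfl ?_
      simp [ctrs, Nat.add_assoc])
  have h2 := MRuns.loopCtr (s := s) (c := .tmp) (t := 1) (k := n)
    (body := fun _ => incr .n)
    (fun i => prepMem inp N wd (ctrs i (b + n) (b + n) 0 v n 0)) (by
      intro i _ r
      refine (incr_spec (c := .n)).conv le_rfl ?_
      simp [ctrs])
  have h3 := dump_spec (s := s) L (c := .base) (by simp)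
    (m := prepMem inp N wd (ctrs n (b + n) (b + n) 0 v 0 0)) rfl
  have h4 := MRuns.loopCtr (s := s) (c := .var) (t := L + 1) (k := v)
    (body := fun _ => ticks L)
    (fun i => prepMem inp N (List.replicate (i * L) (.inl true) ++
      (List.replicate ((b + n) * L) (.inl true) ++ wd)) (ctrs n (b + n) (b + n) 0 v 0 0)) (by
      intro i _ r
      refine ticks_spec.conv le_rfl ?_
      rw [setCtr_prepMem, setCtr_prepMem, addWord_prepMem, ← List.append_assoc,
        ← List.replicate_add, Nat.succ_mul, Nat.add_comm L])
  have h5 := MRuns.pushesWord (s := s) (l := encodeNum Δ o)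
    (m := prepMem inp N (List.replicate (v * L) (.inl true) ++
      (List.replicate ((b + n) * L) (.inl true) ++ wd)) (ctrs n (b + n) (b + n) 0 0 0 0))
  simp only [setCtr_prepMem, update_ctrs_n, update_ctrs_tmp, update_ctrs_var, Nat.add_zero,
    addWord_prepMem, ctr_prepMem, Nat.zero_mul, List.replicate_zero, List.nil_append] at h1 h2 h3 h4
  refine (h1.seq (h2.seq (h3.seq (h4.seq h5)))).conv ?_ ?_
  · simp only [ctrs, encodeNum, List.length_append, List.length_replicate, List.length_singleton]
    nlinarith
  · have e : (encodeNum Δ o).reverse ++ (List.replicate (v * L) (.inl true) ++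
        (List.replicate ((b + n) * L) (.inl true) ++ wd)) =
        (encodeNum Δ ((b + n + v) * L + o)).reverse ++ wd := by
      rw [← List.append_assoc (List.replicate _ _), ← List.replicate_add, ← List.append_assoc,
        reverse_encodeNum_append, ← Nat.add_mul, Nat.add_comm v]
    rw [← e]
    rfl

/-- Read the given instance. The first component of the store is `true` while the number of
variables is read. -/
def scanBody {σ : Type} (a : Sym Γ) : Prog (Alph (Sym Γ) (Sym Δ)) (Bool × σ) :=
  match a with
  | .inl true => .ite Prod.fst (.seq (incr .n) (.seq (incr .base) (incr .pred))) (incr .var)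
  | .inl false => .ite Prod.fst (.load fun s => (false, s.2)) (occurrence L o)
  | .inr R => .push (.inr .word) fun _ => .inr ⟨R.1, hΓ R.2⟩

def scan {σ : Type} : Prog (Alph (Sym Γ) (Sym Δ)) (Bool × σ) :=
  .loop (.inl .input) (scanBody hΓ L o)

variable {σ : Type} {r : σ} {N : ℕ} {s' : Bool × σ} {m' : Mem (Sym Γ) (Sym Δ)}

/-- `D` is a uniform bound for the cost of one input symbol, so the whole scan takes at most `D`
times the length of the input, up to a constant. -/
theorem scan_cons {s s₁ : Bool × σ} {a : Sym Γ} {inp : List (Sym Γ)} {wd : List (Sym Δ)}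
    {c : Ctr → ℕ} {m₁ : Mem (Sym Γ) (Sym Δ)} {t t' D : ℕ}
    (h : MRuns (scanBody hΓ L o a) s (prepMem inp N wd c) t s₁ m₁)
    (h' : MRuns (scan hΓ L o) s₁ m₁ t' s' m') (ht : t + 1 ≤ D) :
    MRuns (scan hΓ L o) s (prepMem (a :: inp) N wd c) (D + t') s' m' :=
  (MRuns.loop_cons (k := .inl .input) (a := a) rfl (Mem.update_input _ _) h h').mono (by omega)

/-- After the header `base = n`, the start of layer `1`. An occurrence advances before it writes, so
occurrences fall into the layers `2, …, T + 1`, in agreement with `number 2`, and `base` ends at `(T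
+ 1) * n`, the number of cells outside layer `0`. -/
theorem scan_header {inp : List (Sym Γ)} {wd : List (Sym Δ)} {t D : ℕ} (hD : 5 ≤ D) (n k : ℕ)
    (h : MRuns (scan hΓ L o) (false, r) (prepMem inp N wd (ctrs (k + n) (k + n) (k + n) 0 0 0 0)) t
      s' m') :
    MRuns (scan hΓ L o) (true, r) (prepMem (encodeNum Γ n ++ inp) N wd (ctrs k k k 0 0 0 0))
      ((n + 1) * D + t) s' m' := by
  induction n generalizing k with
  | zero =>
    refine (scan_cons (D := D) (a := .inl false) hΓ L o (MRuns.ite_true rfl MRuns.load) h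
      (by omega)).mono ?_
    omega
  | succ n ih =>
    have := ih (k + 1) (by rwa [Nat.add_assoc, Nat.add_comm 1 n])
    refine (scan_cons (D := D) (a := .inl true) hΓ L o (t := 4) (MRuns.ite_true rfl
      (MRuns.conv ((incr_spec (c := .n)).seq ((incr_spec (c := .base)).seq
        (incr_spec (c := .pred)))) (t' := 3) le_rfl ?_)) this (by omega)).mono ?_
    · simp only [setCtr_prepMem, ctr_prepMem, update_ctrs_n, update_ctrs_base, update_ctrs_pred]
      rfl
    · rw [Nat.add_mul (n + 1)]
      omega

/-- `k` ticks of the number have been read already. `M` bounds the cell index to be written, and the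
end mark, which triggers `occurrence`, is the most expensive symbol. -/
theorem scan_num {inp : List (Sym Γ)} {wd : List (Sym Δ)} {t D M n b : ℕ} (v k : ℕ)
    (hM : b + n + (k + v) ≤ M) (hD : M * (L + 11) + o + 9 ≤ D)
    (h : MRuns (scan hΓ L o) (false, r) (prepMem inp N
      ((encodeNum Δ ((b + n + (k + v)) * L + o)).reverse ++ wd)
        (ctrs n (b + n) (b + n) 0 0 0 0)) t s' m') :
    MRuns (scan hΓ L o) (false, r) (prepMem (encodeNum Γ v ++ inp) N wd (ctrs n b b 0 k 0 0))
      ((v + 1) * D + t) s' m' := by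
  induction v generalizing k with
  | zero =>
    have h0 := Nat.mul_le_mul_right (L + 11) hM
    refine (scan_cons (D := D) (a := .inl false) hΓ L o (MRuns.ite_false rfl
      (occurrence_spec L o _ _ _ _ _ _ _)) h ?_).mono (by omega)
    change (b + n + k) * (L + 11) ≤ _ at h0
    change (b + n + k) * (L + 11) + o + 7 + 1 + 1 ≤ D
    omega
  | succ v ih =>
    have := ih (k + 1) (by omega) (by rwa [Nat.add_assoc k 1, Nat.add_comm 1 v])
    refine (scan_cons (D := D) (a := .inl true) hΓ L o (t := 2) (MRuns.ite_false rfl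
      (MRuns.conv (incr_spec (c := .var)) (t' := 1) le_rfl ?_)) this (by omega)).mono ?_
    · simp only [setCtr_prepMem, ctr_prepMem, update_ctrs_var]
      rfl
    · rw [Nat.add_mul (v + 1)]
      omega

theorem scan_scope {inp : List (Sym Γ)} {t D M n : ℕ} (hD : M * (L + 11) + o + 9 ≤ D)
    (vs : List (Fin n)) (k : ℕ) (wd : List (Sym Δ)) (hM : (k + vs.length + 1) * n ≤ M)
    (h : MRuns (scan hΓ L o) (false, r) (prepMem inp N
      (((vs.zipIdx (k + 1)).flatMap fun x => encodeNum Δ ((x.2 * n + x.1) * L + o)).reverse ++ wd)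
        (ctrs n ((k + vs.length) * n) ((k + vs.length) * n) 0 0 0 0)) t s' m') :
    MRuns (scan hΓ L o) (false, r)
      (prepMem ((vs.flatMap fun v : Fin n => encodeNum Γ (v : ℕ)) ++ inp) N wd
        (ctrs n (k * n) (k * n) 0 0 0 0))
      ((vs.flatMap fun v : Fin n => encodeNum Γ (v : ℕ)).length * D + t) s' m' := by
  induction vs generalizing k wd with
  | nil => simpa using h
  | cons v vs ih =>
    have h1 := ih (k + 1) ((encodeNum Δ ((k * n + n + (0 + v)) * L + o)).reverse ++ wd)
      (by rw [List.length_cons] at hM; rwa [Nat.add_assoc k 1, Nat.add_comm 1]) (by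
        rw [List.length_cons, Nat.add_comm vs.length, ← Nat.add_assoc] at h
        rw [List.zipIdx_cons, List.flatMap_cons, List.reverse_append, List.append_assoc] at h
        convert h using 7
        simp only
        ring)
    have hk : (k + 1) * n = k * n + n := by ring
    rw [hk] at h1
    have h2 := scan_num hΓ L o (M := M) (v : ℕ) 0 (by
      have := v.2
      have : (k + 2) * n ≤ M := le_trans (Nat.mul_le_mul_right n (by simp)) hM
      nlinarith) hD h1
    rw [List.flatMap_cons, List.append_assoc]
    refine h2.mono ?_
    have hv : (encodeNum Γ (v : ℕ)).length = v + 1 := by simp [encodeNum]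
    rw [List.length_append, hv]
    apply le_of_eq
    ring

theorem scan_constraints {t D M n : ℕ} (hD : M * (L + 11) + o + 9 ≤ D)
    (cs : List (Constraint Γ n)) (k : ℕ) (wd : List (Sym Δ))
    (hM : (k + (occ cs).length + 1) * n ≤ M)
    (h : MRuns (scan hΓ L o) (false, r) (prepMem [] N
      (((number (k + 1) cs).flatMap fun c => encodeCon ((c.lift hΓ).map fun x =>
        (x.2 * n + x.1) * L + o)).reverse ++ wd)
        (ctrs n ((k + (occ cs).length) * n) ((k + (occ cs).length) * n) 0 0 0 0)) t s' m') :
    MRuns (scan hΓ L o) (false, r)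
      (prepMem (cs.flatMap encodeConstraint) N wd (ctrs n (k * n) (k * n) 0 0 0 0))
      ((cs.flatMap encodeConstraint).length * D + t) s' m' := by
  induction cs generalizing k wd with
  | nil => simpa [number, occ] using h
  | cons c cs ih =>
    have hocc : (occ (c :: cs)).length = c.1.1.1 + (occ cs).length := by
      simp [occ]
    rw [hocc, ← Nat.add_assoc] at h hM
    have hz : ((List.ofFn c.2).zipIdx (k + 1)).flatMap
        (fun x => encodeNum Δ ((x.2 * n + x.1) * L + o)) =
        (List.ofFn fun e => ((k + 1 + e) * n + (c.2 e : ℕ)) * L + o).flatMap (encodeNum Δ) := by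
      have : (List.ofFn c.2).zipIdx (k + 1) = List.ofFn fun e => (c.2 e, k + 1 + (e : ℕ)) := by
        apply List.ext_getElem <;> simp
      rw [this, ← List.flatMap_map (fun x : Fin n × ℕ => (x.2 * n + x.1) * L + o), List.map_ofFn]
      rfl
    have h1 := ih (k + c.1.1.1)
      (((((List.ofFn c.2).zipIdx (k + 1)).flatMap
        fun x => encodeNum Δ ((x.2 * n + x.1) * L + o)).reverse) ++
          (.inr ⟨c.1.1, hΓ c.1.2⟩ :: wd)) (by assumption) (by
        rw [number, List.flatMap_cons, List.reverse_append, List.append_assoc] at h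
        have e : (((List.ofFn c.2).zipIdx (k + 1)).flatMap
            fun x => encodeNum Δ ((x.2 * n + x.1) * L + o)).reverse ++
              (.inr ⟨c.1.1, hΓ c.1.2⟩ :: wd) =
            (encodeCon (Con.map (fun x => (x.2 * n + x.1) * L + o) (Con.lift hΓ
              (⟨c.1, fun e => (c.2 e, k + 1 + e)⟩ : Con Γ (Fin n × ℕ))))).reverse ++ wd := by
          rw [hz, encodeCon, List.reverse_cons, List.append_assoc]
          rfl
        rw [e, Nat.add_right_comm]
        exact h)
    have h2 := scan_scope hΓ L o hD (List.ofFn c.2) k (.inr ⟨c.1.1, hΓ c.1.2⟩ :: wd)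
      (by
        rw [List.length_ofFn]
        exact le_trans (Nat.mul_le_mul_right n (by omega)) hM)
      (by rw [List.length_ofFn]; exact h1)
    have h3 := scan_cons (D := D) hΓ L o (a := .inr c.1) (N := N) (s := (false, r)) (wd := wd)
      (c := ctrs n (k * n) (k * n) 0 0 0 0) MRuns.pushWord h2 (by omega)
    have he : encodeConstraint c =
        .inr c.1 :: (List.ofFn c.2).flatMap fun v : Fin n => encodeNum Γ (v : ℕ) := by
      rw [encodeConstraint_eq, encodeCon, ← List.flatMap_map (f := Fin.val) (g := encodeNum Γ),
        List.map_ofFn]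
      rfl
    rw [List.flatMap_cons, he, List.cons_append]
    refine h3.mono ?_
    simp only [List.length_append, List.length_cons]
    apply le_of_eq
    ring

/-- The specification of the first part of the program. -/
theorem scan_spec (I : CSPInstance Γ) {D : ℕ}
    (hD : ((occ I.constraints).length + 2) * I.numVars * (L + 11) + o + 9 ≤ D) :
    MRuns (scan hΓ L o) (true, r) (prepMem I.encode N [] (ctrs 0 0 0 0 0 0 0))
      (I.encode.length * D + 1) (false, r) (prepMem [] N
        (((number 2 I.constraints).flatMap fun c => encodeCon ((c.lift hΓ).map fun x =>
          (x.2 * I.numVars + x.1) * L + o)).reverse)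
        (ctrs I.numVars (((occ I.constraints).length + 1) * I.numVars)
          (((occ I.constraints).length + 1) * I.numVars) 0 0 0 0)) := by
  have h0 : MRuns (scan hΓ L o) (false, r) (prepMem [] N
        (((number 2 I.constraints).flatMap fun c => encodeCon ((c.lift hΓ).map fun x =>
          (x.2 * I.numVars + x.1) * L + o)).reverse)
        (ctrs I.numVars (((occ I.constraints).length + 1) * I.numVars)
          (((occ I.constraints).length + 1) * I.numVars) 0 0 0 0)) 1 _ _ :=
    MRuns.loop_nil rfl
  have h1 := scan_constraints (Δ := Δ) hΓ L o hD I.constraints 1 []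
    (Nat.mul_le_mul_right _ (by omega)) (by
      rw [List.append_nil, Nat.add_comm 1 (occ _).length]
      exact h0)
  rw [Nat.one_mul] at h1
  have h2 := scan_header hΓ L o (D := D) (by omega) I.numVars 0 (by rwa [Nat.zero_add])
  refine h2.mono ?_
  rw [CSPInstance.encode]
  simp only [List.length_append, encodeNum, List.length_replicate, List.length_singleton]
  apply le_of_eq
  ring

end Scan

/-- A step pushes at most one symbol, so a time bound also bounds the length of whatever has been
written. -/
theorem Prog.Exec.length_le {K : Type} [DecidableEq K] {S : K → Type} {σ : Type} {p : Prog S σ}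
    {s s' : Prog.State S σ} {t : ℕ} (h : p.Exec s t s') (k : K) :
    (s'.2 k).length ≤ (s.2 k).length + t := by
  induction h with
  | @push j f s =>
    by_cases hj : k = j
    · subst hj; simp
    · simp [hj]
  | @pop j f s =>
    by_cases hj : k = j
    · subst hj; simp; omega
    · simp [hj]
  | load => simp
  | seq _ _ h h' => omega
  | ite_true _ _ h => omega
  | ite_false _ _ h => omega
  | loop_nil => simp
  | @loop_cons j body a l s t s' t' s'' hk _ _ h h' =>
    have : (Function.update s.2 j l k).length ≤ (s.2 k).length := by
      by_cases hj : k = j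
      · subst hj; simp [hk]
      · simp [hj]
    simp only at h
    omega

/-! ### Moving the word to the query and scaling the error bound. -/

section Prepare

variable {A B σ : Type} {s s' : σ} {m m' : Mem A B} {t : ℕ}

theorem MRuns.length_word_le {p : Prog (Alph A B) σ} (h : MRuns p s m t s' m') :
    m'.word.length ≤ m.word.length + t := by
  obtain ⟨u, hu, h⟩ := h
  exact (h.length_le (.inr .word)).trans (Nat.add_le_add_left hu _)

/-- Move the content of the stack `word` to the query. -/
def moveWord : Prog (Alph A B) σ := .loop (.inr .word) fun a => .push (.inl .query) fun _ => a

theorem moveWord_spec : MRuns moveWord s m (2 * m.word.length + 1) s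
    { m with word := [], query := m.word.reverse ++ m.query } := by
  obtain ⟨l, hl⟩ : ∃ l, m.word = l := ⟨_, rfl⟩
  induction l generalizing m with
  | nil =>
    rw [hl]
    refine (MRuns.loop_nil (k := .inr .word) hl).conv (by simp) ?_
    cases m
    simp_all
  | cons a l ih =>
    have h1 := MRuns.pushQuery (s := s) (m := { m with word := l }) (f := fun _ => a)
    have h2 := ih (m := { m with word := l, query := a :: m.query }) rfl
    refine (MRuns.loop_cons (k := .inr .word) (a := a) (l := l) hl (Mem.update_word _ _) h1
      h2).conv ?_ ?_
    · simp only [hl, List.length_cons]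
      omega
    · simp [hl]

/-- Multiply the reciprocal of the error bound by 8. -/
def scaleErr : Prog (Alph A B) σ :=
  .loop (.inl .inputErr) fun _ => Prog.pushes (.inl .queryErr) (List.replicate 8 ())

theorem scaleErr_spec : MRuns scaleErr s m (10 * m.inputErr + 1) s
    { m with inputErr := 0, queryErr := 8 * m.inputErr + m.queryErr } := by
  obtain ⟨k, hk⟩ : ∃ k, m.inputErr = k := ⟨_, rfl⟩
  induction k generalizing m with
  | zero =>
    refine (MRuns.loop_nil (k := .inl .inputErr) (by simp [Mem.stk, hk])).conv (by simp) ?_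
    cases m
    simp_all
  | succ k ih =>
    have h1 := MRuns.pushesQueryErr (s := s) (m := { m with inputErr := k }) (k := 8)
    have h2 := ih (m := { m with inputErr := k, queryErr := 8 + m.queryErr }) rfl
    refine (MRuns.loop_cons (k := .inl .inputErr) (a := ()) (l := List.replicate k ())
      (by simp [Mem.stk, hk, List.replicate_succ]) (Mem.update_inputErr _ _) h1 h2).conv ?_ ?_
    · simp only [hk]
      omega
    · simp only [hk, Mem.mk.injEq, true_and, and_true]
      omega

end Prepare

/-! ### Writing all cells and completing the query. -/

section Cells

variable {Γ Δ : ConstraintLanguage} {σ : Type} (L : ℕ) (τ : List (Con Δ (Bool × ℕ)))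

/-- Write the constraints of one cell and go to the next one. -/
def nextCell : Prog (Alph (Sym Γ) (Sym Δ)) σ :=
  .seq (emitCell L τ) (.seq (incr .own) (incr .pred))

/-- Write the constraints of all cells. -/
def emitCells : Prog (Alph (Sym Γ) (Sym Δ)) σ :=
  .seq (.loop (.inr (.ctr .n)) fun _ => nextCell L τ)
    (.seq (.loop (.inr (.ctr .pred)) fun _ => Prog.skip)
      (.loop (.inr (.ctr .base)) fun _ => nextCell L τ))

/-- The counters left by the scan drive the loops: `n` counts the cells of layer `0`, whose
predecessors start at `pred = b`, and `base` counts the remaining cells, whose predecessors start at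
`0`. At the end `own` is the total number of cells. -/
theorem emitCells_spec : ∃ K : ℕ, ∀ (s : σ) (N : ℕ) (wd : List (Sym Δ)) (n b : ℕ),
    MRuns (emitCells (Γ := Γ) L τ) s (prepMem [] N wd (ctrs n b b 0 0 0 0))
      ((n + b) * (K * (n + b + 1) + 5) + 3) s
      (prepMem [] N (((List.range n).flatMap (fun p => cellCode L τ p (p + b)) ++
        (List.range b).flatMap (fun p => cellCode L τ (n + p) p)).reverse ++ wd)
        (ctrs 0 0 b (n + b) 0 0 0)) := by
  obtain ⟨K, hK⟩ := emitCell_spec (A := Sym Γ) (σ := σ) L τ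
  have step : ∀ (s : σ) (N : ℕ) (wd : List (Sym Δ)) (n b o p M : ℕ), o ≤ M → p ≤ M →
      MRuns (nextCell (Γ := Γ) L τ) s (prepMem [] N wd (ctrs n b p o 0 0 0)) (K * (M + 1) + 2) s
        (prepMem [] N ((cellCode L τ o p).reverse ++ wd) (ctrs n b (p + 1) (o + 1) 0 0 0)) := by
    intro s N wd n b o p M ho hp
    refine ((hK s (prepMem [] N wd (ctrs n b p o 0 0 0)) M rfl ho hp).seq
      ((incr_spec (c := .own)).seq (incr_spec (c := .pred)))).conv le_rfl ?_
    simp [ctrs]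
  refine ⟨K, fun s N wd n b => ?_⟩
  have h1 := MRuns.loopCtr (s := s) (c := .n) (t := K * (n + b + 1) + 2) (k := n)
    (body := fun _ => nextCell L τ)
    (fun i => prepMem (Γ := Γ) [] N (((List.range i).flatMap fun p =>
      cellCode L τ p (p + b)).reverse ++ wd) (ctrs n b (i + b) i 0 0 0)) (by
      intro i hi r
      simp only [setCtr_prepMem, update_ctrs_n]
      refine (step s N _ r b i (i + b) (n + b) (by omega) (by omega)).conv le_rfl ?_
      rw [List.range_succ, List.flatMap_append, List.reverse_append, List.append_assoc,
        Nat.add_right_comm]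
      simp)
  -- The predecessors of layer `1` are the cells of layer `0`, so `pred` is reset.
  have h2 := MRuns.loopCtr (s := s) (c := .pred) (t := 1) (k := n + b)
    (body := fun _ => Prog.skip)
    (fun _ => prepMem (Γ := Γ) [] N (((List.range n).flatMap fun p =>
      cellCode L τ p (p + b)).reverse ++ wd) (ctrs 0 b (n + b) n 0 0 0))
    (fun i hi r => MRuns.skip)
  have h3 := MRuns.loopCtr (s := s) (c := .base) (t := K * (n + b + 1) + 2) (k := b)
    (body := fun _ => nextCell L τ)
    (fun i => prepMem (Γ := Γ) [] N (((List.range i).flatMap fun p =>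
      cellCode L τ (n + p) p).reverse ++ (((List.range n).flatMap fun p =>
      cellCode L τ p (p + b)).reverse ++ wd)) (ctrs 0 b i (n + i) 0 0 0)) (by
      intro i hi r
      simp only [setCtr_prepMem, update_ctrs_base]
      refine (step s N _ 0 r (n + i) i (n + b) (by omega) (by omega)).conv le_rfl ?_
      rw [List.range_succ, List.flatMap_append, List.reverse_append, List.append_assoc,
        ← Nat.add_assoc]
      simp)
  simp only [setCtr_prepMem, update_ctrs_n, update_ctrs_pred, update_ctrs_base, List.range_zero,
    List.flatMap_nil, List.reverse_nil, List.nil_append, Nat.add_zero, Nat.zero_add] at h1 h2 h3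
  refine (h1.seq (h2.seq h3)).conv (by nlinarith) ?_
  rw [List.reverse_append, List.append_assoc]

/-- Contents of the stacks while the query is completed. -/
def queryMem (N : ℕ) (q : List (Sym Δ)) (e : ℕ) (c : Ctr → ℕ) : Mem (Sym Γ) (Sym Δ) where
  input := []
  inputErr := N
  query := q
  queryErr := e
  answer := []
  output := []
  word := []
  bits _ := []
  ctr := c

theorem setCtr_queryMem (N : ℕ) (q : List (Sym Δ)) (e : ℕ) (c : Ctr → ℕ) (k : Ctr) (x : ℕ) :
    (queryMem (Γ := Γ) N q e c).setCtr k x = queryMem N q e (Function.update c k x) := rfl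

/-- Complete the query by the number of variables and the error bound. -/
def finishQuery : Prog (Alph (Sym Γ) (Sym Δ)) σ :=
  .seq moveWord
    (.seq (.push (.inl .query) fun _ => .inl false)
      (.seq (.loop (.inr (.ctr .own)) fun _ =>
          .seq (incr .tmp) (.seq (incr .cells)
            (Prog.pushes (.inl .query) (List.replicate L (.inl true)))))
        scaleErr))

/-- The code begins with the number `P * L` of variables. It is pushed last, after the constraints,
and so lies on top of the stack. Two copies of `P` are kept for the time after the call: `tmp` for
reading the answer and `cells` for the divisions. -/
theorem finishQuery_spec (s : σ) (N : ℕ) (wd : List (Sym Δ)) (b P : ℕ) :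
    MRuns (finishQuery (Γ := Γ) L) s (prepMem [] N wd (ctrs 0 0 b P 0 0 0))
      (2 * wd.length + P * (L + 4) + 10 * N + 4) s
      (queryMem 0 (encodeNum Δ (P * L) ++ wd.reverse) (8 * N) (ctrs 0 0 b 0 0 P P)) := by
  have h1 := moveWord_spec (s := s) (m := prepMem (Γ := Γ) [] N wd (ctrs 0 0 b P 0 0 0))
  have h2 := MRuns.pushQuery (s := s) (f := fun _ => (.inl false : Sym Δ))
    (m := queryMem (Γ := Γ) N wd.reverse 0 (ctrs 0 0 b P 0 0 0))
  have h3 := MRuns.loopCtr (s := s) (c := .own) (t := 1 + (1 + (L + 1))) (k := P)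
    (body := fun _ => .seq (incr .tmp) (.seq (incr .cells)
      (Prog.pushes (.inl .query) (List.replicate L (.inl true)))))
    (fun i => queryMem (Γ := Γ) N (List.replicate (i * L) (.inl true) ++ (.inl false :: wd.reverse))
      0 (ctrs 0 0 b P 0 i i)) (by
      intro i _ r
      refine ((incr_spec (c := .tmp)).seq ((incr_spec (c := .cells)).seq
        MRuns.pushesQuery)).conv (by simp) ?_
      have e : List.replicate ((i + 1) * L) (.inl true) ++ (.inl false :: wd.reverse) =
          (List.replicate L (.inl true : Sym Δ)).reverse ++
            (List.replicate (i * L) (.inl true) ++ (.inl false :: wd.reverse)) := by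
        rw [List.reverse_replicate, ← List.append_assoc, ← List.replicate_add, Nat.succ_mul,
          Nat.add_comm L]
      rw [e]
      simp [queryMem, Mem.setCtr, ctrs])
  have h4 := scaleErr_spec (s := s) (m := queryMem (Γ := Γ) N
    (List.replicate (P * L) (.inl true) ++ (.inl false :: wd.reverse)) 0 (ctrs 0 0 b 0 0 P P))
  simp only [setCtr_queryMem, update_ctrs_own, Nat.zero_mul, List.replicate_zero,
    List.nil_append] at h3
  have e1 : (prepMem (Γ := Γ) [] N wd (ctrs 0 0 b P 0 0 0)).word.reverse ++
    (prepMem (Γ := Γ) [] N wd (ctrs 0 0 b P 0 0 0)).query = wd.reverse := List.append_nil _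
  rw [e1] at h1
  refine (h1.seq (h2.seq (h3.seq h4))).conv ?_ ?_
  · simp only [prepMem, queryMem]
    nlinarith
  · rw [encodeNum, List.append_assoc]
    rfl

/-- Write the query. -/
def prepare (hΓ : Γ ⊆ Δ) (o : ℕ) : Prog (Alph (Sym Γ) (Sym Δ)) (Bool × σ) :=
  .seq (.seq (scan hΓ L o) (emitCells L τ)) (finishQuery L)

theorem prepare_spec (hΓ : Γ ⊆ Δ) (o : ℕ) : ∃ K : ℕ, ∀ (I : CSPInstance Γ) (N T P : ℕ) (r : σ),
    T = (occ I.constraints).length → P = (T + 2) * I.numVars →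
    MRuns (prepare L τ hΓ o) (true, r) (prepMem I.encode N [] (ctrs 0 0 0 0 0 0 0))
      (3 * (I.encode.length * (P * (L + 11) + o + 9) + P * (K * (P + 1) + 5) + 4) +
        P * (L + 4) + 10 * N + 4) (false, r)
      (queryMem 0 (encodeNum Δ (P * L) ++ ((number 2 I.constraints).flatMap (fun c =>
          encodeCon ((c.lift hΓ).map fun x => (x.2 * I.numVars + x.1) * L + o)) ++
        ((List.range I.numVars).flatMap (fun p => cellCode L τ p (p + (T + 1) * I.numVars)) ++
          (List.range ((T + 1) * I.numVars)).flatMap (fun p =>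
            cellCode L τ (I.numVars + p) p)))) (8 * N)
        (ctrs 0 0 ((T + 1) * I.numVars) 0 0 P P)) := by
  obtain ⟨K, hK⟩ := emitCells_spec (Γ := Γ) (σ := Bool × σ) L τ
  refine ⟨K, ?_⟩
  rintro I N T P r rfl rfl
  have hP : I.numVars + ((occ I.constraints).length + 1) * I.numVars =
    ((occ I.constraints).length + 2) * I.numVars := by ring
  have h := (scan_spec (r := r) (N := N) hΓ L o I le_rfl).seq (hK (false, r) N _ _ _)
  rw [hP] at h
  -- Moving the word costs two steps per symbol, hence at most twice the time spent on writing it;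
  -- this explains the factor `3`.
  have hl := h.length_word_le
  refine (h.seq (finishQuery_spec L _ _ _ _ _)).conv ?_ ?_
  · simp only [prepMem, List.length_nil] at hl
    omega
  · rw [List.reverse_append, List.reverse_reverse, List.reverse_reverse]

end Cells

/-! ### Binary arithmetic on stacks -/

/-- The number with the given binary digits, the least significant one first. -/
def ofBits (l : List Bool) : ℕ := List.foldr Nat.bit 0 l

theorem ofBits_cons (b : Bool) (l : List Bool) : ofBits (b :: l) = 2 * ofBits l + b.toNat :=
  Nat.bit_val b _

theorem ofBits_append (l l' : List Bool) :
    ofBits (l ++ l') = ofBits l + 2 ^ l.length * ofBits l' := by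
  induction l with
  | nil => simp [ofBits]
  | cons b l ih =>
    rw [List.cons_append, ofBits_cons, ofBits_cons, ih, List.length_cons]
    ring

theorem ofBits_tail (l : List Bool) : ofBits l.tail = ofBits l / 2 := by
  cases l with
  | nil => rfl
  | cons b l =>
    rw [List.tail_cons, ofBits_cons]
    have := b.toNat_le
    omega

theorem ofBits_bits (Y : ℕ) : ofBits (Nat.bits Y) = Y := by
  induction Y using Nat.binaryRec' with
  | zero => rfl
  | bit b n h ih => rw [Nat.bits_append_bit n b h, ofBits_cons, ih, Nat.bit_val]

theorem ofBits_map_getD {k : ℕ} {l : List Bool} (h : l.length ≤ k) :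
    ofBits ((List.range k).map fun i => l.getD i false) = ofBits l := by
  induction k generalizing l with
  | zero =>
    rw [List.length_eq_zero_iff.mp (Nat.le_zero.mp h)]
    rfl
  | succ k ih =>
    rw [List.range_succ_eq_map, List.map_cons, List.map_map, ofBits_cons]
    cases l with
    | nil => simpa [Function.comp_def, ofBits] using ih (l := []) (by simp)
    | cons b l =>
      rw [ofBits_cons, ← ih (l := l) (by simpa using h)]
      rfl

section Answer

variable {A B : Type} {w : ℕ} [NeZero w]

/-- Contents of the stacks after the oracle call. -/
def ansMem (a out bt bf : List Bool) (c : Ctr → ℕ) : Mem A B where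
  input := []
  inputErr := 0
  query := []
  queryErr := 0
  answer := a
  output := out
  word := []
  bits b := cond b bt bf
  ctr := c

variable {a out bt bf l : List Bool} {c : Ctr → ℕ} {σ : Type} {s : σ}

theorem setCtr_ansMem (k : Ctr) (x : ℕ) : (ansMem a out bt bf c : Mem A B).setCtr k x =
    ansMem a out bt bf (Function.update c k x) := rfl

theorem setBits_true_ansMem : (ansMem a out bt bf c : Mem A B).setBits true l =
    ansMem a out l bf c := by
  simp only [ansMem, Mem.setBits, Mem.mk.injEq, true_and, and_true]
  funext b
  cases b <;> simp

theorem setBits_false_ansMem : (ansMem a out bt bf c : Mem A B).setBits false l =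
    ansMem a out bt l c := by
  simp only [ansMem, Mem.setBits, Mem.mk.injEq, true_and, and_true]
  funext b
  cases b <;> simp

theorem pushTrue_spec {f : σ → Bool} : MRuns (.push (.inr (.bits true)) f) s
    (ansMem a out bt bf c : Mem A B) 1 s (ansMem a out (f s :: bt) bf c) :=
  MRuns.pushBits.conv le_rfl setBits_true_ansMem

theorem pushFalse_spec {f : σ → Bool} : MRuns (.push (.inr (.bits false)) f) s
    (ansMem a out bt bf c : Mem A B) 1 s (ansMem a out bt (f s :: bf) c) :=
  MRuns.pushBits.conv le_rfl setBits_false_ansMem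

theorem loopTrue_cons {body : Bool → Prog (Alph A B) σ} {b : Bool} {s₁ s₂ : σ} {m₁ m₂ : Mem A B}
    {t t' : ℕ} (h : MRuns (body b) s (ansMem a out bt bf c) t s₁ m₁)
    (h' : MRuns (.loop (.inr (.bits true)) body) s₁ m₁ t' s₂ m₂) :
    MRuns (.loop (.inr (.bits true)) body) s (ansMem a out (b :: bt) bf c) (t + t' + 1) s₂ m₂ :=
  MRuns.loop_cons (k := .inr (.bits true)) rfl
    ((Mem.update_bits _ _ _).trans (congrArg Mem.stk setBits_true_ansMem)) h h'

theorem loopFalse_cons {body : Bool → Prog (Alph A B) σ} {b : Bool} {s₁ s₂ : σ} {m₁ m₂ : Mem A B}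
    {t t' : ℕ} (h : MRuns (body b) s (ansMem a out bt bf c) t s₁ m₁)
    (h' : MRuns (.loop (.inr (.bits false)) body) s₁ m₁ t' s₂ m₂) :
    MRuns (.loop (.inr (.bits false)) body) s (ansMem a out bt (b :: bf) c) (t + t' + 1) s₂ m₂ :=
  MRuns.loop_cons (k := .inr (.bits false)) rfl
    ((Mem.update_bits _ _ _).trans (congrArg Mem.stk setBits_false_ansMem)) h h'

def moveToFalse : Prog (Alph A B) σ :=
  .loop (.inr (.bits true)) fun b => .push (.inr (.bits false)) fun _ => b

theorem moveToFalse_spec : MRuns moveToFalse s (ansMem a out bt bf c : Mem A B)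
    (2 * bt.length + 1) s (ansMem a out [] (bt.reverse ++ bf) c) := by
  induction bt generalizing bf with
  | nil => exact (MRuns.loop_nil rfl).mono (by simp)
  | cons b bt ih =>
    refine (loopTrue_cons pushFalse_spec ih).conv ?_ ?_
    · rw [List.length_cons]; omega
    · simp

def moveToTrue : Prog (Alph A B) σ :=
  .loop (.inr (.bits false)) fun b => .push (.inr (.bits true)) fun _ => b

theorem moveToTrue_spec : MRuns moveToTrue s (ansMem a out bt bf c : Mem A B)
    (2 * bf.length + 1) s (ansMem a out (bf.reverse ++ bt) [] c) := by
  induction bf generalizing bt with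
  | nil => exact (MRuns.loop_nil rfl).mono (by simp)
  | cons b bf ih =>
    refine (loopFalse_cons pushTrue_spec ih).conv ?_ ?_
    · rw [List.length_cons]; omega
    · simp

def moveToOutput : Prog (Alph A B) σ :=
  .loop (.inr (.bits true)) fun b => .push (.inl .output) fun _ => b

theorem moveToOutput_spec : MRuns moveToOutput s (ansMem a out bt bf c : Mem A B)
    (2 * bt.length + 1) s (ansMem a (bt.reverse ++ out) [] bf c) := by
  induction bt generalizing out with
  | nil => exact (MRuns.loop_nil rfl).mono (by simp)
  | cons b bt ih =>
    refine (loopTrue_cons (m₁ := ansMem a (b :: out) bt bf c) MRuns.pushOutput ih).conv ?_ ?_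
    · rw [List.length_cons]; omega
    · simp

/-- Read one digit of the answer. -/
def readBit : Prog (Alph A B) (Bool × σ) :=
  .seq (.pop (.inl .answer) fun s o => (o.getD false, s.2))
    (.seq (.push (.inr (.bits true)) Prod.fst) (.load fun s => (false, s.2)))

theorem readBit_spec {r : σ} {y : List Bool} (i : ℕ) :
    MRuns readBit (false, r)
      (ansMem (y.drop i) out (((List.range i).map fun i => y.getD i false).reverse ++ bt) bf c :
        Mem A B) 3 (false, r)
      (ansMem (y.drop (i + 1)) out
        (((List.range (i + 1)).map fun i => y.getD i false).reverse ++ bt) bf c) := by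
  have h1 := MRuns.popAnswer (s := (false, r)) (f := fun s o => (o.getD false, s.2))
    (m := (ansMem (y.drop i) out (((List.range i).map fun i => y.getD i false).reverse ++ bt) bf c :
        Mem A B))
  refine (h1.seq ((pushTrue_spec (a := (y.drop i).tail) (f := Prod.fst)).seq
    MRuns.load)).conv le_rfl ?_
  rw [List.tail_drop, List.range_succ, List.map_append, List.reverse_append]
  simp [ansMem]

/-- Read `P * L + 1` digits of the answer, where `P` is the value of the counter `tmp`. -/
def readAnswer (L : ℕ) : Prog (Alph A B) (Bool × σ) :=
  .seq (.push (.inr (.bits true)) fun _ => false)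
    (.seq (.loop (.inr (.ctr .tmp)) fun _ => Prog.iter readBit L) readBit)

/-- The number of digits read is fixed by `P` and `L`: run-time must be bounded even if an oracle
returns huge numbers. Missing digits are read as `0`. The digit `false` at the bottom doubles the
number, which prepares the rounding. -/
theorem readAnswer_spec (L : ℕ) {r : σ} {y : List Bool} (b P : ℕ) :
    MRuns (readAnswer L) (false, r) (ansMem y [] [] [] (ctrs 0 0 b 0 0 P P) : Mem A B)
      (P * (L * 3 + 2) + 5) (false, r)
      (ansMem (y.drop (P * L + 1)) []
        (((List.range (P * L + 1)).map fun i => y.getD i false).reverse ++ [false]) []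
        (ctrs 0 0 b 0 0 0 P)) := by
  have h1 := MRuns.loopCtr (A := A) (B := B) (s := (false, r)) (c := .tmp) (t := L * 3 + 1) (k := P)
    (body := fun _ => Prog.iter readBit L)
    (fun i => ansMem (y.drop (i * L)) []
        (((List.range (i * L)).map fun i => y.getD i false).reverse ++ [false]) []
        (ctrs 0 0 b 0 0 P P)) (by
      intro i _ x
      have := Prog.runs_iter (p := readBit) (n := L) (B := 3) (fun j => (((false, r) : Bool × σ),
        (ansMem (y.drop (i * L + j)) []
          (((List.range (i * L + j)).map fun i => y.getD i false).reverse ++ [false]) []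
          (ctrs 0 0 b 0 0 x P) : Mem A B).stk)) (fun j _ => readBit_spec (i * L + j))
      rw [setCtr_ansMem, setCtr_ansMem, update_ctrs_tmp, Nat.succ_mul]
      exact this)
  simp only [setCtr_ansMem, update_ctrs_tmp, Nat.zero_mul] at h1
  refine (pushTrue_spec.seq (h1.seq (readBit_spec (P * L)))).mono ?_
  nlinarith

/-- One step of long division by `w`: the second component of the store is the remainder. -/
def divide : Prog (Alph A B) (Bool × Fin w) :=
  .seq (.loop (.inr (.bits true)) fun b =>
      .seq (.push (.inr (.bits false)) fun s => decide (w ≤ 2 * s.2.val + b.toNat))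
        (.load fun s => (s.1, Fin.ofNat w (2 * s.2.val + b.toNat))))
    (.seq moveToTrue (.load fun s => (s.1, 0)))

/-- Invariant of long division: quotient times `w` plus remainder is the value of the digits
consumed so far. Digits come from the most significant one downwards, and quotient digits are pushed
in this order, so the least significant ends on top. -/
theorem divideLoop_spec (bt : List Bool) (r : Fin w) (bf : List Bool) :
    ∃ (bf' : List Bool) (r' : Fin w), bf'.length = bf.length + bt.length ∧
      ofBits bf' * w + r' = (ofBits bf * w + r) * 2 ^ bt.length + ofBits bt.reverse ∧
      ∀ (f : Bool) (c : Ctr → ℕ), MRuns (.loop (.inr (.bits true)) fun b =>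
          .seq (.push (.inr (.bits false)) fun s => decide (w ≤ 2 * s.2.val + b.toNat))
            (.load fun s => (s.1, Fin.ofNat w (2 * s.2.val + b.toNat))))
        (f, r) (ansMem a out bt bf c : Mem A B) (3 * bt.length + 1) (f, r')
        (ansMem a out [] bf' c) := by
  induction bt generalizing r bf with
  | nil => exact ⟨bf, r, rfl, by simp [ofBits], fun f c => MRuns.loop_nil rfl⟩
  | cons b bt ih =>
    obtain ⟨bf', r', hl, hv, h⟩ := ih (Fin.ofNat w (2 * r.val + b.toNat))
      (decide (w ≤ 2 * r.val + b.toNat) :: bf)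
    refine ⟨bf', r', by rw [hl, List.length_cons, List.length_cons]; omega, ?_, fun f c => ?_⟩
    -- As `r < w`, we have `2 * r + b < 2 * w`, so the quotient digit is `0` or `1`.
    · have key : (decide (w ≤ 2 * r.val + b.toNat)).toNat * w + (2 * r.val + b.toNat) % w =
          2 * r.val + b.toNat := by
        have hr := r.2
        have hb := b.toNat_le
        by_cases hw : w ≤ 2 * r.val + b.toNat
        · rw [decide_eq_true hw, Nat.mod_eq_sub_mod hw, Nat.mod_eq_of_lt (by omega)]
          simp only [Bool.toNat_true]
          omega
        · rw [decide_eq_false hw, Nat.mod_eq_of_lt (by omega)]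
          simp
      rw [hv, ofBits_cons, List.reverse_cons, ofBits_append, List.length_reverse, List.length_cons]
      rw [Fin.val_ofNat, Nat.add_mul (2 * ofBits bf), Nat.add_assoc (_ * w), key, ofBits_cons]
      simp only [ofBits, List.foldr_nil]
      ring
    · refine (loopTrue_cons (pushFalse_spec.seq MRuns.load) (h f c)).mono ?_
      rw [List.length_cons]
      omega

theorem divide_spec (bt : List Bool) : ∃ bt' : List Bool, bt'.length = bt.length ∧
    ofBits bt'.reverse = ofBits bt.reverse / w ∧ ∀ (f : Bool) (c : Ctr → ℕ),
      MRuns divide ((f, 0) : Bool × Fin w) (ansMem a out bt [] c : Mem A B)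
        (5 * bt.length + 3) (f, 0) (ansMem a out bt' [] c) := by
  obtain ⟨bf, r, hl, hv, h⟩ :=
    divideLoop_spec (A := A) (B := B) (a := a) (out := out) bt (0 : Fin w) []
  rw [List.length_nil, Nat.zero_add] at hl
  refine ⟨bf.reverse, by rw [List.length_reverse, hl], ?_, fun f c => ?_⟩
  · rw [List.reverse_reverse]
    have h0 : ofBits ([] : List Bool) = 0 := rfl
    rw [h0, Fin.val_zero, Nat.zero_mul, Nat.zero_add, Nat.zero_mul, Nat.zero_add] at hv
    rw [← hv, Nat.add_comm, Nat.add_mul_div_right _ _ (Nat.pos_of_neZero w),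
      Nat.div_eq_of_lt r.2, Nat.zero_add]
  · refine ((h f c).seq (moveToTrue_spec.seq MRuns.load)).conv ?_ ?_
    · omega
    · rw [List.append_nil]

/-- Divide by `w ^ P`, where `P` is the value of the counter `cells`. -/
theorem divideLoop_cells_spec (bt : List Bool) (b P : ℕ) : ∃ bt' : List Bool,
    bt'.length = bt.length ∧ ofBits bt'.reverse = ofBits bt.reverse / w ^ P ∧
      MRuns (.loop (.inr (.ctr .cells)) fun _ => divide) ((false, 0) : Bool × Fin w)
        (ansMem a out bt [] (ctrs 0 0 b 0 0 0 P) : Mem A B) (P * (5 * bt.length + 4) + 1) (false, 0)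
        (ansMem a out bt' [] (ctrs 0 0 b 0 0 0 0)) := by
  choose g hl hv h using divide_spec (A := A) (B := B) (w := w) (a := a) (out := out)
  have hl' : ∀ i, (g^[i] bt).length = bt.length := by
    intro i
    induction i with
    | zero => rfl
    | succ i ih => rw [Function.iterate_succ_apply', hl, ih]
  have hv' : ∀ i, ofBits (g^[i] bt).reverse = ofBits bt.reverse / w ^ i := by
    intro i
    induction i with
    | zero => simp
    | succ i ih => rw [Function.iterate_succ_apply', hv, ih, Nat.div_div_eq_div_mul, pow_succ]
  refine ⟨g^[P] bt, hl' P, hv' P, ?_⟩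
  have h1 := MRuns.loopCtr (A := A) (B := B) (s := ((false, 0) : Bool × Fin w)) (c := .cells)
    (t := 5 * bt.length + 3) (k := P) (body := fun _ => divide)
    (fun i => ansMem a out (g^[i] bt) [] (ctrs 0 0 b 0 0 0 P)) (by
      intro i _ x
      have := h (g^[i] bt) false (ctrs 0 0 b 0 0 0 x)
      rw [hl', ← Function.iterate_succ_apply' g] at this
      simpa only [setCtr_ansMem, update_ctrs_cells] using this)
  simp only [setCtr_ansMem, update_ctrs_cells] at h1
  exact h1

/-- Add the carry bit to a number. -/
def addCarry : Prog (Alph A B) (Bool × σ) :=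
  .loop (.inr (.bits false)) fun b =>
    .seq (.push (.inr (.bits true)) fun s => xor b s.1) (.load fun s => (b && s.1, s.2))

theorem addCarry_spec (bf : List Bool) (f : Bool) (bt : List Bool) (r : σ) :
    ∃ (l : List Bool) (f' : Bool), l.length = bf.length ∧
      ofBits l + f'.toNat * 2 ^ bf.length = ofBits bf + f.toNat ∧
      MRuns addCarry (f, r) (ansMem a out bt bf c : Mem A B) (3 * bf.length + 1) (f', r)
        (ansMem a out (l.reverse ++ bt) [] c) := by
  induction bf generalizing f bt with
  | nil => exact ⟨[], f, rfl, by simp, MRuns.loop_nil rfl⟩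
  | cons b bf ih =>
    obtain ⟨l, f', hl, hv, h⟩ := ih (b && f) (xor b f :: bt)
    refine ⟨xor b f :: l, f', by rw [List.length_cons, hl, List.length_cons], ?_, ?_⟩
    · rw [ofBits_cons, ofBits_cons, List.length_cons, pow_succ]
      have hb : (xor b f).toNat + 2 * (b && f).toNat = b.toNat + f.toNat := by
        cases b <;> cases f <;> rfl
      nlinarith
    · refine (loopFalse_cons (pushTrue_spec.seq MRuns.load) h).conv ?_ ?_
      · rw [List.length_cons]
        omega
      · simp

/-- Compute `(V + 1) / 2` for the number `V` on the stack. -/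
def halveUp : Prog (Alph A B) (Bool × σ) :=
  .seq moveToFalse (.seq (.load fun s => (true, s.2)) (.seq addCarry
    (.seq (.push (.inr (.bits true)) Prod.fst)
      (.seq moveToOutput (.pop (.inl .output) fun s _ => s)))))

/-- Add `1` as an initial carry, append the final carry as most significant digit, and drop the
least significant digit. -/
theorem halveUp_spec (bt : List Bool) (f : Bool) (r : σ) : ∃ (s : Bool × σ) (out : List Bool),
    ofBits out = (ofBits bt.reverse + 1) / 2 ∧
    MRuns halveUp (f, r) (ansMem a [] bt [] c : Mem A B) (7 * bt.length + 8) s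
      (ansMem a out [] [] c) := by
  obtain ⟨l, f', hl, hv, h⟩ := addCarry_spec (A := A) (B := B) (a := a) (out := []) (c := c)
    (bt.reverse ++ []) true [] r
  refine ⟨(f', r), (l ++ [f']).tail, ?_, ?_⟩
  · rw [ofBits_tail, ofBits_append, ofBits_cons, hl]
    rw [List.append_nil] at hv ⊢
    simp only [ofBits, List.foldr_nil, Bool.toNat_true] at hv ⊢
    rw [← hv]
    congr 1
    ring
  · rw [List.length_append, List.length_reverse, List.length_nil, Nat.add_zero] at hl
    have h6 := MRuns.popOutput (s := (f', r)) (f := fun s _ => s)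
      (m := (ansMem a ((f' :: (l.reverse ++ [])).reverse ++ []) [] [] c : Mem A B))
    refine (moveToFalse_spec.seq (MRuns.load.seq (h.seq (pushTrue_spec.seq
      (moveToOutput_spec.seq h6))))).conv ?_ ?_
    · simp only [List.length_append, List.length_reverse, List.length_nil, List.length_cons, hl]
      omega
    · simp [ansMem]

/-- The computation after the oracle call. -/
def postprocess (L : ℕ) : Prog (Alph A B) (Bool × Fin w) :=
  .seq (readAnswer L) (.seq (.loop (.inr (.ctr .cells)) fun _ => divide) halveUp)

/-- The time bound holds for all `Y`, while the output matters only for answers that fit into the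
digits read. -/
theorem postprocess_spec (L b P Y : ℕ) : ∃ (s : Bool × Fin w) (m : Mem A B),
    (Y < 2 ^ (P * L + 1) → ofBits m.output = (2 * Y / w ^ P + 1) / 2) ∧
    MRuns (postprocess L) ((false, 0) : Bool × Fin w)
      (ansMem (Nat.bits Y) [] [] [] (ctrs 0 0 b 0 0 P P))
      (P * (L * 3 + 2) + P * (5 * (P * L + 2) + 4) + 7 * (P * L + 2) + 14) s m := by
  have h1 := readAnswer_spec (A := A) (B := B) L (r := (0 : Fin w)) (y := Nat.bits Y) b P
  set y := ((List.range (P * L + 1)).map fun i => (Nat.bits Y).getD i false).reverse ++ [false]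
    with hy
  obtain ⟨bt, hl, hv, h2⟩ := divideLoop_cells_spec (A := A) (B := B) (w := w)
    (a := (Nat.bits Y).drop (P * L + 1)) (out := []) y b P
  obtain ⟨s, out, ho, h3⟩ := halveUp_spec (A := A) (B := B) (a := (Nat.bits Y).drop (P * L + 1))
    (c := ctrs 0 0 b 0 0 0 0) bt false (0 : Fin w)
  refine ⟨s, _, fun hY => ?_, (h1.seq (h2.seq h3)).mono ?_⟩
  · change ofBits out = _
    rw [ho, hv, hy, List.reverse_append, List.reverse_reverse]
    rw [List.reverse_singleton, List.singleton_append, ofBits_cons, ofBits_map_getD, ofBits_bits]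
    · rfl
    · rw [Nat.size_eq_bits_len]
      exact Nat.size_le.mpr hY
  · have : y.length = P * L + 2 := by simp [hy]
    rw [hl, this]
    omega

end Answer

/-! ### Rounding -/

theorem exp_le_one_add_two_mul {x : ℝ} (h0 : 0 ≤ x) (h1 : x ≤ 1 / 2) :
    Real.exp x ≤ 1 + 2 * x := by
  have h := Real.one_sub_le_exp_neg x
  rw [Real.exp_neg] at h
  have hx : 0 < 1 - x := by linarith
  have h2 : Real.exp x ≤ (1 - x)⁻¹ := by
    rw [← inv_inv (Real.exp x)]
    exact inv_anti₀ hx h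
  refine h2.trans ?_
  rw [inv_le_iff_one_le_mul₀ hx]
  nlinarith

theorem exp_neg_le_one_sub_half {x : ℝ} (h0 : 0 ≤ x) (h1 : x ≤ 1) :
    Real.exp (-x) ≤ 1 - x / 2 := by
  have h := Real.add_one_le_exp x
  rw [Real.exp_neg]
  have hx : 0 < x + 1 := by linarith
  refine (inv_anti₀ hx h).trans ?_
  rw [inv_le_iff_one_le_mul₀ hx]
  nlinarith

/-- Rounding a good approximation of `Z * W` divided by `W` to the nearest integer. -/
theorem round_mem_goodApprox {Z W Y N : ℕ} (hW : 0 < W) (hN : 2 ≤ N)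
    (hY : Y ∈ goodApprox (Z * W) (8 * N)) : (2 * Y / W + 1) / 2 ∈ goodApprox Z N := by
  obtain ⟨h1, h2⟩ := hY
  obtain ⟨Q, hQ⟩ : ∃ Q, 2 * Y / W = Q := ⟨_, rfl⟩
  rw [hQ]
  set R := (Q + 1) / 2 with hR
  set ε : ℝ := 1 / (N : ℝ) with hε
  have hN' : (2 : ℝ) ≤ N := by exact_mod_cast hN
  have hε0 : 0 < ε := by positivity
  have hε1 : ε ≤ 1 / 2 := by
    rw [hε]
    exact one_div_le_one_div_of_le (by norm_num) hN'
  have hδ : 1 / ((8 * N : ℕ) : ℝ) = ε / 8 := by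
    rw [hε]; push_cast; field_simp
  rw [hδ] at h1 h2
  have hW' : (0 : ℝ) < W := by exact_mod_cast hW
  have hZ : (0 : ℝ) ≤ Z := Nat.cast_nonneg Z
  -- `R` is the nearest integer
  have r1 : (2 * R - 1 : ℝ) * W ≤ 2 * Y := by
    have h3 : (2 * R - 1) * W ≤ 2 * Y :=
      (Nat.mul_le_mul_right W (by omega)).trans (hQ ▸ Nat.div_mul_le_self (2 * Y) W)
    rcases Nat.eq_zero_or_pos R with h0 | h0
    · rw [h0]
      have : (0 : ℝ) ≤ Y := Nat.cast_nonneg Y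
      push_cast
      nlinarith
    · have h4 : ((2 * R - 1 : ℕ) : ℝ) = 2 * R - 1 := by
        rw [Nat.cast_sub (by omega)]; push_cast; ring
      rw [← h4]
      exact_mod_cast h3
  have r2 : (2 * Y : ℝ) < (2 * R + 1) * W := by
    have h3 : 2 * Y < (2 * R + 1) * W := by
      have h4 := Nat.lt_div_mul_add (a := 2 * Y) hW
      rw [hQ] at h4
      have h5 : (Q + 1) * W ≤ (2 * R + 1) * W := Nat.mul_le_mul_right W (by omega)
      nlinarith
    exact_mod_cast h3
  have e1 := exp_le_one_add_two_mul (x := ε / 8) (by positivity) (by linarith)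
  have e2 := Real.one_sub_le_exp_neg (ε / 8)
  have e3 := Real.add_one_le_exp ε
  have e4 := exp_neg_le_one_sub_half (x := ε) hε0.le (by linarith)
  push_cast at h1 h2
  have b1 : (Y : ℝ) ≤ (1 + ε / 4) * Z * W := by
    have : Real.exp (ε / 8) * (Z * W) ≤ (1 + 2 * (ε / 8)) * (Z * W) := by gcongr
    linarith
  have b2 : (1 - ε / 8) * Z * W ≤ (Y : ℝ) := by
    have : (1 - ε / 8) * (Z * W) ≤ Real.exp (-(ε / 8)) * (Z * W) := by gcongr
    linarith
  have c1 : (2 * R - 1 : ℝ) ≤ 2 * ((1 + ε / 4) * Z) := by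
    refine le_of_mul_le_mul_right ?_ hW'
    linarith
  have c2 : 2 * ((1 - ε / 8) * Z) < (2 * R + 1 : ℝ) := by
    refine lt_of_mul_lt_mul_right ?_ hW'.le
    linarith
  have d1 : (1 - ε / 2) * (Z : ℝ) ≤ R ∧ (R : ℝ) ≤ (1 + ε) * Z := by
    have hεZ : 0 ≤ ε * Z := by positivity
    -- If `ε / 4 * Z < 1 / 2`, then `Y / W` is so close to `Z` that rounding returns `Z`. Otherwise
    -- the rounding error `1 / 2` is at most `ε / 4 * Z`.
    rcases lt_or_ge (ε / 4 * Z) (1 / 2) with h | h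
    · have hRZ : R = Z := by
        have h3 : (R : ℝ) < Z + 1 := by nlinarith
        have h4 : (Z : ℝ) < R + 1 := by nlinarith
        have h3' : R < Z + 1 := by exact_mod_cast h3
        have h4' : Z < R + 1 := by exact_mod_cast h4
        omega
      rw [hRZ]
      constructor <;> nlinarith
    · constructor <;> nlinarith
  exact ⟨(mul_le_mul_of_nonneg_right e4 hZ).trans d1.1,
    d1.2.trans (mul_le_mul_of_nonneg_right (by linarith) hZ)⟩

/-- For error bounds up to `1 / 4` the approximation ratio is less than `2`, so one digit more than
for `v` suffices. -/
theorem lt_two_pow_of_mem_goodApprox {v N Y k : ℕ} (hN : 4 ≤ N) (hv : v ≤ 2 ^ k)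
    (hY : Y ∈ goodApprox v N) : Y < 2 ^ (k + 1) := by
  have hN' : (4 : ℝ) ≤ N := by exact_mod_cast hN
  have h1 : 1 / (N : ℝ) ≤ 1 / 4 := one_div_le_one_div_of_le (by norm_num) hN'
  have h2 := exp_le_one_add_two_mul (x := 1 / (N : ℝ)) (by positivity) (by linarith)
  have hv' : (v : ℝ) ≤ 2 ^ k := by exact_mod_cast hv
  have h3 : (Y : ℝ) ≤ (1 + 2 * (1 / (N : ℝ))) * 2 ^ k :=
    hY.2.trans (mul_le_mul h2 hv' (Nat.cast_nonneg _) (by positivity))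
  have h4 : (Y : ℝ) < 2 ^ (k + 1) := by
    rw [pow_succ]
    have : (0 : ℝ) < 2 ^ k := by positivity
    nlinarith
  exact_mod_cast h4

/-! ### Size bounds, run-time and assembly of the reduction. -/

theorem CSPInstance.Z_le {Γ : ConstraintLanguage} (I : CSPInstance Γ) : I.Z ≤ 2 ^ I.numVars := by
  have h := Set.ncard_le_ncard (Set.subset_univ {s : Fin I.numVars → Bool | I.Satisfies s})
  rwa [Set.ncard_univ, Nat.card_eq_fintype_card, Fintype.card_fun, Fintype.card_bool,
    Fintype.card_fin] at h

theorem CSPInstance.numVars_le {Γ : ConstraintLanguage} (I : CSPInstance Γ) :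
    I.numVars ≤ I.encode.length := by
  rw [CSPInstance.encode, encodeNum]
  simp only [List.length_append, List.length_replicate]
  omega

theorem CSPInstance.length_occ_le {Γ : ConstraintLanguage} (I : CSPInstance Γ) :
    (occ I.constraints).length ≤ I.encode.length := by
  have h : ∀ cs : List (Constraint Γ I.numVars),
      (occ cs).length ≤ (cs.flatMap encodeConstraint).length := by
    intro cs
    induction cs with
    | nil => simp [occ]
    | cons c cs ih =>
      have h1 : (occ (c :: cs)).length = c.1.1.1 + (occ cs).length := by simp [occ]
      have h2 : ∀ l : List ℕ, l.length ≤ (l.flatMap (encodeNum Γ)).length := by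
        intro l
        induction l with
        | nil => simp
        | cons v l ih =>
          simp only [List.flatMap_cons, List.length_append, List.length_cons, encodeNum,
            List.length_replicate, List.length_nil]
          omega
      have h3 : c.1.1.1 ≤ (encodeConstraint c).length := by
        rw [encodeConstraint_eq, encodeCon, List.length_cons]
        refine le_trans ?_ (Nat.le_succ_of_le (h2 _))
        rw [List.length_ofFn]
        exact le_rfl
      rw [h1, List.flatMap_cons, List.length_append]
      omega
  rw [CSPInstance.encode, List.length_append]
  exact (h I.constraints).trans (Nat.le_add_left _ _)

/-- Bound for the run-time of `prepare`, for an input of length `ℓ` and `P` cells. -/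
def prepareTime (L o K ℓ P N : ℕ) : ℕ :=
  3 * (ℓ * (P * (L + 11) + o + 9) + P * (K * (P + 1) + 5) + 4) + P * (L + 4) + 10 * N + 4

/-- Bound for the run-time of `postprocess`, for `P` cells. -/
def postprocessTime (L P : ℕ) : ℕ :=
  P * (L * 3 + 2) + P * (5 * (P * L + 2) + 4) + 7 * (P * L + 2) + 14

theorem exists_polynomial_time (L o K : ℕ) : ∃ p : Polynomial ℕ, ∀ x, p.eval x =
    prepareTime L o K x ((x + 2) * x) x + postprocessTime L ((x + 2) * x) + 2 := by
  let X : Polynomial ℕ := Polynomial.X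
  let P : Polynomial ℕ := (X + 2) * X
  let l : Polynomial ℕ := Polynomial.C L
  refine ⟨(3 * (X * (P * (l + 11) + Polynomial.C o + 9) + P * (Polynomial.C K * (P + 1) + 5) + 4) +
    P * (l + 4) + 10 * X + 4) + (P * (l * 3 + 2) + P * (5 * (P * l + 2) + 4) + 7 * (P * l + 2) + 14)
    + 2, fun x => ?_⟩
  simp only [X, P, l, prepareTime, postprocessTime, Polynomial.eval_add, Polynomial.eval_mul,
    Polynomial.eval_X, Polynomial.eval_C, Polynomial.eval_ofNat, Polynomial.eval_one]

theorem initStk_eq {Γ Δ : ConstraintLanguage} (x : List (Sym Γ)) (N : ℕ) :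
    (OracleMachine.initStk x N : ∀ k, List (Alph (Sym Γ) (Sym Δ) k)) =
      (prepMem x N [] (ctrs 0 0 0 0 0 0 0)).stk := by
  funext k
  rcases k with k | k
  · cases k <;> rfl
  · rcases k with c | _ | _
    · cases c <;> rfl
    · rfl
    · rfl

theorem answerStk_eq {Γ Δ : ConstraintLanguage} (q : List (Sym Δ)) (e : ℕ) (c : Ctr → ℕ) (Y : ℕ) :
    OracleMachine.answerStk (queryMem (Γ := Γ) 0 q e c).stk Y =
      (ansMem (Nat.bits Y) [] [] [] c : Mem (Sym Γ) (Sym Δ)).stk := by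
  funext k
  rcases k with k | k
  · cases k <;> rfl
  · rcases k with _ | _ | b
    · rfl
    · rfl
    · cases b <;> rfl

/-- The reduction, given gadgets for the binary and a sufficiently large equality relation. -/
theorem apReducible_of_gadgets {Γ Δ : ConstraintLanguage} {d : ℕ} (hΓ : Γ ⊆ Δ) (H : Gadget Δ d 2)
    (G : Gadget Δ d (2 * H.entries + 2)) : APReducible (numCSP Γ) (numCSPDeg d Δ) := by
  set w := 2 * H.m * G.m ^ H.numVars with hw
  have hw0 : 0 < w := by
    have := H.m_pos
    have := G.m_pos
    positivity
  have : NeZero w := ⟨hw0.ne'⟩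
  set L := H.numVars * G.numVars with hL
  obtain ⟨K, hK⟩ := prepare_spec (Γ := Γ) (σ := Fin w) L (template H G) hΓ (2 * H.entries)
  obtain ⟨p, hp⟩ := exists_polynomial_time L (2 * H.entries) K
  refine apReducible_of_progs p (prepare L (template H G) hΓ (2 * H.entries)) (postprocess L)
    (true, (0 : Fin w)) ?_
  intro I N hN
  change CSPInstance Γ at I
  obtain ⟨P, hP⟩ : ∃ P, P = ((occ I.constraints).length + 2) * I.numVars := ⟨_, rfl⟩
  have hrun := hK I N _ P 0 rfl hP
  set J := boundedInstance hΓ H G I with hJ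
  have hJn : J.numVars = P * L := by
    rw [hP, hL, ← mul_assoc]
    rfl
  have henc := boundedInstance_encode hΓ H G I
  rw [← hP, ← hL] at henc
  rw [← henc] at hrun
  -- The time bounds are monotone in all arguments, and `P ≤ (x + 2) * x` for `x = |I| + N`, since
  -- both the variables and the occurrences of `I` are at most as many as the symbols of its code.
  have hB : prepareTime L (2 * H.entries) K I.encode.length P N + postprocessTime L P + 2 ≤
      p.eval (I.encode.length + N) := by
    have h1 := I.length_occ_le
    have h2 := I.numVars_le
    have hPx : P ≤ (I.encode.length + N + 2) * (I.encode.length + N) := by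
      rw [hP]
      exact Nat.mul_le_mul (by omega) (by omega)
    have hℓ : I.encode.length ≤ I.encode.length + N := by omega
    have hNx : N ≤ I.encode.length + N := by omega
    rw [hp, prepareTime, prepareTime, postprocessTime, postprocessTime]
    gcongr
  have hlen : ∀ c, ((queryMem (Γ := Γ) 0 J.encode (8 * N) c).stk (.inl .queryErr)).length = 8 * N :=
    fun c => List.length_replicate
  refine ⟨⟨J, boundedInstance_degree hΓ H G I⟩, prepareTime L (2 * H.entries) K I.encode.length P N,
    postprocessTime L P, ((false, 0), (queryMem 0 J.encode (8 * N)
      (ctrs 0 0 (((occ I.constraints).length + 1) * I.numVars) 0 0 P P)).stk), ?_, rfl, ?_, ?_, hB, ?_⟩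
  · change Prog.Runs _ (_, OracleMachine.initStk I.encode N) _ _
    rw [initStk_eq]
    exact hrun
  · exact (show 2 ≤ 8 * N by omega).trans_eq (hlen _).symm
  · refine (hlen _).trans_le (le_trans ?_ hB)
    rw [prepareTime]
    omega
  · intro Y
    obtain ⟨s, m, hm, hr⟩ := postprocess_spec (A := Sym Γ) (B := Sym Δ) (w := w) L
      (((occ I.constraints).length + 1) * I.numVars) P Y
    refine ⟨(s, m.stk), ?_, fun hY => ?_⟩
    · rw [answerStk_eq]
      exact hr
    · have hY' : Y ∈ goodApprox J.Z (8 * N) := by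
        rw [← hlen]
        exact hY
      -- `J` has `P * L` variables, so a good answer has at most the `P * L + 1` digits that are
      -- read.
      have hlt := lt_two_pow_of_mem_goodApprox (by omega) (hJn ▸ J.Z_le) hY'
      rw [hJ, boundedInstance_Z, ← hP, ← hw] at hY'
      change ofBits m.output ∈ _
      rw [hm hlt]
      exact round_mem_goodApprox (pow_pos hw0 P) hN hY'

end BoolCSP

end

theorem proposition4p1 (Γ : BoolCSP.ConstraintLanguage) (d : ℕ)
    (h : BoolCSP.DSimulatesEquality d Γ) :
    BoolCSP.APReducible (BoolCSP.numCSP Γ)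
      (BoolCSP.numCSPDeg d (Γ ∪ BoolCSP.pinLanguage)) := by
  obtain ⟨H⟩ := BoolCSP.exists_gadget (by omega) (h 2 le_rfl)
  -- `H` is chosen before `G`, because the arity required of `G` depends on `H`. Ports up to number
  -- `2 * H.entries` are needed; the additional `2` also ensures an arity of at least `2`.
  obtain ⟨G⟩ := BoolCSP.exists_gadget (by omega) (h (2 * H.entries + 2) (by omega))
  exact BoolCSP.apReducible_of_gadgets Finset.subset_union_left H G
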